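/- Let $n\ge 2$ and $r\in\mathbb R$. Write $c=1$ for $CP^n(4)$ and $c=-1$ for $CH^n(-4)$; these are the bases of the Hopf fibrations $\pi:S^{2n+1}(1)\to CP^n(4)$ and $\pi:H^{2n+1}_1(-1)\to CH^n(-4)$, where $S^{2n+1}(1)\subset\mathbb C^{n+1}$, $H_1^{2n+1}(-1)=\{z\in\mathbb C^{n+1}_1:\langle z,z\rangle=-1\}$, and $\mathbb C^{n+1}_1$ carries $\langle z,w\rangle=\operatorname{Re}(-z_1\bar w_1+\sum_{j\ge2}z_j\bar w_j)$. A (immersed) non-totally geodesic Lagrangian submanifold of one of these spaces is *$H$-umbilical* with functions $\mu,\varphi$ if near each point there is an orthonormal frame $e_1,\dots,e_n$ such that its second fundamental form satisfies $h(e_j,e_j)=\mu Je_n$, $h(e_j,e_n)=\mu Je_j$ for $j<n$, $h(e_n,e_n)=\varphi Je_n$, and $h(e_j,e_k)=0$ for $j\ne k$, $j,k<n$. It is *of ratio $r$* if $\mu$ has no zeros and $\varphi/\mu=r$. **(1)** There exist (connected, nonempty) $H$-umbilical Lagrangian submanifolds of ratio $r$ in $CP^n(4)$ and in $CH^n(-4)$.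 **(2)** Let $r\ne2$. For $c=\pm1$ there exist nowhere vanishing $C^2$ solutions $\mu:I\to\mathbb R$, on a nonempty open interval $I$, of $$\mu\mu''-\frac{r-3}{r-2}\,\mu'^2+(r-2)\mu^2\big((r-1)\mu^2+c\big)=0,\qquad(*)$$ and each of them gives an $H$-umbilical Lagrangian submanifold of ratio $r$ as follows. (a) $CP^n(4)$. Let $\mu:I\to\mathbb R$ be a nowhere vanishing solution of $(*)$ with $c=1$. There is a smooth unit speed curve $\gamma:I\to S^2(\tfrac12)=\{x\in\mathbb E^3:\langle x,x\rangle=\tfrac14\}$ with curvature $r\mu$ which has horizontal lifts $z=(z_1,z_2):I\to S^3(1)\subset\mathbb C^2$ through the Hopf fibration $(z_1,z_2)\mapsto(z_1\bar z_2,\tfrac12(|z_1|^2-|z_2|^2))$, and is such that every horizontal lift $z$ of $\gamma$ is a unit speed Legendre curve with $z''=ir\mu z'-z$, and $$\psi(x,y)=(z_1(x),z_2(x)y),\qquad x\in I,\ y\in S^{n-1}(1)\subset\mathbb E^n,$$ composed with $\pi$ is an $H$-umbilical Lagrangian immersion of $I\times S^{n-1}$ into $CP^n(4)$ with functions $\mu(x)$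 and $\varphi=r\mu(x)$. (b) $CH^n(-4)$. Let $\mu:I\to\mathbb R$ be a nowhere vanishing solution of $(*)$ with $c=-1$. There is a smooth unit speed curve $\gamma$ on $I$ in the hyperbolic plane $H^2(-\tfrac12)=\{x\in\mathbb E^3_1:x_1^2+x_2^2-x_3^2=-\tfrac14,\ x_3\ge\tfrac12\}$ with curvature $r\mu$ which has horizontal lifts $z:I\to H^3_1(-1)\subset\mathbb C^2_1$ through the Hopf fibration $(z_1,z_2)\mapsto(z_1\bar z_2,\tfrac12(|z_1|^2+|z_2|^2))$, and is such that every horizontal lift $z$ of $\gamma$ is a unit speed Legendre curve with $z''=ir\mu z'+z$, and $\pi\circ\psi$ is an $H$-umbilical Lagrangian immersion into $CH^n(-4)$ with functions $\mu(x)$ and $\varphi=r\mu(x)$, where $\psi$ is determined by $E=\mu^2+\big(\tfrac{\mu'}{(r-2)\mu}\big)^2-1$, which is everywhere positive, everywhere negative or identically zero on $I$: * if $E>0$: $\psi(x,y)=(z_1(x),z_2(x)y)$ on $I\times S^{n-1}(1)$; * if $E<0$: $\psi(x,y)=(z_1(x)y,z_2(x))$ on $I\times\{y\in\mathbb E^n_1:\langle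 y,y\rangle=-1,\ y_1>0\}$; * if $E=0$: $\psi(x,u)=\big(z_1+\tfrac{|u|^2}2(z_1-z_2),\ z_2+\tfrac{|u|^2}2(z_1-z_2),\ (z_1-z_2)u\big)$ on $I\times\mathbb E^{n-1}$, with $z=z(x)$. In both cases the curvature of $\gamma$ is signed with respect to the orientation given by the complex structure that the Hopf fibration induces on the surface. -/

import Mathlib

open scoped Manifold ContDiff ComplexConjugate

noncomputable section

namespace SpaceForms

/-! ### The flat spaces, the unit quadrics and the Hopf fibration

Throughout `c = 1` is the elliptic case and `c = -1` the hyperbolic one. -/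

/-- Signature of the Hermitian form: `(c, 1, …, 1)`. -/
def sig (c : ℝ) {n : ℕ} : Fin (n + 1) → ℝ := Fin.cons c (fun _ => 1)

/-- The Hermitian form `c z₀ w̄₀ + ∑_{j ≥ 1} z_j w̄_j` on `ℂ^{n+1}`: for `c = 1` the form of the
standard `ℂ^{n+1}`, for `c = -1` the form of the pseudo-Euclidean space `ℂ_1^{n+1}`. -/
def herm (c : ℝ) {n : ℕ} (z w : Fin (n + 1) → ℂ) : ℂ :=
  ∑ j, (sig c j : ℂ) * z j * conj (w j)

/-- The (pseudo-)Euclidean metric `⟨z, w⟩ = Re (herm c z w)`. -/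
def ip (c : ℝ) {n : ℕ} (z w : Fin (n + 1) → ℂ) : ℝ := (herm c z w).re

/-- The sphere `S^{2n+1}(1)` for `c = 1`, the anti-de Sitter space `H_1^{2n+1}(-1)` for
`c = -1`. -/
def Quadric (c : ℝ) (n : ℕ) : Set (Fin (n + 1) → ℂ) := {z | ip c z z = c}

/-- The vector space of complex `(n+1) × (n+1)` matrices (as a function space, so that it carries a
topology and a norm; the choice of the norm plays no role). -/
abbrev Mat (n : ℕ) : Type := Fin (n + 1) → Fin (n + 1) → ℂ

/-- The matrix product. -/
def mmul {n : ℕ} (X Y : Mat n) : Mat n := fun j k => ∑ l, X j l * Y l k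

/-- The Hopf fibration. A point `[z]` of `CP^n` or `CH^n` (a complex line, resp. a negative complex
line) is identified with the `herm`-orthogonal projection of `ℂ^{n+1}` onto that line, whose matrix
is `c z z^* G` with `G = diag (sig c)` when `z` lies on the quadric. -/
def hopf (c : ℝ) {n : ℕ} (z : Fin (n + 1) → ℂ) : Mat n :=
  fun j k => (c : ℂ) * (z j * conj (z k)) * (sig c k : ℂ)

/-- The differential of `hopf c` at `z`, applied to `v`. -/
def dHopf (c : ℝ) {n : ℕ} (z v : Fin (n + 1) → ℂ) : Mat n :=
  fun j k => (c : ℂ) * (v j * conj (z k) + z j * conj (v k)) * (sig c k : ℂ)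

/-! ### `CP^n(4)` and `CH^n(-4)` -/

/-- `CP^n(4)` for `c = 1`, `CH^n(-4)` for `c = -1`: the base of the Hopf fibration. -/
def SpaceForm (c : ℝ) (n : ℕ) : Set (Mat n) := hopf c '' Quadric c n

/-- `X` is tangent to the space form at `P`: it is the image under the differential of the Hopf
fibration of a tangent vector of the quadric at a point over `P`. -/
def IsTangent (c : ℝ) {n : ℕ} (P X : Mat n) : Prop :=
  ∃ z ∈ Quadric c n, hopf c z = P ∧ ∃ v, ip c v z = 0 ∧ X = dHopf c z v

/-- The metric of the space form: the restriction of the bilinear form `(c/2) Re tr (X Y)` on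
matrices. It makes the Hopf fibration a Riemannian submersion, see `metric_dHopf`. -/
def metric (c : ℝ) {n : ℕ} (X Y : Mat n) : ℝ := c / 2 * (∑ j, mmul X Y j j).re

/-- The complex structure of the space form at `P`. On tangent vectors it is induced by
multiplication with `i` on `ℂ^{n+1}`, see `cplx_dHopf`. -/
def cplx {n : ℕ} (P X : Mat n) : Mat n := Complex.I • (mmul X P - mmul P X)

theorem herm_conj {c : ℝ} {n : ℕ} (z w : Fin (n + 1) → ℂ) :
    conj (herm c z w) = herm c w z := by
  simp only [herm, map_sum, map_mul, Complex.conj_ofReal, Complex.conj_conj]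
  exact Finset.sum_congr rfl fun j _ => by ring

theorem herm_self {c : ℝ} {n : ℕ} {z : Fin (n + 1) → ℂ} (hz : z ∈ Quadric c n) :
    herm c z z = c := by
  have h1 : (herm c z z).im = 0 := Complex.conj_eq_iff_im.1 (herm_conj z z)
  exact Complex.ext (by simpa [Quadric, ip] using hz) (by simpa using h1)

/-- The Hopf fibration is a Riemannian submersion: its differential is isometric on the horizontal
space `{v | herm c v z = 0}`. -/
theorem metric_dHopf {c : ℝ} (hc : c = 1 ∨ c = -1) {n : ℕ} {z v w : Fin (n + 1) → ℂ}
    (hz : z ∈ Quadric c n) (hv : herm c v z = 0) (hw : herm c w z = 0) :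
    metric c (dHopf c z v) (dHopf c z w) = ip c v w := by
  have hzv : herm c z v = 0 := by rw [← herm_conj, hv, map_zero]
  have key : (∑ j, mmul (dHopf c z v) (dHopf c z w) j j) =
      (c : ℂ) ^ 2 * (herm c v z * herm c w z + herm c v w * herm c z z +
        herm c z z * herm c w v + herm c z w * herm c z v) := by
    simp only [mmul, dHopf, herm, Finset.sum_mul_sum]
    simp only [← Finset.sum_add_distrib, Finset.mul_sum]
    exact Finset.sum_congr rfl fun j _ => Finset.sum_congr rfl fun l _ => by ring
  have h2 : herm c w v = conj (herm c v w) := (herm_conj v w).symm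
  have hcc : (c : ℂ) ^ 2 = 1 := by rcases hc with rfl | rfl <;> norm_num
  rw [metric, key, hv, hzv, herm_self hz, h2, hcc, ip]
  rcases hc with rfl | rfl <;> simp <;> ring

/-- On horizontal vectors the complex structure corresponds to multiplication with `i`. -/
theorem cplx_dHopf {c : ℝ} (hc : c = 1 ∨ c = -1) {n : ℕ} {z v : Fin (n + 1) → ℂ}
    (hz : z ∈ Quadric c n) (hv : herm c v z = 0) :
    cplx (hopf c z) (dHopf c z v) = dHopf c z (Complex.I • v) := by
  have hzv : herm c z v = 0 := by rw [← herm_conj, hv, map_zero]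
  have hcc : (c : ℂ) * c = 1 := by rcases hc with rfl | rfl <;> norm_num
  have h1 : ∀ j k, mmul (dHopf c z v) (hopf c z) j k =
      (c : ℂ) * c * (v j * herm c z z + z j * herm c z v) * conj (z k) * (sig c k : ℂ) := by
    intro j k
    simp only [mmul, dHopf, hopf, herm, Finset.sum_mul, ← Finset.sum_add_distrib, Finset.mul_sum]
    exact Finset.sum_congr rfl fun l _ => by ring
  have h2 : ∀ j k, mmul (hopf c z) (dHopf c z v) j k =
      (c : ℂ) * c * z j * (herm c v z * conj (z k) + herm c z z * conj (v k)) *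
        (sig c k : ℂ) := by
    intro j k
    simp only [mmul, dHopf, hopf, herm, Finset.sum_mul, ← Finset.sum_add_distrib, Finset.mul_sum]
    exact Finset.sum_congr rfl fun l _ => by ring
  funext j k
  simp only [cplx, Pi.smul_apply, Pi.sub_apply, h1, h2, hcc, hv, hzv, herm_self hz, dHopf,
    smul_eq_mul, map_mul, Complex.conj_I]
  ring

/-! ### Lagrangian immersions and their second fundamental form

Submanifolds are immersions `f : U → SpaceForm c n` of an open subset `U` of a manifold `M`
(modelled on `E` through `I`), with the induced metric on `U`. -/

section Immersions

variable {E : Type} [NormedAddCommGroup E] [NormedSpace ℝ E] {H : Type} [TopologicalSpace H]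
  (I : ModelWithCorners ℝ E H) {M : Type} [TopologicalSpace M] [ChartedSpace H M]

/-- `f_* X` at `p`, for a tangent vector `X` of `M` at `p`. -/
def push {n : ℕ} (f : M → Mat n) (p : M) (X : TangentSpace I p) : Mat n :=
  mfderiv I 𝓘(ℝ, Mat n) f p X

/-- The derivative at `p` in the direction `X p` of the vector field `f_* Y` along `f`, taken in the
vector space of matrices. -/
def flatDeriv {n : ℕ} (f : M → Mat n) (X Y : (q : M) → TangentSpace I q) (p : M) : Mat n :=
  mfderiv I 𝓘(ℝ, Mat n) (fun q => push I f q (Y q)) p (X p)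

/-- `D` is the covariant derivative of `f_* Y` in the direction `X p` for the Levi-Civita
connection of the space form: the tangential part of the flat derivative. -/
def IsCovDeriv (c : ℝ) {n : ℕ} (f : M → Mat n) (X Y : (q : M) → TangentSpace I q) (p : M)
    (D : Mat n) : Prop :=
  IsTangent c (f p) D ∧ ∀ T, IsTangent c (f p) T → metric c (flatDeriv I f X Y p - D) T = 0

/-- `w` is the value at `p` of `h (X, Y)`, with `h` the second fundamental form of `f` in the space
form: the part of the covariant derivative which is normal to `M` (formula of Gauss). -/
def IsSecondFF (c : ℝ) {n : ℕ} (f : M → Mat n) (X Y : (q : M) → TangentSpace I q) (p : M)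
    (w : Mat n) : Prop :=
  IsTangent c (f p) w ∧ (∀ Z : TangentSpace I p, metric c w (push I f p Z) = 0) ∧
    ∃ Z : TangentSpace I p, IsCovDeriv I c f X Y p (push I f p Z + w)

/-- Smoothness on `W` of a vector field of `M`; since `f` is an immersion, it is tested on the
vector field `f_* X`. -/
def SmoothField {n : ℕ} (f : M → Mat n) (X : (q : M) → TangentSpace I q) (W : Set M) : Prop :=
  ContMDiffOn I 𝓘(ℝ, Mat n) ∞ (fun q => push I f q (X q)) W

/-- `f` restricts to a smooth Lagrangian immersion of the open set `U` (of dimension `n`) into the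
space form of complex dimension `n`; the Kähler form is `ω (X, Y) = metric (J X) Y`. -/
structure IsLagrangianOn (c : ℝ) {n : ℕ} (f : M → Mat n) (U : Set M) : Prop where
  dim : Module.finrank ℝ E = n
  isOpen : IsOpen U
  mapsTo : ∀ p ∈ U, f p ∈ SpaceForm c n
  smooth : ContMDiffOn I 𝓘(ℝ, Mat n) ∞ f U
  immersion : ∀ p ∈ U, Function.Injective (push I f p)
  lagrangian : ∀ p ∈ U, ∀ X Y : TangentSpace I p,
    metric c (cplx (f p) (push I f p X)) (push I f p Y) = 0

/-- The second fundamental form vanishes identically on `U`. -/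
def IsTotallyGeodesicOn (c : ℝ) {n : ℕ} (f : M → Mat n) (U : Set M) : Prop :=
  ∀ W ⊆ U, IsOpen W → ∀ X Y : (q : M) → TangentSpace I q,
    SmoothField I f X W → SmoothField I f Y W → ∀ p ∈ W, IsSecondFF I c f X Y p 0

/-- `f` restricts to an `H`-umbilical Lagrangian immersion of `U` into the space form of complex
dimension `n = m + 1`, with the functions `μ` and `φ`: it is not totally geodesic, and near each
point there is an orthonormal frame `e_1, …, e_n` with `h (e_j, e_j) = μ J e_n`,
`h (e_j, e_n) = μ J e_j`, `h (e_n, e_n) = φ J e_n`, `h (e_j, e_k) = 0` for `j ≠ k` below `n`. -/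
structure IsHUmbilicalOn (c : ℝ) {m : ℕ} (f : M → Mat (m + 1)) (U : Set M) (μ φ : M → ℝ) :
    Prop extends IsLagrangianOn I c f U where
  not_totallyGeodesic : ¬ IsTotallyGeodesicOn I c f U
  frame : ∀ p ∈ U, ∃ W : Set M, IsOpen W ∧ p ∈ W ∧ W ⊆ U ∧
    ∃ e : Fin (m + 1) → (q : M) → TangentSpace I q,
      (∀ i, SmoothField I f (e i) W) ∧
      ∀ q ∈ W,
        (∀ i k, metric c (push I f q (e i q)) (push I f q (e k q)) = if i = k then 1 else 0) ∧
        (∀ j : Fin m, IsSecondFF I c f (e j.castSucc) (e j.castSucc) q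
          (μ q • cplx (f q) (push I f q (e (Fin.last m) q)))) ∧
        (∀ j : Fin m, IsSecondFF I c f (e j.castSucc) (e (Fin.last m)) q
          (μ q • cplx (f q) (push I f q (e j.castSucc q)))) ∧
        IsSecondFF I c f (e (Fin.last m)) (e (Fin.last m)) q
          (φ q • cplx (f q) (push I f q (e (Fin.last m) q))) ∧
        (∀ j k : Fin m, j ≠ k → IsSecondFF I c f (e j.castSucc) (e k.castSucc) q 0)

/-- `f` restricts to an `H`-umbilical Lagrangian immersion of `U` whose ratio `φ : μ` is the
constant `r`. -/
def IsHUmbilicalOfRatioOn (c : ℝ) {m : ℕ} (f : M → Mat (m + 1)) (U : Set M) (r : ℝ) : Prop :=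
  ∃ μ φ : M → ℝ, IsHUmbilicalOn I c f U μ φ ∧ ∀ p ∈ U, μ p ≠ 0 ∧ φ p / μ p = r

end Immersions

/-! ### Curves -/

/-- The metric `x₀ y₀ + x₁ y₁ + c x₂ y₂` of `𝔼³` (`c = 1`) or `𝔼³_1` (`c = -1`). -/
def ip3 (c : ℝ) (x y : Fin 3 → ℝ) : ℝ := x 0 * y 0 + x 1 * y 1 + c * (x 2 * y 2)

/-- The sphere `S²(1/2)` of radius `1/2` for `c = 1`, the hyperbolic plane `H²(-1/2)` of curvature
`-4` for `c = -1` (the sheet `x₂ ≥ 1/2`). -/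
def Surface (c : ℝ) : Set (Fin 3 → ℝ) := {x | ip3 c x x = c / 4 ∧ (c = -1 → 1 / 2 ≤ x 2)}

/-- The Hopf fibration of `S³(1)` over `S²(1/2)`, resp. of `H³_1(-1)` over `H²(-1/2)`:
`(z₁, z₂) ↦ (z₁ z̄₂, (|z₁|² - c |z₂|²) / 2)`. -/
def hopf3 (c : ℝ) (z : Fin 2 → ℂ) : Fin 3 → ℝ :=
  ![(z 0 * conj (z 1)).re, (z 0 * conj (z 1)).im, (‖z 0‖ ^ 2 - c * ‖z 1‖ ^ 2) / 2]

/-- `γ` is on `I` a smooth unit speed curve in `S²(1/2)` or `H²(-1/2)` with curvature function `κ`: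
the part of `γ''` tangent to the surface is `κ ν`, with `ν` the unit normal of `γ` in the surface.
The surface is oriented by the complex structure which `hopf3` induces on it, so that the basis
`γ', ν` is positive when `det (γ, γ', ν) < 0`. -/
structure IsUnitSpeedCurve (c : ℝ) (I : Set ℝ) (γ : ℝ → Fin 3 → ℝ) (κ : ℝ → ℝ) : Prop where
  smooth : ContDiffOn ℝ ∞ γ I
  mem : ∀ t ∈ I, γ t ∈ Surface c
  unitSpeed : ∀ t ∈ I, ip3 c (deriv γ t) (deriv γ t) = 1
  curvature : ∀ t ∈ I, ∃ ν : Fin 3 → ℝ, ip3 c ν ν = 1 ∧ ip3 c ν (γ t) = 0 ∧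
    ip3 c ν (deriv γ t) = 0 ∧ Matrix.det (Matrix.of ![γ t, deriv γ t, ν]) < 0 ∧
    ∃ a : ℝ, deriv (deriv γ) t = κ t • ν + a • γ t

/-- `z` is on `I` a horizontal lift of `γ` through `hopf3 c`. -/
structure IsHorizontalLift (c : ℝ) (I : Set ℝ) (γ : ℝ → Fin 3 → ℝ) (z : ℝ → Fin 2 → ℂ) :
    Prop where
  smooth : ContDiffOn ℝ ∞ z I
  mem : ∀ t ∈ I, z t ∈ Quadric c 1
  lift : ∀ t ∈ I, hopf3 c (z t) = γ t
  horizontal : ∀ t ∈ I, ip c (deriv z t) (Complex.I • z t) = 0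

/-- `z` is on `I` a unit speed Legendre curve in `S³(1)` or `H³_1(-1)`. -/
structure IsUnitSpeedLegendre (c : ℝ) (I : Set ℝ) (z : ℝ → Fin 2 → ℂ) : Prop where
  smooth : ContDiffOn ℝ ∞ z I
  mem : ∀ t ∈ I, z t ∈ Quadric c 1
  unitSpeed : ∀ t ∈ I, ip c (deriv z t) (deriv z t) = 1
  legendre : ∀ t ∈ I, ip c (deriv z t) (Complex.I • z t) = 0

/-- `I` is a nonempty open interval and `μ` a solution without zeros on `I` of
`μ μ'' - (r-3)/(r-2) μ'² + (r-2) μ² ((r-1) μ² + c) = 0`. -/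
structure IsSolution (r c : ℝ) (I : Set ℝ) (μ : ℝ → ℝ) : Prop where
  isOpen : IsOpen I
  ordConnected : I.OrdConnected
  nonempty : I.Nonempty
  twice : ContDiffOn ℝ 2 μ I
  ne_zero : ∀ t ∈ I, μ t ≠ 0
  ode : ∀ t ∈ I, μ t * deriv (deriv μ) t - (r - 3) / (r - 2) * deriv μ t ^ 2 +
    (r - 2) * μ t ^ 2 * ((r - 1) * μ t ^ 2 + c) = 0

/-- `μ² + (μ' / ((r-2) μ))² - 1`. -/
def energy (r : ℝ) (μ : ℝ → ℝ) (t : ℝ) : ℝ :=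
  μ t ^ 2 + (deriv μ t / ((r - 2) * μ t)) ^ 2 - 1

/-! ### Submanifolds built from a curve `z = (z₁, z₂)` -/

/-- `ψ (x, y) = (z₁ (x), z₂ (x) y)`, for `y` in the unit sphere of `𝔼^{m+1}`. -/
def psiSphere {m : ℕ} (z : ℝ → Fin 2 → ℂ)
    (q : ℝ × Metric.sphere (0 : EuclideanSpace ℝ (Fin (m + 1))) 1) : Fin (m + 2) → ℂ :=
  Fin.cons (z q.1 0) (fun j => z q.1 1 * ((q.2 : EuclideanSpace ℝ (Fin (m + 1))) j : ℂ))

/-- `ψ (x, y) = (z₁ (x) y, z₂ (x))`, for `y = (√(1 + |u|²), u)` in the hyperboloid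
`{⟨y, y⟩ = -1, y₁ > 0}` of `𝔼_1^{m+1}`, parametrized by `u ∈ 𝔼^m`. -/
def psiHyperboloid {m : ℕ} (z : ℝ → Fin 2 → ℂ) (q : ℝ × EuclideanSpace ℝ (Fin m)) :
    Fin (m + 2) → ℂ :=
  Fin.cons (z q.1 0 * (Real.sqrt (1 + ‖q.2‖ ^ 2) : ℂ))
    (Fin.snoc (fun j : Fin m => z q.1 0 * (q.2 j : ℂ)) (z q.1 1))

/-- `ψ (x, u) = (z₁ + |u|²/2 (z₁ - z₂), z₂ + |u|²/2 (z₁ - z₂), (z₁ - z₂) u)` at `x`, for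
`u ∈ 𝔼^m`. -/
def psiHorosphere {m : ℕ} (z : ℝ → Fin 2 → ℂ) (q : ℝ × EuclideanSpace ℝ (Fin m)) :
    Fin (m + 2) → ℂ :=
  Fin.cons (z q.1 0 + ((‖q.2‖ ^ 2 / 2 : ℝ) : ℂ) * (z q.1 0 - z q.1 1))
    (Fin.cons (z q.1 1 + ((‖q.2‖ ^ 2 / 2 : ℝ) : ℂ) * (z q.1 0 - z q.1 1))
      (fun j : Fin m => (z q.1 0 - z q.1 1) * (q.2 j : ℂ)))

/-- `π ∘ ψ` is an `H`-umbilical Lagrangian immersion of `I × S^m` with functions `μ` and `r μ`. -/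
def YieldsOnSphere (m : ℕ) (c r : ℝ) (I : Set ℝ) (μ : ℝ → ℝ) (z : ℝ → Fin 2 → ℂ) : Prop :=
  IsHUmbilicalOn (𝓘(ℝ, ℝ).prod (𝓡 m)) c
    (fun q : ℝ × Metric.sphere (0 : EuclideanSpace ℝ (Fin (m + 1))) 1 => hopf c (psiSphere z q))
    (I ×ˢ Set.univ) (fun q => μ q.1) (fun q => r * μ q.1)

/-- `π ∘ ψ` is an `H`-umbilical Lagrangian immersion of `I × H^m` (with `H^m` parametrized by
`𝔼^m`) with functions `μ` and `r μ`. -/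
def YieldsOnHyperboloid (m : ℕ) (c r : ℝ) (I : Set ℝ) (μ : ℝ → ℝ) (z : ℝ → Fin 2 → ℂ) : Prop :=
  IsHUmbilicalOn 𝓘(ℝ, ℝ × EuclideanSpace ℝ (Fin m)) c
    (fun q : ℝ × EuclideanSpace ℝ (Fin m) => hopf c (psiHyperboloid z q))
    (I ×ˢ Set.univ) (fun q => μ q.1) (fun q => r * μ q.1)

/-- `π ∘ ψ` is an `H`-umbilical Lagrangian immersion of `I × 𝔼^m` with functions `μ` and `r μ`. -/
def YieldsOnHorosphere (m : ℕ) (c r : ℝ) (I : Set ℝ) (μ : ℝ → ℝ) (z : ℝ → Fin 2 → ℂ) : Prop :=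
  IsHUmbilicalOn 𝓘(ℝ, ℝ × EuclideanSpace ℝ (Fin m)) c
    (fun q : ℝ × EuclideanSpace ℝ (Fin m) => hopf c (psiHorosphere z q))
    (I ×ˢ Set.univ) (fun q => μ q.1) (fun q => r * μ q.1)

end SpaceForms

end

/-!
An immersion into `CP^n(4)` or `CH^n(-4)` which lifts to an immersion `ψ` into the quadric whose
image of each tangent space is a real space on which `herm` is real and positive, and
`herm`-orthogonal to `ψ`, is Lagrangian. If `F_l` are the images of an orthonormal frame `e_l`, its
second fundamental form is `h (e_i, e_k) = ∑_l Im herm (D_{e_i} F_k) (F_l) J e_l`: splitting the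
flat derivative `D_{e_i} F_k` in the unitary basis `ψ, F_l`, the real coefficients give the tangent
part and the imaginary ones the normal part (`IsLegendrianFrame.isSecondFF`,
`isHUmbilicalOn_hopf`).

All the maps `ψ` in question are rotations `ζ (x) Y + η (x) K` of a profile curve `(ζ, η)`: `K` is a
fixed real vector and `Y` runs through a sphere, a hyperbolic space or a horosphere, according to
whether `K` is an axis in the direction of the first coordinate, an axis in the direction of the
last coordinate, or null. With the frame `ζ / |ζ| T_j`, for `T_j` an orthonormal frame of the
orbit, together with `ζ' Y + η' K`, the coefficients above are determined by the logarithmic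
derivative `ζ' / ζ = a + i μ`, whose imaginary part is the function `μ`, and by the curvature `φ`
of the Legendre curve, `z'' = i φ z' - c z` (`IsAdaptedFrame.isLegendrianFrame`).

Hence one needs Legendre curves of curvature `r μ` one coordinate `ζ` of which has a logarithmic
derivative `b = a + i μ` with imaginary part `μ`. For `ζ` the equation of the curve says
`b' + b² = i r μ b - c`, that is
`a' = -a² - (r - 1) μ² - c` and `μ' = (r - 2) a μ` (`IsRiccati`). For `r ≠ 2` the elimination of `a`
turns this system into the given differential equation (`IsSolution.isRiccati`,
`IsRiccati.isSolution`), but the system makes sense for all `r`, so it gives existence for `r = 2`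
as well. With antiderivatives `A` of `a` and `θ` of `μ`, the functions `exp (A + i θ)` and
`(a - i μ) exp (A + i (r - 1) θ)` both solve the equation of the curve. Along solutions
`exp (2 A) (μ² + a² + c)` is constant (`IsRiccati.exists_energy`), which shows that the energy keeps
its sign, and after normalizing this constant to `1` or `-1` the two functions are the coordinates
of the Legendre curve; when it is `0` the complement of the null coordinate `ζ` comes from a further
quadrature.

Finally `hopf3` takes a Legendre curve of curvature `φ` to a curve of curvature `φ` in the surface
(`IsLegendreCurve.isUnitSpeedCurve`), and two horizontal lifts of the same curve differ by a
constant phase (`IsHorizontalLift.exists_phase`), under which all conditions are invariant.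
-/

open scoped Manifold ContDiff ComplexConjugate

noncomputable section

namespace SpaceForms

/-! ### The Hermitian form -/

section Herm

variable {c : ℝ} {n : ℕ}

theorem herm_add_left (v w z : Fin (n + 1) → ℂ) :
    herm c (v + w) z = herm c v z + herm c w z := by
  simp only [herm, Pi.add_apply, ← Finset.sum_add_distrib]
  exact Finset.sum_congr rfl fun j _ => by ring

theorem herm_smul_left (a : ℂ) (v z : Fin (n + 1) → ℂ) :
    herm c (a • v) z = a * herm c v z := by
  simp only [herm, Pi.smul_apply, smul_eq_mul, Finset.mul_sum]
  exact Finset.sum_congr rfl fun j _ => by ring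

theorem herm_zero_left (z : Fin (n + 1) → ℂ) : herm c 0 z = 0 := by simp [herm]

theorem herm_sum_left {ι : Type*} (s : Finset ι) (v : ι → Fin (n + 1) → ℂ)
    (z : Fin (n + 1) → ℂ) : herm c (∑ i ∈ s, v i) z = ∑ i ∈ s, herm c (v i) z := by
  classical
  induction s using Finset.induction_on with
  | empty => simp [herm_zero_left]
  | insert a s ha ih => rw [Finset.sum_insert ha, Finset.sum_insert ha, herm_add_left, ih]

theorem herm_add_right (v w z : Fin (n + 1) → ℂ) :
    herm c z (v + w) = herm c z v + herm c z w := by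
  rw [← herm_conj, herm_add_left, map_add, herm_conj, herm_conj]

theorem herm_smul_right (a : ℂ) (v z : Fin (n + 1) → ℂ) :
    herm c z (a • v) = conj a * herm c z v := by
  rw [← herm_conj, herm_smul_left, map_mul, herm_conj]

theorem herm_sum_right {ι : Type*} (s : Finset ι) (v : ι → Fin (n + 1) → ℂ)
    (z : Fin (n + 1) → ℂ) : herm c z (∑ i ∈ s, v i) = ∑ i ∈ s, herm c z (v i) := by
  rw [← herm_conj, herm_sum_left, map_sum]
  exact Finset.sum_congr rfl fun i _ => herm_conj _ _

theorem herm_eq_zero_symm {v z : Fin (n + 1) → ℂ} (h : herm c v z = 0) : herm c z v = 0 := by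
  rw [← herm_conj, h, map_zero]

theorem mul_self_of_sign (hc : c = 1 ∨ c = -1) : (c : ℂ) * c = 1 := by
  rcases hc with rfl | rfl <;> norm_num

theorem sig_mul_self (hc : c = 1 ∨ c = -1) (j : Fin (n + 1)) :
    (sig c j : ℂ) * (sig c j : ℂ) = 1 := by
  refine Fin.cases ?_ (fun i => ?_) j
  · simpa [sig] using mul_self_of_sign hc
  · simp [sig]

/-- A point of the quadric together with a `herm`-orthonormal family of `n` vectors orthogonal to
it is a unitary basis of `ℂ^{n+1}`. -/
theorem herm_expansion (hc : c = 1 ∨ c = -1) {z : Fin (n + 1) → ℂ} (hz : z ∈ Quadric c n)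
    {E : Fin n → Fin (n + 1) → ℂ}
    (hE : ∀ i k, herm c (E i) (E k) = if i = k then 1 else 0)
    (hEz : ∀ i, herm c (E i) z = 0) (v : Fin (n + 1) → ℂ) :
    v = (c * herm c v z) • z + ∑ i, herm c v (E i) • E i := by
  set B : Fin (n + 1) → Fin (n + 1) → ℂ := Fin.cons z E with hB
  have hBB : ∀ k l, herm c (B l) (B k) = if k = l then (sig c k : ℂ) else 0 := by
    intro k l
    refine Fin.cases ?_ (fun k => ?_) k <;> refine Fin.cases ?_ (fun l => ?_) l
    · simp [hB, sig, herm_self hz]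
    · simp [hB, hEz, (Fin.succ_ne_zero l).symm]
    · simp [hB, herm_eq_zero_symm (hEz k)]
    · simp [hB, hE, sig, eq_comm]
  let A : Matrix (Fin (n + 1)) (Fin (n + 1)) ℂ := Matrix.of fun j k => B k j
  let A' : Matrix (Fin (n + 1)) (Fin (n + 1)) ℂ :=
    Matrix.of fun k l => (sig c k : ℂ) * conj (B k l) * (sig c l : ℂ)
  have h1 : A' * A = 1 := by
    ext k l
    rw [Matrix.mul_apply, Matrix.one_apply]
    have : ∑ j, A' k j * A j l = (sig c k : ℂ) * herm c (B l) (B k) := by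
      simp only [herm, Finset.mul_sum, A, A', Matrix.of_apply]
      exact Finset.sum_congr rfl fun j _ => by ring
    rw [this, hBB]
    split_ifs <;> simp [sig_mul_self hc]
  have h2 : A * A' = 1 := mul_eq_one_comm.1 h1
  have h3 : v = ∑ k, ((sig c k : ℂ) * herm c v (B k)) • B k := by
    funext j
    have h4 : v j = ∑ l, (A * A') j l * v l := by simp [h2, Matrix.one_apply]
    rw [h4]
    simp only [Matrix.mul_apply, Finset.sum_apply, Pi.smul_apply, smul_eq_mul, herm,
      Finset.mul_sum, Finset.sum_mul, A, A', Matrix.of_apply]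
    rw [Finset.sum_comm]
    exact Finset.sum_congr rfl fun k _ => Finset.sum_congr rfl fun l _ => by ring
  rw [Fin.sum_univ_succ] at h3
  simpa [hB, sig] using h3

end Herm

/-! ### The Hopf fibration and tangent vectors of the space form -/

section Hopf

variable {c : ℝ} {n : ℕ}

theorem dHopf_add (z v w : Fin (n + 1) → ℂ) :
    dHopf c z (v + w) = dHopf c z v + dHopf c z w := by
  funext j k; simp only [dHopf, Pi.add_apply, map_add]; ring

theorem dHopf_real_smul (z v : Fin (n + 1) → ℂ) (a : ℝ) :
    dHopf c z (a • v) = a • dHopf c z v := by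
  funext j k
  simp only [dHopf, Pi.smul_apply, Complex.real_smul, map_mul, Complex.conj_ofReal]; ring

theorem dHopf_self_smul_I (z : Fin (n + 1) → ℂ) : dHopf c z (Complex.I • z) = 0 := by
  funext j k
  simp only [dHopf, Pi.smul_apply, smul_eq_mul, map_mul, Complex.conj_I, Pi.zero_apply]; ring

theorem dHopf_phase {u : ℂ} (hu : u * conj u = 1) (z v : Fin (n + 1) → ℂ) :
    dHopf c (u • z) (u • v) = dHopf c z v := by
  funext j k
  simp only [dHopf, Pi.smul_apply, smul_eq_mul, map_mul]
  linear_combination (c * (v j * conj (z k) + z j * conj (v k)) * (sig c k : ℂ)) * hu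

/-- Points of the quadric in the same fibre differ by a phase. -/
theorem exists_phase_of_hopf_eq (hc : c = 1 ∨ c = -1) {z w : Fin (n + 1) → ℂ}
    (hz : z ∈ Quadric c n) (hw : w ∈ Quadric c n) (h : hopf c z = hopf c w) :
    ∃ u : ℂ, u * conj u = 1 ∧ z = u • w := by
  have hcc := mul_self_of_sign hc
  have h1 : z = (c * herm c z w) • w := by
    funext j
    have h2 : ∑ k, hopf c z j k * z k = ∑ k, hopf c w j k * z k := by rw [h]
    have h3 : ∀ x : Fin (n + 1) → ℂ, ∑ k, hopf c x j k * z k = c * x j * herm c z x := by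
      intro x
      simp only [hopf, herm, Finset.mul_sum]
      exact Finset.sum_congr rfl fun k _ => by ring
    rw [h3, h3, herm_self hz] at h2
    simp only [Pi.smul_apply, smul_eq_mul]
    linear_combination h2 - z j * hcc
  refine ⟨_, ?_, h1⟩
  generalize c * herm c z w = u at h1
  have h4 := herm_self hz
  rw [h1, herm_smul_left, herm_smul_right, herm_self hw] at h4
  have hc0 : (c : ℂ) ≠ 0 := by rcases hc with rfl | rfl <;> norm_num
  exact mul_right_cancel₀ hc0 (by rw [one_mul, mul_assoc]; exact h4)

theorem metric_dHopf_dHopf (hc : c = 1 ∨ c = -1) (z v z' w : Fin (n + 1) → ℂ) :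
    metric c (dHopf c z v) (dHopf c z' w) = c / 2 *
      (herm c v z' * herm c w z + herm c v w * herm c z' z + herm c z z' * herm c w v +
        herm c z w * herm c z' v).re := by
  have key : (∑ j, mmul (dHopf c z v) (dHopf c z' w) j j) = (c : ℂ) * c *
      (herm c v z' * herm c w z + herm c v w * herm c z' z + herm c z z' * herm c w v +
        herm c z w * herm c z' v) := by
    simp only [mmul, dHopf, herm, Finset.sum_mul_sum]
    simp only [← Finset.sum_add_distrib, Finset.mul_sum]
    exact Finset.sum_congr rfl fun j _ => Finset.sum_congr rfl fun l _ => by ring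
  rw [metric, key, mul_self_of_sign hc, one_mul]

theorem metric_add_left (X Y T : Mat n) : metric c (X + Y) T = metric c X T + metric c Y T := by
  simp only [metric, mmul, Pi.add_apply, add_mul, Finset.sum_add_distrib, Complex.add_re]; ring

theorem metric_smul_left (a : ℝ) (X T : Mat n) : metric c (a • X) T = a * metric c X T := by
  simp only [metric, mmul, Pi.smul_apply, Complex.real_smul, mul_assoc, ← Finset.mul_sum,
    Complex.re_ofReal_mul]
  ring

theorem metric_sub_left (X Y T : Mat n) : metric c (X - Y) T = metric c X T - metric c Y T := by
  have h : X - Y = X + (-1 : ℝ) • Y := by simp [sub_eq_add_neg]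
  rw [h, metric_add_left, metric_smul_left]; ring

theorem isTangent_dHopf {z v : Fin (n + 1) → ℂ} (hz : z ∈ Quadric c n) (hv : herm c v z = 0) :
    IsTangent c (hopf c z) (dHopf c z v) :=
  ⟨z, hz, rfl, v, by simp [ip, hv], rfl⟩

/-- Every tangent vector at `hopf c z` is the image of a horizontal vector at `z` itself. -/
theorem IsTangent.exists_horizontal (hc : c = 1 ∨ c = -1) {z : Fin (n + 1) → ℂ}
    (hz : z ∈ Quadric c n) {T : Mat n} (hT : IsTangent c (hopf c z) T) :
    ∃ v, herm c v z = 0 ∧ T = dHopf c z v := by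
  obtain ⟨w, hw, hwz, v, hv, rfl⟩ := hT
  obtain ⟨u, hu, rfl⟩ := exists_phase_of_hopf_eq hc hz hw hwz.symm
  rw [← dHopf_phase hu]
  set z := u • w
  have h0 : (herm c (u • v) z).re = 0 := by
    simp only [z, herm_smul_left, herm_smul_right]
    rw [← mul_assoc, mul_comm _ u, hu, one_mul]; exact hv
  have hcc : c * c = 1 := by rcases hc with rfl | rfl <;> norm_num
  -- the vertical part `i s z` of the vector is annihilated by the differential
  generalize u • v = v at h0
  set s : ℝ := c * (herm c v z).im with hs
  refine ⟨v + (-s) • (Complex.I • z), ?_, ?_⟩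
  · rw [herm_add_left, ← Complex.coe_smul, herm_smul_left, herm_smul_left, herm_self hz]
    apply Complex.ext
    · simp [h0]
    · simp only [Complex.add_im, Complex.mul_im, Complex.ofReal_re, Complex.ofReal_im,
        Complex.I_re, Complex.I_im, Complex.mul_re, Complex.zero_im, hs]
      linear_combination (-(herm c v z).im) * hcc
  · rw [dHopf_add, dHopf_real_smul, dHopf_self_smul_I, smul_zero, add_zero]

end Hopf

/-! ### Directional derivatives of functions on a manifold -/

section DirDeriv

variable {E : Type} [NormedAddCommGroup E] [NormedSpace ℝ E] {H : Type} [TopologicalSpace H]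
  {I : ModelWithCorners ℝ E H} {M : Type} [TopologicalSpace M] [ChartedSpace H M]
  {F : Type} [NormedAddCommGroup F] [NormedSpace ℝ F]
  {F' : Type} [NormedAddCommGroup F'] [NormedSpace ℝ F']

variable (I) in
/-- `g` is differentiable at `p`, with derivative `d` in the direction `X`. -/
def HasDirDeriv (g : M → F) (p : M) (X : TangentSpace I p) (d : F) : Prop :=
  ∃ g' : TangentSpace I p →L[ℝ] F, HasMFDerivAt I 𝓘(ℝ, F) g p g' ∧ g' X = d

namespace HasDirDeriv

variable {g : M → F} {p : M} {X : TangentSpace I p} {d : F}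

theorem mfderiv_eq (h : HasDirDeriv I g p X d) : mfderiv I 𝓘(ℝ, F) g p X = d := by
  obtain ⟨g', h, rfl⟩ := h
  rw [h.mfderiv]
  rfl

theorem of_mdifferentiableAt (h : MDifferentiableAt I 𝓘(ℝ, F) g p) :
    HasDirDeriv I g p X (mfderiv I 𝓘(ℝ, F) g p X) := ⟨_, h.hasMFDerivAt, rfl⟩

theorem unique {d' : F} (h : HasDirDeriv I g p X d) (h' : HasDirDeriv I g p X d') : d = d' :=
  h.mfderiv_eq.symm.trans h'.mfderiv_eq

theorem congr_of_eventuallyEq {g₁ : M → F} (h : HasDirDeriv I g p X d)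
    (h₁ : ∀ᶠ q in nhds p, g₁ q = g q) : HasDirDeriv I g₁ p X d := by
  obtain ⟨g', h, rfl⟩ := h
  exact ⟨g', h.congr_of_eventuallyEq h₁, rfl⟩

theorem congr_val {d' : F} (h : HasDirDeriv I g p X d) (hd : d = d') : HasDirDeriv I g p X d' :=
  hd ▸ h

theorem const (a : F) : HasDirDeriv I (fun _ : M => a) p X 0 :=
  ⟨0, hasMFDerivAt_const a p, rfl⟩

theorem comp {φ : F → F'} {φ' : F →L[ℝ] F'} (hφ : HasFDerivAt φ φ' (g p))
    (h : HasDirDeriv I g p X d) : HasDirDeriv I (fun q => φ (g q)) p X (φ' d) := by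
  obtain ⟨g', h, rfl⟩ := h
  exact ⟨φ'.comp g', HasMFDerivAt.comp p hφ.hasMFDerivAt h, rfl⟩

theorem comp_deriv {g : M → ℝ} {d : ℝ} {φ : ℝ → F} {a : F} (hφ : HasDerivAt φ a (g p))
    (h : HasDirDeriv I g p X d) : HasDirDeriv I (fun q => φ (g q)) p X (d • a) :=
  h.comp hφ.hasFDerivAt

theorem clm (L : F →L[ℝ] F') (h : HasDirDeriv I g p X d) :
    HasDirDeriv I (fun q => L (g q)) p X (L d) := h.comp L.hasFDerivAt

theorem add {g₁ : M → F} {d₁ : F} (h : HasDirDeriv I g p X d) (h₁ : HasDirDeriv I g₁ p X d₁) :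
    HasDirDeriv I (fun q => g q + g₁ q) p X (d + d₁) := by
  obtain ⟨g', h, rfl⟩ := h
  obtain ⟨g₁', h₁, rfl⟩ := h₁
  exact ⟨g' + g₁', h.add h₁, rfl⟩

theorem smul_dir (a : ℝ) (h : HasDirDeriv I g p X d) : HasDirDeriv I g p (a • X) (a • d) := by
  obtain ⟨g', h, rfl⟩ := h
  exact ⟨g', h, by simp⟩

theorem sum_smul_dir {k : ℕ} {X : Fin (k + 1) → TangentSpace I p} {d : Fin (k + 1) → F}
    (h : ∀ l, HasDirDeriv I g p (X l) (d l)) (a : Fin (k + 1) → ℝ) :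
    HasDirDeriv I g p (∑ l, a l • X l) (∑ l, a l • d l) := by
  obtain ⟨g', h0, -⟩ := h 0
  refine ⟨g', h0, ?_⟩
  rw [map_sum]
  refine Finset.sum_congr rfl fun l _ => ?_
  rw [map_smul, ← (h l).mfderiv_eq, h0.mfderiv]
  rfl

theorem mul {A : Type} [NormedCommRing A] [NormedAlgebra ℝ A] {g g₁ : M → A} {d d₁ : A}
    (h : HasDirDeriv I g p X d) (h₁ : HasDirDeriv I g₁ p X d₁) :
    HasDirDeriv I (fun q => g q * g₁ q) p X (g p * d₁ + g₁ p * d) := by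
  obtain ⟨g', h, rfl⟩ := h
  obtain ⟨g₁', h₁, rfl⟩ := h₁
  exact ⟨_, h.mul h₁, rfl⟩

theorem ofReal {g : M → ℝ} {d : ℝ} (h : HasDirDeriv I g p X d) :
    HasDirDeriv I (fun q => (g q : ℂ)) p X (d : ℂ) := h.clm Complex.ofRealCLM

theorem complexConj {g : M → ℂ} {d : ℂ} (h : HasDirDeriv I g p X d) :
    HasDirDeriv I (fun q => conj (g q)) p X (conj d) := h.clm Complex.conjCLE.toContinuousLinearMap

theorem pi {ι : Type} [Fintype ι] {G : ι → Type} [∀ i, NormedAddCommGroup (G i)]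
    [∀ i, NormedSpace ℝ (G i)] {g : M → ∀ i, G i} {d : ∀ i, G i}
    (h : ∀ i, HasDirDeriv I (fun q => g q i) p X (d i)) : HasDirDeriv I g p X d := by
  choose g' hg' hd using h
  refine ⟨ContinuousLinearMap.pi g', ⟨continuousAt_pi.2 fun i => (hg' i).1,
    hasFDerivWithinAt_pi.2 fun i => (hg' i).2⟩, funext hd⟩

theorem apply {ι : Type} [Fintype ι] {G : ι → Type} [∀ i, NormedAddCommGroup (G i)]
    [∀ i, NormedSpace ℝ (G i)] {g : M → ∀ i, G i} {d : ∀ i, G i}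
    (h : HasDirDeriv I g p X d) (i : ι) : HasDirDeriv I (fun q => g q i) p X (d i) :=
  h.clm (ContinuousLinearMap.proj i)

end HasDirDeriv

variable {c : ℝ} {n : ℕ}

theorem HasDirDeriv.hopf {ψ : M → Fin (n + 1) → ℂ} {p : M} {X : TangentSpace I p}
    {v : Fin (n + 1) → ℂ} (h : HasDirDeriv I ψ p X v) :
    HasDirDeriv I (fun q => hopf c (ψ q)) p X (dHopf c (ψ p) v) := by
  refine .pi fun j => .pi fun k => ?_
  have := ((HasDirDeriv.const (I := I) (p := p) (X := X) (c : ℂ)).mul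
    ((h.apply j).mul (h.apply k).complexConj)).mul (.const (sig c k : ℂ))
  refine this.congr_val ?_
  simp only [SpaceForms.dHopf]; ring

theorem HasDirDeriv.dHopf {ψ G : M → Fin (n + 1) → ℂ} {p : M} {X : TangentSpace I p}
    {v w : Fin (n + 1) → ℂ} (h : HasDirDeriv I ψ p X v) (h' : HasDirDeriv I G p X w) :
    HasDirDeriv I (fun q => dHopf c (ψ q) (G q)) p X (dHopf c v (G p) + dHopf c (ψ p) w) := by
  refine .pi fun j => .pi fun k => ?_
  have := ((HasDirDeriv.const (I := I) (p := p) (X := X) (c : ℂ)).mul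
    (((h'.apply j).mul (h.apply k).complexConj).add ((h.apply j).mul (h'.apply k).complexConj))).mul
    (.const (sig c k : ℂ))
  refine this.congr_val ?_
  simp only [SpaceForms.dHopf, Pi.add_apply]; ring

theorem contDiff_hopf : ContDiff ℝ ∞ (hopf c (n := n)) := by
  refine contDiff_pi.2 fun j => contDiff_pi.2 fun k => ?_
  change ContDiff ℝ ∞ fun z : Fin (n + 1) → ℂ => (c : ℂ) * (z j * conj (z k)) * (sig c k : ℂ)
  have h : ∀ j, ContDiff ℝ ∞ fun z : Fin (n + 1) → ℂ => z j := fun j => contDiff_apply ℝ ℂ j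
  exact (contDiff_const.mul ((h j).mul (Complex.conjCLE.contDiff.comp (h k)))).mul contDiff_const

theorem contDiff_dHopf :
    ContDiff ℝ ∞ fun x : (Fin (n + 1) → ℂ) × (Fin (n + 1) → ℂ) => dHopf c x.1 x.2 := by
  refine contDiff_pi.2 fun j => contDiff_pi.2 fun k => ?_
  change ContDiff ℝ ∞ fun x : (Fin (n + 1) → ℂ) × (Fin (n + 1) → ℂ) =>
    (c : ℂ) * (x.2 j * conj (x.1 k) + x.1 j * conj (x.2 k)) * (sig c k : ℂ)
  have h1 : ∀ j, ContDiff ℝ ∞ fun x : (Fin (n + 1) → ℂ) × (Fin (n + 1) → ℂ) => x.1 j :=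
    fun j => (contDiff_apply ℝ ℂ j).comp contDiff_fst
  have h2 : ∀ j, ContDiff ℝ ∞ fun x : (Fin (n + 1) → ℂ) × (Fin (n + 1) → ℂ) => x.2 j :=
    fun j => (contDiff_apply ℝ ℂ j).comp contDiff_snd
  exact (contDiff_const.mul (((h2 j).mul (Complex.conjCLE.contDiff.comp (h1 k))).add
    ((h1 j).mul (Complex.conjCLE.contDiff.comp (h2 k))))).mul contDiff_const

theorem contMDiffOn_hopf {ψ : M → Fin (n + 1) → ℂ} {W : Set M}
    (h : ContMDiffOn I 𝓘(ℝ, Fin (n + 1) → ℂ) ∞ ψ W) :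
    ContMDiffOn I 𝓘(ℝ, Mat n) ∞ (fun q => hopf c (ψ q)) W := fun q hq =>
  ContDiff.comp_contMDiffWithinAt (g := hopf c) (f := ψ) contDiff_hopf (h q hq)

theorem contMDiffOn_dHopf {ψ F : M → Fin (n + 1) → ℂ} {W : Set M}
    (h : ContMDiffOn I 𝓘(ℝ, Fin (n + 1) → ℂ) ∞ ψ W)
    (h' : ContMDiffOn I 𝓘(ℝ, Fin (n + 1) → ℂ) ∞ F W) :
    ContMDiffOn I 𝓘(ℝ, Mat n) ∞ (fun q => dHopf c (ψ q) (F q)) W := fun q hq =>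
  ContDiff.comp_contMDiffWithinAt
    (g := fun x : (Fin (n + 1) → ℂ) × (Fin (n + 1) → ℂ) => dHopf c x.1 x.2)
    (f := fun q => (ψ q, F q)) contDiff_dHopf ((h.prodMk_space h') q hq)

end DirDeriv

/-! ### Immersions with a Legendrian lift -/

section Legendrian

variable {E : Type} [NormedAddCommGroup E] [NormedSpace ℝ E] {H : Type} [TopologicalSpace H]
  {I : ModelWithCorners ℝ E H} {M : Type} [TopologicalSpace M] [ChartedSpace H M]
  {c : ℝ} {m : ℕ}

variable (I) in
/-- On the open set `W` the fields `e i` form an orthonormal frame for the map `ψ` into the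
quadric, with images `F i = ψ_* (e i)`, which shows that `ψ` is a Legendrian immersion and that
`Im herm (D_{e i} F k) (F l)`, the cubic form of the Lagrangian immersion `hopf ∘ ψ`, is the one
of an `H`-umbilical immersion with the functions `μ` and `φ`. -/
structure IsLegendrianFrame (c : ℝ) (ψ : M → Fin (m + 2) → ℂ) (μ φ : M → ℝ) (W : Set M)
    (e : Fin (m + 1) → (q : M) → TangentSpace I q) (F : Fin (m + 1) → M → Fin (m + 2) → ℂ) :
    Prop where
  smooth : ∀ i, ContMDiffOn I 𝓘(ℝ, Fin (m + 2) → ℂ) ∞ (F i) W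
  push : ∀ i, ∀ q ∈ W, HasDirDeriv I ψ q (e i q) (F i q)
  unitary : ∀ q ∈ W, ∀ i k, herm c (F i q) (F k q) = if i = k then 1 else 0
  horizontal : ∀ q ∈ W, ∀ i, herm c (F i q) (ψ q) = 0
  cubic : ∀ q ∈ W, ∃ D : Fin (m + 1) → Fin (m + 1) → Fin (m + 2) → ℂ,
    (∀ i k, HasDirDeriv I (F k) q (e i q) (D i k)) ∧
    (∀ (j : Fin m) l, (herm c (D j.castSucc j.castSucc) (F l q)).im =
      if l = Fin.last m then μ q else 0) ∧
    (∀ (j : Fin m) l, (herm c (D j.castSucc (Fin.last m)) (F l q)).im =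
      if l = j.castSucc then μ q else 0) ∧
    (∀ l, (herm c (D (Fin.last m) (Fin.last m)) (F l q)).im = if l = Fin.last m then φ q else 0) ∧
    (∀ j k : Fin m, j ≠ k → ∀ l, (herm c (D j.castSucc k.castSucc) (F l q)).im = 0)

variable {ψ : M → Fin (m + 2) → ℂ} {μ φ : M → ℝ} {W : Set M}
  {e : Fin (m + 1) → (q : M) → TangentSpace I q} {F : Fin (m + 1) → M → Fin (m + 2) → ℂ}

theorem IsLegendrianFrame.push_hopf (h : IsLegendrianFrame I c ψ μ φ W e F) {q : M} (hq : q ∈ W)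
    (i : Fin (m + 1)) :
    SpaceForms.push I (fun q => hopf c (ψ q)) q (e i q) = dHopf c (ψ q) (F i q) :=
  (h.push i q hq).hopf.mfderiv_eq

theorem IsLegendrianFrame.flatDeriv_eq (h : IsLegendrianFrame I c ψ μ φ W e F) (hW : IsOpen W)
    {q : M} (hq : q ∈ W) {i k : Fin (m + 1)} {D : Fin (m + 2) → ℂ}
    (hD : HasDirDeriv I (F k) q (e i q) D) :
    flatDeriv I (fun q => hopf c (ψ q)) (e i) (e k) q =
      dHopf c (F i q) (F k q) + dHopf c (ψ q) D := by
  refine HasDirDeriv.mfderiv_eq (HasDirDeriv.congr_of_eventuallyEq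
    (g := fun q => dHopf c (ψ q) (F k q)) ((h.push i q hq).dHopf hD) ?_)
  filter_upwards [hW.mem_nhds hq] with x hx
  exact h.push_hopf hx k

theorem herm_sum_smul_frame {F : Fin (m + 1) → Fin (m + 2) → ℂ}
    (hF : ∀ i k, herm c (F i) (F k) = if i = k then 1 else 0) (a : Fin (m + 1) → ℂ)
    (k : Fin (m + 1)) : herm c (∑ l, a l • F l) (F k) = a k := by
  simp [herm_sum_left, herm_smul_left, hF]

theorem herm_sum_smul_sum_smul {F : Fin (m + 1) → Fin (m + 2) → ℂ}
    (hF : ∀ i k, herm c (F i) (F k) = if i = k then 1 else 0) (a b : Fin (m + 1) → ℂ) :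
    herm c (∑ l, a l • F l) (∑ l, b l • F l) = ∑ l, a l * conj (b l) := by
  rw [herm_sum_right]
  refine Finset.sum_congr rfl fun l _ => ?_
  rw [herm_smul_right, herm_sum_smul_frame hF, mul_comm]

theorem herm_sum_smul_eq_zero {F : Fin (m + 1) → Fin (m + 2) → ℂ} {z : Fin (m + 2) → ℂ}
    (hF : ∀ i, herm c (F i) z = 0) (a : Fin (m + 1) → ℂ) : herm c (∑ l, a l • F l) z = 0 := by
  simp [herm_sum_left, herm_smul_left, hF]

theorem dHopf_sum_real_smul (z : Fin (m + 2) → ℂ) (a : Fin (m + 1) → ℝ)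
    (F : Fin (m + 1) → Fin (m + 2) → ℂ) :
    dHopf c z (∑ l, a l • F l) = ∑ l, a l • dHopf c z (F l) := by
  have h0 : dHopf c z 0 = 0 := by simpa using dHopf_real_smul (c := c) z 0 0
  have : ∀ s : Finset (Fin (m + 1)),
      dHopf c z (∑ l ∈ s, a l • F l) = ∑ l ∈ s, a l • dHopf c z (F l) := by
    intro s
    induction s using Finset.induction_on with
    | empty => simpa using h0
    | insert i s hi ih =>
      rw [Finset.sum_insert hi, Finset.sum_insert hi, dHopf_add, ih, dHopf_real_smul]
  exact this _

theorem IsLegendrianFrame.push_hopf_sum (h : IsLegendrianFrame I c ψ μ φ W e F) {q : M}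
    (hq : q ∈ W) (a : Fin (m + 1) → ℝ) :
    SpaceForms.push I (fun q => hopf c (ψ q)) q (∑ l, a l • e l q) =
      dHopf c (ψ q) (∑ l, (a l : ℂ) • F l q) := by
  have h1 := (HasDirDeriv.sum_smul_dir (fun l => h.push l q hq) a).hopf (c := c)
  simp only [Complex.coe_smul]
  exact h1.mfderiv_eq

theorem IsLegendrianFrame.cplx_push_hopf (h : IsLegendrianFrame I c ψ μ φ W e F)
    (hc : c = 1 ∨ c = -1) {q : M} (hq : q ∈ W) (hψ : ψ q ∈ Quadric c (m + 1)) (i : Fin (m + 1)) :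
    cplx (hopf c (ψ q)) (SpaceForms.push I (fun q => hopf c (ψ q)) q (e i q)) =
      dHopf c (ψ q) (Complex.I • F i q) := by
  rw [h.push_hopf hq, cplx_dHopf hc hψ (h.horizontal q hq i)]

/-- The frame fields span the tangent space: they are as many as its dimension and orthonormal. -/
theorem IsLegendrianFrame.exists_eq_sum (h : IsLegendrianFrame I c ψ μ φ W e F)
    (hdim : Module.finrank ℝ E = m + 1) {q : M} (hq : q ∈ W) (X : TangentSpace I q) :
    ∃ a : Fin (m + 1) → ℝ, X = ∑ l, a l • e l q := by
  have hli : LinearIndependent ℝ fun l => e l q := by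
    rw [Fintype.linearIndependent_iff]
    intro a ha i
    have h1 : (∑ l, (a l : ℂ) • F l q) = 0 := by
      have h2 := HasDirDeriv.sum_smul_dir (fun l => h.push l q hq) a
      rw [ha] at h2
      obtain ⟨g', -, h3⟩ := h2
      rw [map_zero] at h3
      simpa only [Complex.coe_smul] using h3.symm
    have h4 : herm c (∑ l, (a l : ℂ) • F l q) (F i q) = a i :=
      herm_sum_smul_frame (h.unitary q hq) (fun l => (a l : ℂ)) i
    rw [h1, herm_zero_left] at h4
    exact_mod_cast h4.symm
  have hfr : Module.finrank ℝ (TangentSpace I q) = m + 1 := hdim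
  have hspan := hli.span_eq_top_of_card_eq_finrank (by rw [hfr]; simp)
  have hX : X ∈ Submodule.span ℝ (Set.range fun l => e l q) := by rw [hspan]; trivial
  obtain ⟨a, ha⟩ := (Submodule.mem_span_range_iff_exists_fun ℝ).1 hX
  exact ⟨a, ha.symm⟩

/-- The flat derivative differs from the image of the horizontal part of the derivative `D` upstairs
by a matrix which is orthogonal to the space form. -/
theorem metric_flatDeriv_sub (hc : c = 1 ∨ c = -1) {z v w D : Fin (m + 2) → ℂ}
    {F : Fin (m + 1) → Fin (m + 2) → ℂ} (hz : z ∈ Quadric c (m + 1)) (hv : herm c v z = 0)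
    (hw : herm c w z = 0) (hF : ∀ i k, herm c (F i) (F k) = if i = k then 1 else 0)
    (hFz : ∀ i, herm c (F i) z = 0) {T : Mat (m + 1)} (hT : IsTangent c (hopf c z) T) :
    metric c (dHopf c v w + dHopf c z D - dHopf c z (∑ l, herm c D (F l) • F l)) T = 0 := by
  obtain ⟨t, ht, rfl⟩ := hT.exists_horizontal hc hz
  have hD : dHopf c z D =
      dHopf c z ((c * herm c D z) • z) + dHopf c z (∑ l, herm c D (F l) • F l) := by
    rw [← dHopf_add, ← herm_expansion hc hz hF hFz D]
  rw [hD, ← add_assoc, add_sub_cancel_right, metric_add_left, metric_dHopf_dHopf hc,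
    metric_dHopf_dHopf hc, herm_smul_left, herm_smul_right, hw, ht, herm_eq_zero_symm ht,
    herm_eq_zero_symm hv, hv, herm_eq_zero_symm hw, herm_smul_left, herm_eq_zero_symm ht]
  simp

/-- The second fundamental form of the projected immersion: the imaginary parts of the coefficients
of the derivative `D = D_{e_i} F_k` with respect to the frame `F_l`. -/
theorem IsLegendrianFrame.isSecondFF (h : IsLegendrianFrame I c ψ μ φ W e F)
    (hc : c = 1 ∨ c = -1) (hdim : Module.finrank ℝ E = m + 1) (hW : IsOpen W) {q : M} (hq : q ∈ W)
    (hψ : ψ q ∈ Quadric c (m + 1)) {i k : Fin (m + 1)} {D : Fin (m + 2) → ℂ}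
    (hD : HasDirDeriv I (F k) q (e i q) D) :
    IsSecondFF I c (fun q => hopf c (ψ q)) (e i) (e k) q
      (∑ l, (herm c D (F l q)).im •
        cplx (hopf c (ψ q)) (SpaceForms.push I (fun q => hopf c (ψ q)) q (e l q))) := by
  have hw : (∑ l, (herm c D (F l q)).im •
        cplx (hopf c (ψ q)) (SpaceForms.push I (fun q => hopf c (ψ q)) q (e l q))) =
      dHopf c (ψ q) (∑ l, ((herm c D (F l q)).im * Complex.I) • F l q) := by
    simp only [h.cplx_push_hopf hc hq hψ, mul_smul, Complex.coe_smul]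
    rw [dHopf_sum_real_smul]
  have hF := h.unitary q hq
  have hFz := h.horizontal q hq
  rw [hw]
  refine ⟨isTangent_dHopf hψ (herm_sum_smul_eq_zero hFz _), fun Z => ?_,
    ∑ l, (herm c D (F l q)).re • e l q, ?_⟩
  · obtain ⟨a, rfl⟩ := h.exists_eq_sum hdim hq Z
    rw [h.push_hopf_sum hq, metric_dHopf hc hψ (herm_sum_smul_eq_zero hFz _)
      (herm_sum_smul_eq_zero hFz _), ip, herm_sum_smul_sum_smul hF, Complex.re_sum]
    exact Finset.sum_eq_zero fun l _ => by simp
  · have hcov : SpaceForms.push I (fun q => hopf c (ψ q)) q (∑ l, (herm c D (F l q)).re • e l q) +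
        dHopf c (ψ q) (∑ l, ((herm c D (F l q)).im * Complex.I) • F l q) =
        dHopf c (ψ q) (∑ l, herm c D (F l q) • F l q) := by
      rw [h.push_hopf_sum hq, ← dHopf_add, ← Finset.sum_add_distrib]
      simp only [← add_smul, Complex.re_add_im]
    rw [hcov]
    refine ⟨isTangent_dHopf hψ (herm_sum_smul_eq_zero hFz _), fun T hT => ?_⟩
    rw [h.flatDeriv_eq hW hq hD]
    exact metric_flatDeriv_sub hc hψ (hFz i) (hFz k) hF hFz hT

theorem IsLegendrianFrame.not_isTotallyGeodesicOn (h : IsLegendrianFrame I c ψ μ φ W e F)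
    (hc : c = 1 ∨ c = -1) (hm : 1 ≤ m) (hdim : Module.finrank ℝ E = m + 1) {U : Set M}
    (hW : IsOpen W) (hWU : W ⊆ U) {q : M} (hq : q ∈ W) (hψ : ψ q ∈ Quadric c (m + 1))
    (hsm : ∀ i, SmoothField I (fun q => hopf c (ψ q)) (e i) W) (hμ : μ q ≠ 0) :
    ¬ IsTotallyGeodesicOn I c (fun q => hopf c (ψ q)) U := by
  intro hg
  let j : Fin m := ⟨0, hm⟩
  obtain ⟨D, hD, hjj, -⟩ := h.cubic q hq
  have hF := h.unitary q hq
  have hFz := h.horizontal q hq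
  obtain ⟨-, -, Z, -, hZ⟩ := hg W hWU hW _ _ (hsm j.castSucc) (hsm j.castSucc) q hq
  -- the second fundamental form has a component `μ ≠ 0` in the direction of `J (e (last m))`
  set T := dHopf c (ψ q) (Complex.I • F (Fin.last m) q) with hTdef
  have hTz : herm c (Complex.I • F (Fin.last m) q) (ψ q) = 0 := by
    rw [herm_smul_left, hFz, mul_zero]
  have hT : IsTangent c (hopf c (ψ q)) T := isTangent_dHopf hψ hTz
  have h1 := hZ T hT
  have h2 := metric_flatDeriv_sub hc (D := D j.castSucc j.castSucc) hψ (hFz j.castSucc)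
    (hFz j.castSucc) hF hFz hT
  obtain ⟨a, rfl⟩ := h.exists_eq_sum hdim hq Z
  rw [h.flatDeriv_eq hW hq (hD _ _), add_zero, metric_sub_left, h.push_hopf_sum hq,
    metric_dHopf hc hψ (herm_sum_smul_eq_zero hFz _) hTz] at h1
  rw [metric_sub_left, metric_dHopf hc hψ (herm_sum_smul_eq_zero hFz _) hTz] at h2
  have h3 : ∀ x : Fin (m + 1) → ℂ, ip c (∑ l, x l • F l q) (Complex.I • F (Fin.last m) q) =
      (x (Fin.last m)).im := by
    intro x
    rw [ip, herm_smul_right, herm_sum_smul_frame hF]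
    simp
  rw [h3] at h1 h2
  apply hμ
  have h4 := hjj j (Fin.last m)
  rw [if_pos rfl] at h4
  rw [← h4]
  simp only [Complex.ofReal_im] at h1
  linarith

/-- A map into the quadric with Legendrian frames of the `H`-umbilical kind projects to an
`H`-umbilical Lagrangian immersion. -/
theorem isHUmbilicalOn_hopf (hc : c = 1 ∨ c = -1) (hm : 1 ≤ m)
    (hdim : Module.finrank ℝ E = m + 1) {U : Set M} (hU : IsOpen U) (hne : U.Nonempty)
    (hψ : ContMDiffOn I 𝓘(ℝ, Fin (m + 2) → ℂ) ∞ ψ U) (hmem : ∀ p ∈ U, ψ p ∈ Quadric c (m + 1))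
    (hμ : ∀ p ∈ U, μ p ≠ 0)
    (hframe : ∀ p ∈ U, ∃ W : Set M, IsOpen W ∧ p ∈ W ∧ W ⊆ U ∧ ∃ e F,
      IsLegendrianFrame I c ψ μ φ W e F) :
    IsHUmbilicalOn I c (fun q => hopf c (ψ q)) U μ φ := by
  have hsm : ∀ W ⊆ U, ∀ e F, IsLegendrianFrame I c ψ μ φ W e F →
      ∀ i, SmoothField I (fun q => hopf c (ψ q)) (e i) W := by
    intro W hWU e F h i
    exact (contMDiffOn_dHopf (hψ.mono hWU) (h.smooth i)).congr fun q hq => h.push_hopf hq i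
  refine ⟨⟨hdim, hU, fun p hp => ⟨ψ p, hmem p hp, rfl⟩, contMDiffOn_hopf hψ,
    fun p hp => ?_, fun p hp X Y => ?_⟩, ?_,
    fun p hp => ?_⟩
  · obtain ⟨W, -, hpW, -, e, F, h⟩ := hframe p hp
    refine (injective_iff_map_eq_zero (mfderiv I 𝓘(ℝ, Mat (m + 1)) (fun q => hopf c (ψ q)) p)).2
      fun X hX => ?_
    obtain ⟨a, rfl⟩ := h.exists_eq_sum hdim hpW X
    have h1 := h.push_hopf_sum hpW a
    have h2 : ∀ k, a k = 0 := by
      intro k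
      have h3 : metric c (dHopf c (ψ p) (∑ l, (a l : ℂ) • F l p)) (dHopf c (ψ p) (F k p)) = 0 := by
        rw [← h1, SpaceForms.push, hX]
        have h4 := metric_smul_left (c := c) 0 (0 : Mat (m + 1)) (dHopf c (ψ p) (F k p))
        rw [zero_smul, zero_mul] at h4
        exact h4
      rw [metric_dHopf hc (hmem p hp) (herm_sum_smul_eq_zero (h.horizontal p hpW) _)
        (h.horizontal p hpW k)] at h3
      rw [ip, herm_sum_smul_frame (h.unitary p hpW)] at h3
      exact h3
    simp [h2]
  · obtain ⟨W, -, hpW, -, e, F, h⟩ := hframe p hp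
    obtain ⟨a, rfl⟩ := h.exists_eq_sum hdim hpW X
    obtain ⟨b, rfl⟩ := h.exists_eq_sum hdim hpW Y
    have hz := herm_sum_smul_eq_zero (h.horizontal p hpW) fun l => (a l : ℂ)
    rw [h.push_hopf_sum hpW, h.push_hopf_sum hpW, cplx_dHopf hc (hmem p hp) hz,
      metric_dHopf hc (hmem p hp) (by rw [herm_smul_left, hz, mul_zero])
      (herm_sum_smul_eq_zero (h.horizontal p hpW) _), ip, herm_smul_left,
      herm_sum_smul_sum_smul (h.unitary p hpW)]
    simp
  · obtain ⟨p, hp⟩ := hne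
    obtain ⟨W, hW, hpW, hWU, e, F, h⟩ := hframe p hp
    exact h.not_isTotallyGeodesicOn hc hm hdim hW hWU hpW (hmem p hp) (hsm W hWU e F h) (hμ p hp)
  · obtain ⟨W, hW, hpW, hWU, e, F, h⟩ := hframe p hp
    refine ⟨W, hW, hpW, hWU, e, hsm W hWU e F h, fun q hq => ?_⟩
    have hψq := hmem q (hWU hq)
    obtain ⟨D, hD, h1, h2, h3, h4⟩ := h.cubic q hq
    have hII : ∀ i k, IsSecondFF I c (fun q => hopf c (ψ q)) (e i) (e k) q
      (∑ l, (herm c (D i k) (F l q)).im •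
        cplx (hopf c (ψ q)) (SpaceForms.push I (fun q => hopf c (ψ q)) q (e l q))) :=
      fun i k => h.isSecondFF hc hdim hW hq hψq (hD i k)
    refine ⟨fun i k => ?_, fun j => ?_, fun j => ?_, ?_, fun j k hjk => ?_⟩
    · rw [h.push_hopf hq, h.push_hopf hq, metric_dHopf hc hψq (h.horizontal q hq i)
        (h.horizontal q hq k), ip, h.unitary q hq]
      split_ifs <;> simp
    · simpa [h1] using hII j.castSucc j.castSucc
    · simpa [h2] using hII j.castSucc (Fin.last m)
    · simpa [h3] using hII (Fin.last m) (Fin.last m)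
    · simpa [h4 j k hjk] using hII j.castSucc k.castSucc

end Legendrian

/-! ### Real vectors and profile curves -/

section Real

variable {c : ℝ} {n : ℕ}

/-- The real bilinear form of signature `(c, 1, …, 1)`, to which `herm c` restricts. -/
def rform (c : ℝ) {n : ℕ} (v w : Fin (n + 1) → ℝ) : ℝ := ∑ j, sig c j * v j * w j

/-- The inclusion of `ℝ^{n+1}` in `ℂ^{n+1}`. -/
def cx {n : ℕ} (v : Fin (n + 1) → ℝ) : Fin (n + 1) → ℂ := fun j => (v j : ℂ)

theorem herm_cx (v w : Fin (n + 1) → ℝ) : herm c (cx v) (cx w) = rform c v w := by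
  simp [herm, cx, rform]

theorem rform_comm (v w : Fin (n + 1) → ℝ) : rform c v w = rform c w v :=
  Finset.sum_congr rfl fun j _ => by ring

theorem cx_zero : cx (0 : Fin (n + 1) → ℝ) = 0 := by
  funext j; simp [cx]

/-- The values of `herm` on the complex plane spanned by two real vectors with Gram matrix
`(δ, β; β, κ)`, in the coordinates with respect to these vectors. -/
def planeForm (δ β κ : ℝ) (ζ η ζ' η' : ℂ) : ℂ :=
  δ * (ζ * conj ζ') + β * (ζ * conj η' + η * conj ζ') + κ * (η * conj η')

theorem herm_plane (Y K : Fin (n + 1) → ℝ) (ζ η ζ' η' : ℂ) :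
    herm c (ζ • cx Y + η • cx K) (ζ' • cx Y + η' • cx K) =
      planeForm (rform c Y Y) (rform c Y K) (rform c K K) ζ η ζ' η' := by
  simp only [herm_add_left, herm_add_right, herm_smul_left, herm_smul_right, herm_cx, planeForm,
    rform_comm K Y]
  ring

/-- A unit speed Legendre curve `(ζ, η)` of curvature `φ` in the quadric of a plane, with
coordinates with respect to a basis of Gram matrix `(δ, β; β, κ)`, for which the first coordinate
`ζ` rotates with the angular velocity `μ`. -/
structure IsProfile (c δ β κ : ℝ) (J : Set ℝ) (μ φ : ℝ → ℝ) (ζ η : ℝ → ℂ) : Prop where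
  isOpen : IsOpen J
  smooth_fst : ContDiffOn ℝ ∞ ζ J
  smooth_snd : ContDiffOn ℝ ∞ η J
  mem : ∀ t ∈ J, planeForm δ β κ (ζ t) (η t) (ζ t) (η t) = c
  legendre : ∀ t ∈ J, planeForm δ β κ (deriv ζ t) (deriv η t) (ζ t) (η t) = 0
  unitSpeed : ∀ t ∈ J, planeForm δ β κ (deriv ζ t) (deriv η t) (deriv ζ t) (deriv η t) = 1
  ode_fst : ∀ t ∈ J, deriv (deriv ζ) t = Complex.I * φ t * deriv ζ t - c * ζ t
  ode_snd : ∀ t ∈ J, deriv (deriv η) t = Complex.I * φ t * deriv η t - c * η t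
  ne_zero : ∀ t ∈ J, ζ t ≠ 0
  log_deriv : ∀ t ∈ J, ∃ a : ℝ, deriv ζ t = (a + Complex.I * μ t) * ζ t

theorem contDiffOn_deriv_of_smooth {F : Type} [NormedAddCommGroup F] [NormedSpace ℝ F] {J : Set ℝ}
    (hJ : IsOpen J) {f : ℝ → F} (hf : ContDiffOn ℝ ∞ f J) : ContDiffOn ℝ ∞ (deriv f) J :=
  ((contDiffOn_infty_iff_deriv_of_isOpen hJ).1 hf).2

theorem hasDerivAt_of_smooth {F : Type} [NormedAddCommGroup F] [NormedSpace ℝ F] {J : Set ℝ}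
    (hJ : IsOpen J) {f : ℝ → F} (hf : ContDiffOn ℝ ∞ f J) {t : ℝ} (ht : t ∈ J) :
    HasDerivAt f (deriv f t) t :=
  ((hf.contDiffAt (hJ.mem_nhds ht)).differentiableAt (by simp)).hasDerivAt

end Real

/-! ### Rotation of a profile curve -/

section Rotation

variable {E : Type} [NormedAddCommGroup E] [NormedSpace ℝ E] {H : Type} [TopologicalSpace H]
  {I : ModelWithCorners ℝ E H} {M : Type} [TopologicalSpace M] [ChartedSpace H M]
  {c : ℝ} {m : ℕ}

theorem HasDirDeriv.sum {ι : Type} (s : Finset ι) {F : Type} [NormedAddCommGroup F]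
    [NormedSpace ℝ F] {g : ι → M → F} {p : M} {X : TangentSpace I p} {d : ι → F}
    (h : ∀ i, HasDirDeriv I (g i) p X (d i)) :
    HasDirDeriv I (fun q => ∑ i ∈ s, g i q) p X (∑ i ∈ s, d i) := by
  classical
  induction s using Finset.induction_on with
  | empty => simpa using HasDirDeriv.const (0 : F)
  | insert i s hi ih => simpa only [Finset.sum_insert hi] using (h i).add ih

theorem HasDirDeriv.rform {n : ℕ} {Y Z : M → Fin (n + 1) → ℝ} {p : M} {X : TangentSpace I p}
    {v w : Fin (n + 1) → ℝ} (hY : HasDirDeriv I Y p X v) (hZ : HasDirDeriv I Z p X w) :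
    HasDirDeriv I (fun q => rform c (Y q) (Z q)) p X
      (SpaceForms.rform c (Y p) w + SpaceForms.rform c v (Z p)) := by
  have h := HasDirDeriv.sum Finset.univ fun j =>
    ((HasDirDeriv.const (I := I) (p := p) (X := X) (sig c j)).mul (hY.apply j)).mul (hZ.apply j)
  refine h.congr_val ?_
  simp only [SpaceForms.rform, ← Finset.sum_add_distrib]
  exact Finset.sum_congr rfl fun j _ => by ring

theorem HasDirDeriv.smul_cx {n : ℕ} {x : M → ℝ} {Z : M → Fin (n + 1) → ℝ} {p : M}
    {X : TangentSpace I p} {s : ℝ} {w : Fin (n + 1) → ℝ} {θ : ℝ → ℂ} {θ' : ℂ}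
    (hθ : HasDerivAt θ θ' (x p)) (hx : HasDirDeriv I x p X s) (hZ : HasDirDeriv I Z p X w) :
    HasDirDeriv I (fun q => θ (x q) • cx (Z q)) p X
      ((s * θ' : ℂ) • cx (Z p) + θ (x p) • cx w) := by
  refine .pi fun j => ((hx.comp_deriv hθ).mul (hZ.apply j).ofReal).congr_val ?_
  simp only [cx, Complex.real_smul, Pi.add_apply, Pi.smul_apply, smul_eq_mul]
  ring

theorem contMDiffOn_smul_cx {n : ℕ} {x : M → ℝ} {Z : M → Fin (n + 1) → ℝ} {W : Set M} {J : Set ℝ}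
    (hJ : IsOpen J) {θ : ℝ → ℂ} (hθ : ContDiffOn ℝ ∞ θ J)
    (hx : ContMDiffOn I 𝓘(ℝ, ℝ) ∞ x W) (hxJ : ∀ q ∈ W, x q ∈ J)
    (hZ : ContMDiffOn I 𝓘(ℝ, Fin (n + 1) → ℝ) ∞ Z W) :
    ContMDiffOn I 𝓘(ℝ, Fin (n + 1) → ℂ) ∞ (fun q => θ (x q) • cx (Z q)) W := by
  intro q hq
  refine ContDiffAt.comp_contMDiffWithinAt
    (g := fun y : ℝ × (Fin (n + 1) → ℝ) => θ y.1 • cx y.2) (f := fun q => (x q, Z q)) ?_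
    ((hx.prodMk_space hZ) q hq)
  refine contDiffAt_pi.2 fun j => ?_
  have h1 : ContDiffAt ℝ ∞ (fun y : ℝ × (Fin (n + 1) → ℝ) => θ y.1) (x q, Z q) :=
    ContDiffAt.comp (x q, Z q) (hθ.contDiffAt (hJ.mem_nhds (hxJ q hq))) contDiffAt_fst
  have h2 : ContDiff ℝ ∞ fun y : ℝ × (Fin (n + 1) → ℝ) => ((y.2 j : ℝ) : ℂ) :=
    Complex.ofRealCLM.contDiff.comp ((contDiff_apply ℝ ℝ j).comp contDiff_snd)
  exact h1.mul h2.contDiffAt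

variable (I) in
/-- On the open set `W` the fields `e i` are a frame adapted to the splitting given by the function
`x` and the map `Y` into a real quadric: `e (last m)` is the unit field along which only `x`
varies, and the other ones are orthonormal for the metric induced by `Y`, with images `T j`. -/
structure IsAdaptedFrame (c : ℝ) (x : M → ℝ) (Y : M → Fin (m + 2) → ℝ) (W : Set M)
    (e : Fin (m + 1) → (q : M) → TangentSpace I q) (T : Fin m → M → Fin (m + 2) → ℝ) :
    Prop where
  smooth : ∀ j, ContMDiffOn I 𝓘(ℝ, Fin (m + 2) → ℝ) ∞ (T j) W
  fst : ∀ q ∈ W, ∀ j : Fin m, HasDirDeriv I x q (e j.castSucc q) 0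
  snd : ∀ q ∈ W, ∀ j : Fin m, HasDirDeriv I Y q (e j.castSucc q) (T j q)
  fst_last : ∀ q ∈ W, HasDirDeriv I x q (e (Fin.last m) q) 1
  snd_last : ∀ q ∈ W, HasDirDeriv I Y q (e (Fin.last m) q) 0
  orthonormal : ∀ q ∈ W, ∀ j k, rform c (T j q) (T k q) = if j = k then 1 else 0

variable {x : M → ℝ} {Y : M → Fin (m + 2) → ℝ} {K : Fin (m + 2) → ℝ} {W : Set M}
  {e : Fin (m + 1) → (q : M) → TangentSpace I q} {T : Fin m → M → Fin (m + 2) → ℝ}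

theorem HasDirDeriv.eq_zero_of_const {F : Type} [NormedAddCommGroup F] [NormedSpace ℝ F]
    {g : M → F} {a : F} (hW : IsOpen W) {q : M} (hq : q ∈ W) (hg : ∀ q ∈ W, g q = a)
    {X : TangentSpace I q} {d : F} (h : HasDirDeriv I g q X d) : d = 0 :=
  h.unique ((HasDirDeriv.const a).congr_of_eventuallyEq (by
    filter_upwards [hW.mem_nhds hq] with y hy using hg y hy))

theorem IsAdaptedFrame.rform_T_Y (h : IsAdaptedFrame I c x Y W e T) (hW : IsOpen W) {δ : ℝ}
    (hY : ∀ q ∈ W, rform c (Y q) (Y q) = δ) {q : M} (hq : q ∈ W) (j : Fin m) :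
    rform c (T j q) (Y q) = 0 := by
  have h1 := ((h.snd q hq j).rform (c := c) (h.snd q hq j)).eq_zero_of_const hW hq hY
  rw [rform_comm (Y q)] at h1
  linarith

theorem rform_zero_right {n : ℕ} (v : Fin (n + 1) → ℝ) : rform c v 0 = 0 := by simp [rform]

theorem rform_eq_zero_of_const {n : ℕ} {Z : M → Fin (n + 1) → ℝ} {K : Fin (n + 1) → ℝ}
    (hW : IsOpen W) {β : ℝ} (hZ : ∀ q ∈ W, rform c (Z q) K = β) {q : M} (hq : q ∈ W)
    {X : TangentSpace I q} {d : Fin (n + 1) → ℝ} (h : HasDirDeriv I Z q X d) :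
    rform c d K = 0 := by
  have h1 := (h.rform (c := c) (.const K)).eq_zero_of_const hW hq hZ
  rwa [rform_zero_right, zero_add] at h1

/-- The images `ζ / |ζ| T_j` and `ζ' Y + η' K` of the orthonormal frame of the rotated curve
`ζ Y + η K`. -/
def rotFrame (x : M → ℝ) (Y : M → Fin (m + 2) → ℝ) (K : Fin (m + 2) → ℝ) (ζ η : ℝ → ℂ)
    (T : Fin m → M → Fin (m + 2) → ℝ) : Fin (m + 1) → M → Fin (m + 2) → ℂ :=
  Fin.snoc (fun j q => (ζ (x q) / ‖ζ (x q)‖) • cx (T j q))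
    (fun q => deriv ζ (x q) • cx (Y q) + deriv η (x q) • cx K)

/-- Rotating a profile curve gives a Legendrian immersion with `H`-umbilical cubic form. That the
`T_j` are orthogonal to `Y` and `K`, and the inner products of their derivatives with `Y` and `K`,
follow by differentiating the constants `rform Y Y` and `rform Y K`. -/
theorem IsAdaptedFrame.isLegendrianFrame {δ β κ : ℝ} {J : Set ℝ} {μ φ : ℝ → ℝ} {ζ η : ℝ → ℂ}
    (h : IsAdaptedFrame I c x Y W e T) (hp : IsProfile c δ β κ J μ φ ζ η) (hW : IsOpen W)
    (hx : ContMDiffOn I 𝓘(ℝ, ℝ) ∞ x W) (hY : ContMDiffOn I 𝓘(ℝ, Fin (m + 2) → ℝ) ∞ Y W)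
    (hxJ : ∀ q ∈ W, x q ∈ J) (hYY : ∀ q ∈ W, rform c (Y q) (Y q) = δ)
    (hYK : ∀ q ∈ W, rform c (Y q) K = β) (hKK : rform c K K = κ) :
    IsLegendrianFrame I c (fun q => ζ (x q) • cx (Y q) + η (x q) • cx K)
      (fun q => μ (x q)) (fun q => φ (x q)) W
      (Fin.snoc (α := fun _ => (q : M) → TangentSpace I q)
        (fun j q => ‖ζ (x q)‖⁻¹ • e j.castSucc q) (e (Fin.last m)))
      (rotFrame x Y K ζ η T) := by
  have hJ := hp.isOpen
  have hζ := hp.smooth_fst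
  have hη := hp.smooth_snd
  have hζ' := contDiffOn_deriv_of_smooth hJ hζ
  have hη' := contDiffOn_deriv_of_smooth hJ hη
  have hu : ContDiffOn ℝ ∞ (fun t => ζ t / (‖ζ t‖ : ℂ)) J := by
    simp only [div_eq_mul_inv]
    refine hζ.mul (ContDiffOn.inv (f := fun t => (‖ζ t‖ : ℂ))
      (Complex.ofRealCLM.contDiff.comp_contDiffOn (hζ.norm ℂ hp.ne_zero)) fun t ht => ?_)
    exact_mod_cast norm_ne_zero_iff.2 (hp.ne_zero t ht)
  have hK : ContMDiffOn I 𝓘(ℝ, Fin (m + 2) → ℝ) ∞ (fun _ => K) W := contMDiffOn_const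
  have hsmooth : ∀ i, ContMDiffOn I 𝓘(ℝ, Fin (m + 2) → ℂ) ∞ (rotFrame x Y K ζ η T i) W := by
    intro i
    refine Fin.lastCases ?_ (fun j => ?_) i
    · simp only [rotFrame, Fin.snoc_last]
      exact (contMDiffOn_smul_cx hJ hζ' hx hxJ hY).add (contMDiffOn_smul_cx hJ hη' hx hxJ hK)
    · simp only [rotFrame, Fin.snoc_castSucc]
      exact contMDiffOn_smul_cx hJ hu hx hxJ (h.smooth j)
  have hTY : ∀ q ∈ W, ∀ j, rform c (T j q) (Y q) = 0 := fun q hq j => h.rform_T_Y hW hYY hq j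
  have hTK : ∀ q ∈ W, ∀ j, rform c (T j q) K = 0 := fun q hq j =>
    rform_eq_zero_of_const hW hYK hq (h.snd q hq j)
  have hplane : ∀ q ∈ W, ∀ j (a a' b : ℂ),
      herm c (b • cx (T j q)) (a • cx (Y q) + a' • cx K) = 0 := by
    intro q hq j a a' b
    simp [herm_smul_left, herm_add_right, herm_smul_right, herm_cx, hTY q hq, hTK q hq]
  have hnorm : ∀ t ∈ J, ζ t / (‖ζ t‖ : ℂ) * conj (ζ t / (‖ζ t‖ : ℂ)) = 1 := by
    intro t ht
    rw [Complex.mul_conj, Complex.normSq_eq_norm_sq, norm_div, Complex.norm_real, norm_norm,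
      div_self (norm_ne_zero_iff.2 (hp.ne_zero t ht))]
    simp
  have hunit : ∀ q ∈ W, ∀ i k, herm c (rotFrame x Y K ζ η T i q) (rotFrame x Y K ζ η T k q) =
      if i = k then 1 else 0 := by
    intro q hq i k
    refine Fin.lastCases ?_ (fun i => ?_) i <;> refine Fin.lastCases ?_ (fun k => ?_) k
    · simp only [rotFrame, Fin.snoc_last, if_true]
      rw [herm_plane, hYY q hq, hYK q hq, hKK, hp.unitSpeed _ (hxJ q hq)]
    · simp only [rotFrame, Fin.snoc_last, Fin.snoc_castSucc]
      rw [herm_eq_zero_symm (hplane q hq _ _ _ _), if_neg (Fin.castSucc_lt_last k).ne']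
    · simp only [rotFrame, Fin.snoc_last, Fin.snoc_castSucc]
      rw [hplane q hq, if_neg (Fin.castSucc_lt_last i).ne]
    · simp only [rotFrame, Fin.snoc_castSucc, Fin.castSucc_inj]
      rw [herm_smul_left, herm_smul_right, ← mul_assoc, hnorm _ (hxJ q hq), one_mul, herm_cx,
        h.orthonormal q hq]
      split_ifs <;> simp
  have hhor : ∀ q ∈ W, ∀ i,
      herm c (rotFrame x Y K ζ η T i q) (ζ (x q) • cx (Y q) + η (x q) • cx K) = 0 := by
    intro q hq i
    refine Fin.lastCases ?_ (fun i => ?_) i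
    · simp only [rotFrame, Fin.snoc_last]
      rw [herm_plane, hYY q hq, hYK q hq, hKK, hp.legendre _ (hxJ q hq)]
    · simp only [rotFrame, Fin.snoc_castSucc]
      exact hplane q hq _ _ _ _
  -- derivatives in the directions of the frame
  have hdir : ∀ q ∈ W, ∀ j : Fin m, ∀ {θ : ℝ → ℂ} {Z : M → Fin (m + 2) → ℝ}
      {d : Fin (m + 2) → ℝ}, ContDiffOn ℝ ∞ θ J → HasDirDeriv I Z q (e j.castSucc q) d →
      HasDirDeriv I (fun q => θ (x q) • cx (Z q)) q (‖ζ (x q)‖⁻¹ • e j.castSucc q)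
        (((‖ζ (x q)‖ : ℂ)⁻¹ * θ (x q)) • cx d) := by
    intro q hq j θ Z d hθ hZ
    refine (((h.fst q hq j).smul_cx (hasDerivAt_of_smooth hJ hθ (hxJ q hq)) hZ).smul_dir
      ‖ζ (x q)‖⁻¹).congr_val ?_
    rw [Complex.ofReal_zero, zero_mul, zero_smul, zero_add, ← Complex.coe_smul, smul_smul,
      Complex.ofReal_inv]
  have hdir_last : ∀ q ∈ W, ∀ {θ : ℝ → ℂ} {Z : M → Fin (m + 2) → ℝ}, ContDiffOn ℝ ∞ θ J →
      HasDirDeriv I Z q (e (Fin.last m) q) 0 →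
      HasDirDeriv I (fun q => θ (x q) • cx (Z q)) q (e (Fin.last m) q)
        (deriv θ (x q) • cx (Z q)) := by
    intro q hq θ Z hθ hZ
    refine ((h.fst_last q hq).smul_cx (hasDerivAt_of_smooth hJ hθ (hxJ q hq)) hZ).congr_val ?_
    rw [cx_zero, smul_zero, add_zero, Complex.ofReal_one, one_mul]
  refine ⟨hsmooth, fun i q hq => ?_, hunit, hhor, fun q hq => ?_⟩
  · refine Fin.lastCases ?_ (fun j => ?_) i
    · simp only [rotFrame, Fin.snoc_last]
      exact (hdir_last q hq hζ (h.snd_last q hq)).add (hdir_last q hq hη (.const K))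
    · simp only [rotFrame, Fin.snoc_castSucc]
      refine ((hdir q hq j hζ (h.snd q hq j)).add (hdir q hq j hη (.const K))).congr_val ?_
      rw [cx_zero, smul_zero, add_zero, inv_mul_eq_div]
  -- the cubic form
  · have hxq := hxJ q hq
    obtain ⟨a, ha⟩ := hp.log_deriv _ hxq
    have hζ0 := hp.ne_zero _ hxq
    have hn0 : (‖ζ (x q)‖ : ℂ) ≠ 0 := by exact_mod_cast norm_ne_zero_iff.2 hζ0
    have hdiff : ∀ {F : Type} [NormedAddCommGroup F] [NormedSpace ℝ F] {g : M → F},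
        ContMDiffOn I 𝓘(ℝ, F) ∞ g W → ∀ X : TangentSpace I q,
        HasDirDeriv I g q X (mfderiv I 𝓘(ℝ, F) g q X) := fun hg X =>
      .of_mdifferentiableAt ((hg.contMDiffAt (hW.mem_nhds hq)).mdifferentiableAt (by simp))
    have hTd : ∀ j k : Fin m, ∃ d : Fin (m + 2) → ℝ, HasDirDeriv I (T k) q (e j.castSucc q) d ∧
        rform c d (Y q) = (if j = k then -1 else 0) ∧ rform c d K = 0 := by
      intro j k
      have h1 := hdiff (h.smooth k) (e j.castSucc q)
      refine ⟨_, h1, ?_, rform_eq_zero_of_const hW (fun q hq => hTK q hq k) hq h1⟩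
      have h2 := (h1.rform (c := c) (h.snd q hq j)).eq_zero_of_const hW hq fun q hq => hTY q hq k
      rw [h.orthonormal q hq] at h2
      have h3 := eq_neg_of_add_eq_zero_right h2
      refine h3.trans ?_
      by_cases hjk : k = j
      · simp [hjk]
      · rw [if_neg hjk, if_neg (Ne.symm hjk), neg_zero]
    -- the derivatives of the first `m` frame vectors along each other
    have hcc : ∀ j k : Fin m, ∀ l, ∀ D, HasDirDeriv I (rotFrame x Y K ζ η T k.castSucc) q
        (‖ζ (x q)‖⁻¹ • e j.castSucc q) D →
        (herm c D (rotFrame x Y K ζ η T l q)).im =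
          if j = k ∧ l = Fin.last m then μ (x q) else 0 := by
      intro j k l D hD
      obtain ⟨d, hd, hdY, hdK⟩ := hTd j k
      have h1 := hdir q hq j hu hd
      have h2 : rotFrame x Y K ζ η T k.castSucc =
          fun q => (ζ (x q) / ‖ζ (x q)‖) • cx (T k q) := by simp [rotFrame]
      rw [h2] at hD
      rw [hD.unique h1]
      refine Fin.lastCases ?_ (fun l => ?_) l
      · simp only [rotFrame, Fin.snoc_last, and_true]
        rw [herm_add_right, herm_smul_left, herm_smul_left, herm_smul_right, herm_smul_right,
          herm_cx, herm_cx, hdY, hdK, ha]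
        have h3 : ζ (x q) * conj (ζ (x q)) = (‖ζ (x q)‖ : ℂ) ^ 2 := by
          rw [Complex.mul_conj, Complex.normSq_eq_norm_sq]; push_cast; ring
        have h4 : (‖ζ (x q)‖ : ℂ)⁻¹ * (ζ (x q) / ‖ζ (x q)‖) *
            (conj ((a + Complex.I * μ (x q)) * ζ (x q))) = a - Complex.I * μ (x q) := by
          simp only [map_mul, map_add, Complex.conj_ofReal, Complex.conj_I]
          field_simp
          linear_combination (a - Complex.I * μ (x q)) * h3
        rw [← mul_assoc, h4]
        split_ifs <;> simp
      · simp only [rotFrame, Fin.snoc_castSucc]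
        rw [if_neg fun hl => (Fin.castSucc_lt_last l).ne hl.2, herm_smul_left, herm_smul_right,
          herm_cx, mul_assoc, ← mul_assoc (ζ (x q) / _), hnorm _ hxq, one_mul,
          ← Complex.ofReal_inv, ← Complex.ofReal_mul, Complex.ofReal_im]
    have h_last : rotFrame x Y K ζ η T (Fin.last m) =
          fun q => deriv ζ (x q) • cx (Y q) + deriv η (x q) • cx K := by simp [rotFrame]
    refine ⟨fun i k => _, fun i k => hdiff (hsmooth k) _, fun j l => ?_, fun j l => ?_, fun l => ?_,
      fun j k hjk l => ?_⟩
    · have h1 := hdiff (hsmooth j.castSucc) (‖ζ (x q)‖⁻¹ • e j.castSucc q)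
      simpa only [Fin.snoc_castSucc, true_and] using hcc j j l _ h1
    · have h1 := (hdir q hq j hζ' (h.snd q hq j)).add (hdir q hq j hη' (.const K))
      rw [← h_last] at h1
      have h2 := h1.mfderiv_eq
      simp only [Fin.snoc_castSucc]
      have h3 : (((‖ζ (x q)‖ : ℂ)⁻¹ * deriv ζ (x q)) • cx (T j q) +
          ((‖ζ (x q)‖ : ℂ)⁻¹ * deriv η (x q)) • cx (0 : Fin (m + 2) → ℝ)) =
          (a + Complex.I * μ (x q)) • rotFrame x Y K ζ η T j.castSucc q := by
        simp only [rotFrame, Fin.snoc_castSucc, cx_zero, smul_zero, add_zero, smul_smul, ha]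
        congr 1
        ring
      rw [h2, h3, herm_smul_left, hunit q hq]
      by_cases hl : j.castSucc = l
      · simp [hl]
      · rw [if_neg hl, if_neg (Ne.symm hl)]; simp
    · have h1 := (hdir_last q hq hζ' (h.snd_last q hq)).add (hdir_last q hq hη' (.const K))
      rw [← h_last] at h1
      have h2 := h1.mfderiv_eq
      simp only [Fin.snoc_last]
      have h3 : deriv (deriv ζ) (x q) • cx (Y q) + deriv (deriv η) (x q) • cx K =
          (Complex.I * φ (x q)) • rotFrame x Y K ζ η T (Fin.last m) q +
            (-c : ℂ) • (ζ (x q) • cx (Y q) + η (x q) • cx K) := by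
        rw [h_last, hp.ode_fst _ hxq, hp.ode_snd _ hxq]
        module
      rw [h2, h3, herm_add_left, herm_smul_left, herm_smul_left, hunit q hq,
        herm_eq_zero_symm (hhor q hq l)]
      by_cases hl : Fin.last m = l
      · simp [hl]
      · rw [if_neg hl, if_neg (Ne.symm hl)]; simp
    · have h1 := hdiff (hsmooth k.castSucc) (‖ζ (x q)‖⁻¹ • e j.castSucc q)
      simpa only [Fin.snoc_castSucc, hjk, false_and, if_false] using hcc j k l _ h1

/-- If adapted frames exist near each point, rotating a profile curve and projecting gives an
`H`-umbilical Lagrangian immersion. -/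
theorem isHUmbilicalOn_rotation {δ β κ : ℝ} {J : Set ℝ} {μ φ : ℝ → ℝ} {ζ η : ℝ → ℂ}
    (hc : c = 1 ∨ c = -1) (hm : 1 ≤ m) (hdim : Module.finrank ℝ E = m + 1)
    (hp : IsProfile c δ β κ J μ φ ζ η) (hμ : ∀ t ∈ J, μ t ≠ 0) {U : Set M} (hU : IsOpen U)
    (hne : U.Nonempty) (hx : ContMDiffOn I 𝓘(ℝ, ℝ) ∞ x U)
    (hY : ContMDiffOn I 𝓘(ℝ, Fin (m + 2) → ℝ) ∞ Y U)
    (hxJ : ∀ q ∈ U, x q ∈ J) (hYY : ∀ q ∈ U, rform c (Y q) (Y q) = δ)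
    (hYK : ∀ q ∈ U, rform c (Y q) K = β) (hKK : rform c K K = κ)
    (hframe : ∀ p ∈ U, ∃ W : Set M, IsOpen W ∧ p ∈ W ∧ W ⊆ U ∧ ∃ e T,
      IsAdaptedFrame I c x Y W e T) :
    IsHUmbilicalOn I c (fun q => hopf c (ζ (x q) • cx (Y q) + η (x q) • cx K)) U
      (fun q => μ (x q)) (fun q => φ (x q)) := by
  refine isHUmbilicalOn_hopf hc hm hdim hU hne ?_ (fun p hp' => ?_) (fun p hp' => hμ _ (hxJ p hp'))
    fun p hp' => ?_
  · exact (contMDiffOn_smul_cx hp.isOpen hp.smooth_fst hx hxJ hY).add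
      (contMDiffOn_smul_cx hp.isOpen hp.smooth_snd hx hxJ contMDiffOn_const)
  · rw [Quadric, Set.mem_ofPred_eq, ip, herm_plane, hYY p hp', hYK p hp', hKK,
      hp.mem _ (hxJ p hp'), Complex.ofReal_re]
  · obtain ⟨W, hW, hpW, hWU, e, T, h⟩ := hframe p hp'
    exact ⟨W, hW, hpW, hWU, _, _, h.isLegendrianFrame hp hW (hx.mono hWU) (hY.mono hWU)
      (fun q hq => hxJ q (hWU hq)) (fun q hq => hYY q (hWU hq)) (fun q hq => hYK q (hWU hq)) hKK⟩

end Rotation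

/-! ### Rotations of hyperbolic and parabolic type -/

section RealForm

variable {m : ℕ}

theorem rform_cons (c a a' : ℝ) (v w : Fin (m + 1) → ℝ) :
    rform c (Fin.cons a v) (Fin.cons a' w) = c * a * a' + ∑ j, v j * w j := by
  simp [rform, Fin.sum_univ_succ, sig]

theorem rform_cons_cons (c a a' b b' : ℝ) (v w : Fin m → ℝ) :
    rform c (Fin.cons a (Fin.cons b v : Fin (m + 1) → ℝ))
      (Fin.cons a' (Fin.cons b' w : Fin (m + 1) → ℝ)) = c * a * a' + b * b' + ∑ j, v j * w j := by
  rw [rform_cons, Fin.sum_univ_succ]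
  simp [add_assoc]

theorem rform_cons_snoc (c a a' b b' : ℝ) (v w : Fin m → ℝ) :
    rform c (Fin.cons a (Fin.snoc v b : Fin (m + 1) → ℝ))
      (Fin.cons a' (Fin.snoc w b' : Fin (m + 1) → ℝ)) = c * a * a' + ∑ j, v j * w j + b * b' := by
  rw [rform_cons, Fin.sum_univ_castSucc]
  simp [add_assoc]

theorem sum_mul_eq_inner {ι : Type} [Fintype ι] (u v : EuclideanSpace ℝ ι) :
    ∑ j, u j * v j = inner ℝ u v := by
  rw [PiLp.inner_apply]
  exact Finset.sum_congr rfl fun j _ => by simp [mul_comm]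

end RealForm

section DirDeriv

variable {E : Type} [NormedAddCommGroup E] [NormedSpace ℝ E] {H : Type} [TopologicalSpace H]
  {I : ModelWithCorners ℝ E H} {M : Type} [TopologicalSpace M] [ChartedSpace H M]

theorem HasDirDeriv.norm_sq {V : Type} [NormedAddCommGroup V] [InnerProductSpace ℝ V]
    {u : M → V} {p : M} {X : TangentSpace I p} {d : V} (h : HasDirDeriv I u p X d) :
    HasDirDeriv I (fun q => ‖u q‖ ^ 2) p X (2 * inner ℝ (u p) d) := by
  refine (h.comp (hasStrictFDerivAt_norm_sq (u p)).hasFDerivAt).congr_val ?_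
  simp [two_mul]

theorem HasDirDeriv.sqrt {g : M → ℝ} {p : M} {X : TangentSpace I p} {d : ℝ}
    (h : HasDirDeriv I g p X (2 * (d * Real.sqrt (g p)))) (h0 : 0 < g p) :
    HasDirDeriv I (fun q => Real.sqrt (g q)) p X d := by
  refine (h.comp_deriv (Real.hasDerivAt_sqrt h0.ne')).congr_val ?_
  have := (Real.sqrt_pos.2 h0).ne'
  rw [smul_eq_mul]
  field_simp

theorem HasDirDeriv.cons {n : ℕ} {a : M → ℝ} {v : M → Fin n → ℝ} {p : M} {X : TangentSpace I p}
    {a' : ℝ} {v' : Fin n → ℝ} (ha : HasDirDeriv I a p X a') (hv : HasDirDeriv I v p X v') :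
    HasDirDeriv I (fun q => (Fin.cons (a q) (v q) : Fin (n + 1) → ℝ)) p X (Fin.cons a' v') := by
  refine .pi fun j => ?_
  refine Fin.cases ?_ (fun j => ?_) j
  · simpa only [Fin.cons_zero] using ha
  · simpa only [Fin.cons_succ] using hv.apply j

theorem HasDirDeriv.snoc {n : ℕ} {a : M → ℝ} {v : M → Fin n → ℝ} {p : M} {X : TangentSpace I p}
    {a' : ℝ} {v' : Fin n → ℝ} (hv : HasDirDeriv I v p X v') (ha : HasDirDeriv I a p X a') :
    HasDirDeriv I (fun q => (Fin.snoc (v q) (a q) : Fin (n + 1) → ℝ)) p X (Fin.snoc v' a') := by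
  refine .pi fun j => ?_
  refine Fin.lastCases ?_ (fun j => ?_) j
  · simpa only [Fin.snoc_last] using ha
  · simpa only [Fin.snoc_castSucc] using hv.apply j

theorem HasDirDeriv.coords {n : ℕ} {u : M → EuclideanSpace ℝ (Fin n)} {p : M}
    {X : TangentSpace I p} {d : EuclideanSpace ℝ (Fin n)} (h : HasDirDeriv I u p X d) :
    HasDirDeriv I (fun q j => u q j) p X (fun j => d j) :=
  .pi fun j => h.clm (EuclideanSpace.proj j : EuclideanSpace ℝ (Fin n) →L[ℝ] ℝ)

end DirDeriv

section Hyperbolic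

variable {m : ℕ}

/-- The point `(√(1 + |u|²), u, 0)` of the hyperboloid. -/
def hyperboloidMap (u : EuclideanSpace ℝ (Fin m)) : Fin (m + 2) → ℝ :=
  Fin.cons (Real.sqrt (1 + ‖u‖ ^ 2)) (Fin.snoc (fun j : Fin m => u j) 0 : Fin (m + 1) → ℝ)

/-- The fixed vector of the rotations of hyperbolic type. -/
def hyperboloidAxis (m : ℕ) : Fin (m + 2) → ℝ :=
  Fin.cons 0 (Fin.snoc (fun _ : Fin m => 0) 1 : Fin (m + 1) → ℝ)

/-- The point `(1 + |u|² / 2, |u|² / 2, u)` of the horosphere. -/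
def horosphereMap (u : EuclideanSpace ℝ (Fin m)) : Fin (m + 2) → ℝ :=
  Fin.cons (1 + ‖u‖ ^ 2 / 2) (Fin.cons (‖u‖ ^ 2 / 2) (fun j : Fin m => u j) : Fin (m + 1) → ℝ)

/-- The fixed null vector of the rotations of parabolic type. -/
def horosphereAxis (m : ℕ) : Fin (m + 2) → ℝ :=
  Fin.cons 1 (Fin.cons 1 (fun _ : Fin m => 0) : Fin (m + 1) → ℝ)

theorem contDiff_coord (j : Fin m) :
    ContDiff ℝ ∞ fun q : ℝ × EuclideanSpace ℝ (Fin m) => q.2 j :=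
  (EuclideanSpace.proj j : EuclideanSpace ℝ (Fin m) →L[ℝ] ℝ).contDiff.comp contDiff_snd

theorem contDiff_norm_sq_snd :
    ContDiff ℝ ∞ fun q : ℝ × EuclideanSpace ℝ (Fin m) => ‖q.2‖ ^ 2 :=
  (contDiff_norm_sq ℝ).comp contDiff_snd

theorem one_add_norm_sq_pos (u : EuclideanSpace ℝ (Fin m)) : 0 < 1 + ‖u‖ ^ 2 := by positivity

theorem contDiff_sqrt_snd :
    ContDiff ℝ ∞ fun q : ℝ × EuclideanSpace ℝ (Fin m) => Real.sqrt (1 + ‖q.2‖ ^ 2) :=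
  (contDiff_const.add contDiff_norm_sq_snd).sqrt fun q => (one_add_norm_sq_pos q.2).ne'

theorem contDiff_cons {V : Type} [NormedAddCommGroup V] [NormedSpace ℝ V] {n : ℕ} {a : V → ℝ}
    {v : V → Fin n → ℝ} (ha : ContDiff ℝ ∞ a) (hv : ∀ j, ContDiff ℝ ∞ fun q => v q j) :
    ContDiff ℝ ∞ fun q => (Fin.cons (a q) (v q) : Fin (n + 1) → ℝ) := by
  refine contDiff_pi.2 fun j => ?_
  refine Fin.cases ?_ (fun j => ?_) j
  · simpa only [Fin.cons_zero] using ha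
  · simpa only [Fin.cons_succ] using hv j

theorem contDiff_snoc {V : Type} [NormedAddCommGroup V] [NormedSpace ℝ V] {n : ℕ} {a : V → ℝ}
    {v : V → Fin n → ℝ} (hv : ∀ j, ContDiff ℝ ∞ fun q => v q j) (ha : ContDiff ℝ ∞ a) :
    ContDiff ℝ ∞ fun q => (Fin.snoc (v q) (a q) : Fin (n + 1) → ℝ) := by
  refine contDiff_pi.2 fun j => ?_
  refine Fin.lastCases ?_ (fun j => ?_) j
  · simpa only [Fin.snoc_last] using ha
  · simpa only [Fin.snoc_castSucc] using hv j

theorem contDiff_hyperboloidMap :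
    ContDiff ℝ ∞ fun q : ℝ × EuclideanSpace ℝ (Fin m) => hyperboloidMap q.2 :=
  contDiff_cons contDiff_sqrt_snd (contDiff_pi.1 (contDiff_snoc contDiff_coord contDiff_const))

theorem contDiff_horosphereMap :
    ContDiff ℝ ∞ fun q : ℝ × EuclideanSpace ℝ (Fin m) => horosphereMap q.2 :=
  contDiff_cons (contDiff_const.add (contDiff_norm_sq_snd.div_const 2))
    (contDiff_pi.1 (contDiff_cons (contDiff_norm_sq_snd.div_const 2) contDiff_coord))

theorem hasDirDeriv_of_hasFDerivAt {V F : Type} [NormedAddCommGroup V] [NormedSpace ℝ V]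
    [NormedAddCommGroup F] [NormedSpace ℝ F] {f : V → F} {f' : V →L[ℝ] F} {q : V}
    (h : HasFDerivAt f f' q) (X : V) : HasDirDeriv 𝓘(ℝ, V) f q X (f' X) :=
  ⟨f', h.hasMFDerivAt, rfl⟩

theorem hasDirDeriv_fst (q X : ℝ × EuclideanSpace ℝ (Fin m)) :
    HasDirDeriv 𝓘(ℝ, ℝ × EuclideanSpace ℝ (Fin m)) Prod.fst q X X.1 :=
  hasDirDeriv_of_hasFDerivAt hasFDerivAt_fst X

theorem hasDirDeriv_snd (q X : ℝ × EuclideanSpace ℝ (Fin m)) :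
    HasDirDeriv 𝓘(ℝ, ℝ × EuclideanSpace ℝ (Fin m)) Prod.snd q X X.2 :=
  hasDirDeriv_of_hasFDerivAt hasFDerivAt_snd X

theorem rform_hyperboloidMap (u : EuclideanSpace ℝ (Fin m)) :
    rform (-1) (hyperboloidMap u) (hyperboloidMap u) = -1 := by
  rw [hyperboloidMap, rform_cons_snoc, sum_mul_eq_inner, real_inner_self_eq_norm_sq, mul_assoc,
    Real.mul_self_sqrt (one_add_norm_sq_pos u).le]
  ring

theorem rform_hyperboloidMap_axis (u : EuclideanSpace ℝ (Fin m)) :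
    rform (-1) (hyperboloidMap u) (hyperboloidAxis m) = 0 := by
  rw [hyperboloidMap, hyperboloidAxis, rform_cons_snoc]; simp

theorem rform_hyperboloidAxis : rform (-1) (hyperboloidAxis m) (hyperboloidAxis m) = 1 := by
  rw [hyperboloidAxis, rform_cons_snoc]; simp

theorem rform_horosphereMap (u : EuclideanSpace ℝ (Fin m)) :
    rform (-1) (horosphereMap u) (horosphereMap u) = -1 := by
  rw [horosphereMap, rform_cons_cons, sum_mul_eq_inner, real_inner_self_eq_norm_sq]
  ring

theorem rform_horosphereMap_axis (u : EuclideanSpace ℝ (Fin m)) :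
    rform (-1) (horosphereMap u) (horosphereAxis m) = -1 := by
  rw [horosphereMap, horosphereAxis, rform_cons_cons]; simp

theorem rform_horosphereAxis : rform (-1) (horosphereAxis m) (horosphereAxis m) = 0 := by
  rw [horosphereAxis, rform_cons_cons]; simp

theorem isAdaptedFrame_horosphere (W : Set (ℝ × EuclideanSpace ℝ (Fin m))) :
    IsAdaptedFrame 𝓘(ℝ, ℝ × EuclideanSpace ℝ (Fin m)) (-1) Prod.fst
      (fun q => horosphereMap q.2) W
      (Fin.snoc (α := fun _ => ℝ × EuclideanSpace ℝ (Fin m) → ℝ × EuclideanSpace ℝ (Fin m))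
        (fun j _ => (0, EuclideanSpace.single j 1)) (fun _ => (1, 0)))
      (fun j q => Fin.cons (q.2 j) (Fin.cons (q.2 j)
        (fun k => EuclideanSpace.single j (1 : ℝ) k) : Fin (m + 1) → ℝ)) := by
  have hY : ∀ (q X : ℝ × EuclideanSpace ℝ (Fin m)) {a : ℝ} (_ : inner ℝ q.2 X.2 = a),
      HasDirDeriv 𝓘(ℝ, ℝ × EuclideanSpace ℝ (Fin m)) (fun q => horosphereMap q.2) q X
      (Fin.cons a (Fin.cons a fun j => X.2 j : Fin (m + 1) → ℝ)) := by
    intro q X a ha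
    have h1 := (hasDirDeriv_snd q X).norm_sq
    have h2 := (h1.mul (.const (2⁻¹ : ℝ))).congr_val (d' := a) (by rw [← ha]; ring)
    exact (((HasDirDeriv.const (1 : ℝ)).add h2).congr_val (zero_add _)).cons
      (h2.cons (hasDirDeriv_snd q X).coords)
  refine ⟨fun j => ?_, fun q _ j => ?_, fun q _ j => ?_, fun q _ => ?_, fun q _ => ?_,
    fun q _ j k => ?_⟩
  · refine (contDiff_cons (contDiff_coord j) (contDiff_pi.1 (contDiff_cons (contDiff_coord j)
      (v := fun _ k => EuclideanSpace.single j (1 : ℝ) k) fun k => ?_))).contMDiff.contMDiffOn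
    exact contDiff_const
  · rw [Fin.snoc_castSucc]; exact hasDirDeriv_fst q _
  · rw [Fin.snoc_castSucc]; exact hY q _ (by simp [EuclideanSpace.inner_single_right])
  · rw [Fin.snoc_last]; exact hasDirDeriv_fst q _
  · rw [Fin.snoc_last]
    refine (hY q _ (inner_zero_right _)).congr_val ?_
    funext j
    refine Fin.cases rfl (fun j => Fin.cases rfl (fun j => rfl) j) j
  · rw [rform_cons_cons, sum_mul_eq_inner, EuclideanSpace.inner_single_left]
    simp

/-- The coordinates `u` of the parallel translate, along the geodesic from the vertex of the
hyperboloid to its point over `u`, of the `j`-th vector of the standard basis. -/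
def hyperboloidField (j : Fin m) (u : EuclideanSpace ℝ (Fin m)) : EuclideanSpace ℝ (Fin m) :=
  EuclideanSpace.single j 1 + (u j / (1 + Real.sqrt (1 + ‖u‖ ^ 2))) • u

theorem isAdaptedFrame_hyperboloid (W : Set (ℝ × EuclideanSpace ℝ (Fin m))) :
    IsAdaptedFrame 𝓘(ℝ, ℝ × EuclideanSpace ℝ (Fin m)) (-1) Prod.fst
      (fun q => hyperboloidMap q.2) W
      (Fin.snoc (α := fun _ => ℝ × EuclideanSpace ℝ (Fin m) → ℝ × EuclideanSpace ℝ (Fin m))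
        (fun j q => (0, hyperboloidField j q.2)) (fun _ => (1, 0)))
      (fun j q => Fin.cons (q.2 j)
        (Fin.snoc (fun k => hyperboloidField j q.2 k) 0 : Fin (m + 1) → ℝ)) := by
  have hY : ∀ (q X : ℝ × EuclideanSpace ℝ (Fin m)) {a : ℝ}
      (_ : inner ℝ q.2 X.2 = a * Real.sqrt (1 + ‖q.2‖ ^ 2)),
      HasDirDeriv 𝓘(ℝ, ℝ × EuclideanSpace ℝ (Fin m)) (fun q => hyperboloidMap q.2) q X
      (Fin.cons a (Fin.snoc (fun j => X.2 j) 0 : Fin (m + 1) → ℝ)) := by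
    intro q X a ha
    have h1 : HasDirDeriv 𝓘(ℝ, ℝ × EuclideanSpace ℝ (Fin m))
        (fun q : ℝ × EuclideanSpace ℝ (Fin m) => 1 + ‖q.2‖ ^ 2) q X
        (2 * (a * Real.sqrt (1 + ‖q.2‖ ^ 2))) :=
      ((HasDirDeriv.const (1 : ℝ)).add (hasDirDeriv_snd q X).norm_sq).congr_val
        (by rw [ha, zero_add])
    have h2 := h1.sqrt (one_add_norm_sq_pos q.2)
    exact h2.cons ((hasDirDeriv_snd q X).coords.snoc (.const 0))
  have hw : ∀ u : EuclideanSpace ℝ (Fin m), 1 + Real.sqrt (1 + ‖u‖ ^ 2) ≠ 0 := fun u => by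
    positivity
  refine ⟨fun j => ?_, fun q _ j => ?_, fun q _ j => ?_, fun q _ => ?_, fun q _ => ?_,
    fun q _ j k => ?_⟩
  · refine (contDiff_cons (contDiff_coord j) (contDiff_pi.1 (contDiff_snoc (fun k => ?_)
      contDiff_const))).contMDiff.contMDiffOn
    exact contDiff_const.add
      (((contDiff_coord j).div (contDiff_const.add contDiff_sqrt_snd) fun q => hw q.2).mul
        (contDiff_coord k))
  · rw [Fin.snoc_castSucc]; exact hasDirDeriv_fst q _
  · rw [Fin.snoc_castSucc]
    refine hY q _ ?_
    rw [hyperboloidField, inner_add_right, inner_smul_right, real_inner_self_eq_norm_sq,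
      EuclideanSpace.inner_single_right]
    have h1 := Real.sq_sqrt (one_add_norm_sq_pos q.2).le
    have h2 := hw q.2
    simp only [conj_trivial, one_mul]
    field_simp
    linear_combination (-q.2 j) * h1
  · rw [Fin.snoc_last]; exact hasDirDeriv_fst q _
  · rw [Fin.snoc_last]
    refine (hY q _ (a := 0) (by simp)).congr_val ?_
    funext j
    refine Fin.cases rfl (fun j => Fin.lastCases ?_ (fun j => ?_) j) j <;> simp
  · rw [rform_cons_snoc, sum_mul_eq_inner, hyperboloidField, hyperboloidField,
      inner_add_left, inner_add_right, inner_add_right,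
      inner_smul_left, inner_smul_left, inner_smul_right, inner_smul_right,
      real_inner_self_eq_norm_sq, EuclideanSpace.inner_single_left,
      EuclideanSpace.inner_single_left, EuclideanSpace.inner_single_right]
    have h1 := Real.sq_sqrt (one_add_norm_sq_pos q.2).le
    have h2 := hw q.2
    have h3 : (EuclideanSpace.single k (1 : ℝ)).ofLp j = if j = k then 1 else 0 := by
      simp
    rw [h3]
    simp only [conj_trivial, one_mul]
    field_simp
    linear_combination (-q.2 j * q.2 k) * h1

end Hyperbolic

/-! ### Rotations of elliptic type -/

section Sphere

variable {E : Type} [NormedAddCommGroup E] [NormedSpace ℝ E] {H : Type} [TopologicalSpace H]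
  {I : ModelWithCorners ℝ E H} {M : Type} [TopologicalSpace M] [ChartedSpace H M]
  {c : ℝ} {m : ℕ}

/-- The image of `v` under the rotation of the sphere which takes `y₀` to `y` and fixes the vectors
orthogonal to both, for `v` orthogonal to `y₀` and `y ≠ -y₀`. -/
def transport (y₀ v y : EuclideanSpace ℝ (Fin (m + 1))) : EuclideanSpace ℝ (Fin (m + 1)) :=
  v - (inner ℝ v y / (1 + inner ℝ y y₀)) • (y + y₀)

theorem inner_transport_self {y₀ v y : EuclideanSpace ℝ (Fin (m + 1))} (hy : ‖y‖ = 1)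
    (hyy : 1 + inner ℝ y y₀ ≠ 0) : inner ℝ (transport y₀ v y) y = 0 := by
  rw [transport, inner_sub_left, inner_smul_left, inner_add_left, real_inner_self_eq_norm_sq, hy,
    real_inner_comm y y₀, conj_trivial]
  field_simp
  ring

theorem inner_transport {y₀ v w y : EuclideanSpace ℝ (Fin (m + 1))} (hy₀ : ‖y₀‖ = 1)
    (hy : ‖y‖ = 1) (hyy : 1 + inner ℝ y y₀ ≠ 0) (hv : inner ℝ v y₀ = 0) (hw : inner ℝ w y₀ = 0) :
    inner ℝ (transport y₀ v y) (transport y₀ w y) = inner ℝ v w := by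
  simp only [transport, inner_sub_left, inner_sub_right, inner_smul_left, inner_smul_right,
    inner_add_left, inner_add_right, real_inner_self_eq_norm_sq, hy, hy₀, hv, conj_trivial,
    real_inner_comm y y₀, real_inner_comm w y, real_inner_comm w y₀]
  rw [hw]
  field_simp
  ring

theorem contDiffAt_transport {y₀ v y : EuclideanSpace ℝ (Fin (m + 1))}
    (hyy : 1 + inner ℝ y y₀ ≠ 0) : ContDiffAt ℝ ∞ (transport y₀ v) y :=
  contDiffAt_const.sub (((contDiffAt_const.inner ℝ contDiffAt_id).div
    (contDiffAt_const.add (contDiffAt_id.inner ℝ contDiffAt_const)) hyy).smul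
      (contDiffAt_id.add contDiffAt_const))

/-- The inclusion of the hyperplane orthogonal to the first basis vector. -/
def consZero (y : EuclideanSpace ℝ (Fin (m + 1))) : Fin (m + 2) → ℝ := Fin.cons 0 fun j => y j

theorem contDiff_consZero : ContDiff ℝ ∞ (consZero (m := m)) :=
  contDiff_cons contDiff_const fun j =>
    (EuclideanSpace.proj j : EuclideanSpace ℝ (Fin (m + 1)) →L[ℝ] ℝ).contDiff

theorem rform_consZero (y w : EuclideanSpace ℝ (Fin (m + 1))) :
    rform c (consZero y) (consZero w) = inner ℝ y w := by
  rw [consZero, consZero, rform_cons, sum_mul_eq_inner]; simp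

theorem HasDirDeriv.consZero {y : M → EuclideanSpace ℝ (Fin (m + 1))} {p : M}
    {X : TangentSpace I p} {d : EuclideanSpace ℝ (Fin (m + 1))} (h : HasDirDeriv I y p X d) :
    HasDirDeriv I (fun q => consZero (y q)) p X (SpaceForms.consZero d) :=
  (HasDirDeriv.const (0 : ℝ)).cons h.coords

/-- If `(x, y)` is a submersion onto a product of a line with a sphere, there are adapted frames
near each point. -/
theorem exists_isAdaptedFrame_sphere {x : M → ℝ} {y : M → EuclideanSpace ℝ (Fin (m + 1))}
    {U : Set M} (hU : IsOpen U)
    (hy : ContMDiffOn I 𝓘(ℝ, EuclideanSpace ℝ (Fin (m + 1))) ∞ y U)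
    (hnorm : ∀ q ∈ U, ‖y q‖ = 1)
    (hsurj : ∀ q ∈ U, ∀ (s : ℝ) (w : EuclideanSpace ℝ (Fin (m + 1))), inner ℝ w (y q) = 0 →
      ∃ X : TangentSpace I q, HasDirDeriv I x q X s ∧ HasDirDeriv I y q X w) {p : M} (hp : p ∈ U) :
    ∃ W : Set M, IsOpen W ∧ p ∈ W ∧ W ⊆ U ∧ ∃ e T,
      IsAdaptedFrame (m := m) I c x (fun q => consZero (y q)) W e T := by
  classical
  have hp1 := hnorm p hp
  have : Fact (Module.finrank ℝ (EuclideanSpace ℝ (Fin (m + 1))) = m + 1) :=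
    ⟨finrank_euclideanSpace_fin⟩
  let b := OrthonormalBasis.fromOrthogonalSpanSingleton (𝕜 := ℝ) m
    (show y p ≠ 0 by rw [← norm_ne_zero_iff, hp1]; exact one_ne_zero)
  let v : Fin m → EuclideanSpace ℝ (Fin (m + 1)) := fun j => b j
  have hv : ∀ j, inner ℝ (v j) (y p) = 0 := fun j => by
    rw [real_inner_comm]
    exact (Submodule.mem_orthogonal_singleton_iff_inner_right).1 (b j).2
  have hvv : ∀ j k, inner ℝ (v j) (v k) = if j = k then (1 : ℝ) else 0 := fun j k => by
    have := orthonormal_iff_ite.1 b.orthonormal j k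
    rwa [Submodule.coe_inner] at this
  set W : Set M := U ∩ y ⁻¹' {w | -1 < inner ℝ w (y p)} with hW
  have hWo : IsOpen W := hy.continuousOn.isOpen_inter_preimage hU
    (isOpen_lt continuous_const (continuous_id.inner continuous_const))
  have hpW : p ∈ W := ⟨hp, by
    change -1 < inner ℝ (y p) (y p)
    rw [real_inner_self_eq_norm_sq, hp1]; norm_num⟩
  have hne : ∀ q ∈ W, 1 + inner ℝ (y q) (y p) ≠ 0 := fun q hq => by
    have : -1 < inner ℝ (y q) (y p) := hq.2
    linarith
  have hW1 : ∀ q ∈ W, ‖y q‖ = 1 := fun q hq => hnorm q hq.1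
  have hex : ∀ q, ∃ X : Fin m → TangentSpace I q, q ∈ W → ∀ j, HasDirDeriv I x q (X j) 0 ∧
      HasDirDeriv I y q (X j) (transport (y p) (v j) (y q)) := by
    intro q
    by_cases hq : q ∈ W
    · choose X hX using fun j => hsurj q hq.1 0 _ (inner_transport_self (hW1 q hq) (hne q hq)
        (v := v j))
      exact ⟨X, fun _ => hX⟩
    · exact ⟨fun _ => 0, fun h => absurd h hq⟩
  have hex' : ∀ q, ∃ X : TangentSpace I q, q ∈ W →
      HasDirDeriv I x q X 1 ∧ HasDirDeriv I y q X 0 := by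
    intro q
    by_cases hq : q ∈ W
    · obtain ⟨X, hX⟩ := hsurj q hq.1 1 0 (inner_zero_left _)
      exact ⟨X, fun _ => hX⟩
    · exact ⟨0, fun h => absurd h hq⟩
  choose X hX using hex
  choose N hN using hex'
  refine ⟨W, hWo, hpW, Set.inter_subset_left,
    Fin.snoc (α := fun _ => (q : M) → TangentSpace I q) (fun j q => X q j) N,
    fun j q => consZero (transport (y p) (v j) (y q)), fun j q hq => ?_, fun q hq j => ?_,
    fun q hq j => ?_, fun q hq => ?_, fun q hq => ?_, fun q hq j k => ?_⟩
  · exact ContDiffAt.comp_contMDiffWithinAt (f := y)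
      (g := fun w => consZero (transport (y p) (v j) w))
      (contDiff_consZero.contDiffAt.comp _ (contDiffAt_transport (hne q hq)))
      ((hy.mono Set.inter_subset_left) q hq)
  · rw [Fin.snoc_castSucc]; exact (hX q hq j).1
  · rw [Fin.snoc_castSucc]; exact (hX q hq j).2.consZero
  · rw [Fin.snoc_last]; exact (hN q hq).1
  · rw [Fin.snoc_last]
    refine (hN q hq).2.consZero.congr_val ?_
    funext j
    refine Fin.cases rfl (fun j => rfl) j
  · rw [rform_consZero, inner_transport hp1 (hW1 q hq) (hne q hq) (hv j) (hv k), hvv]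

end Sphere

section SphereProduct

variable {c : ℝ} {m : ℕ}

local notation "𝕊" => Metric.sphere (0 : EuclideanSpace ℝ (Fin (m + 1))) 1

theorem exists_hasDirDeriv_coe_sphere (y : 𝕊) {w : EuclideanSpace ℝ (Fin (m + 1))}
    (hw : inner ℝ w (y : EuclideanSpace ℝ (Fin (m + 1))) = 0) :
    ∃ X : TangentSpace (𝓡 m) y,
      HasDirDeriv (𝓡 m) (fun y : 𝕊 => (y : EuclideanSpace ℝ (Fin (m + 1)))) y X w := by
  have : Fact (Module.finrank ℝ (EuclideanSpace ℝ (Fin (m + 1))) = m + 1) :=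
    ⟨finrank_euclideanSpace_fin⟩
  have h1 : w ∈ (ℝ ∙ (y : EuclideanSpace ℝ (Fin (m + 1))))ᗮ :=
    (Submodule.mem_orthogonal_singleton_iff_inner_right).2 (by rw [real_inner_comm]; exact hw)
  rw [← range_mvfderiv_subtypeVal (n := m) y] at h1
  obtain ⟨X, hX⟩ := h1
  refine ⟨X, (HasDirDeriv.of_mdifferentiableAt
    ((contMDiff_coe_sphere (m := 1) y).mdifferentiableAt one_ne_zero)).congr_val hX⟩

/-- The projections of the product of the line with the sphere form a submersion onto the
product. -/
theorem exists_hasDirDeriv_prod_sphere (q : ℝ × 𝕊) (s : ℝ)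
    {w : EuclideanSpace ℝ (Fin (m + 1))}
    (hw : inner ℝ w (q.2 : EuclideanSpace ℝ (Fin (m + 1))) = 0) :
    ∃ X : TangentSpace (𝓘(ℝ, ℝ).prod (𝓡 m)) q,
      HasDirDeriv (𝓘(ℝ, ℝ).prod (𝓡 m)) (fun q : ℝ × 𝕊 => q.1) q X s ∧
      HasDirDeriv (𝓘(ℝ, ℝ).prod (𝓡 m))
        (fun q : ℝ × 𝕊 => (q.2 : EuclideanSpace ℝ (Fin (m + 1)))) q X w := by
  obtain ⟨Z, g', hg', hZ⟩ := exists_hasDirDeriv_coe_sphere q.2 hw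
  refine ⟨(s, Z), ⟨_, hasMFDerivAt_fst q, rfl⟩,
    ⟨_, HasMFDerivAt.comp q hg' (hasMFDerivAt_snd q), ?_⟩⟩
  exact hZ

theorem contMDiff_coe_snd :
    ContMDiff (𝓘(ℝ, ℝ).prod (𝓡 m)) 𝓘(ℝ, EuclideanSpace ℝ (Fin (m + 1))) ∞
      (fun q : ℝ × 𝕊 => (q.2 : EuclideanSpace ℝ (Fin (m + 1)))) := by
  have : Fact (Module.finrank ℝ (EuclideanSpace ℝ (Fin (m + 1))) = m + 1) :=
    ⟨finrank_euclideanSpace_fin⟩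
  exact (contMDiff_coe_sphere (m := ∞) (n := m)).comp contMDiff_snd

end SphereProduct

/-! ### From Legendre curves to submanifolds -/

section Curves

variable {c : ℝ} {J : Set ℝ} {μ φ : ℝ → ℝ} {z : ℝ → Fin 2 → ℂ}

/-- A unit speed Legendre curve `z` of curvature `φ` in the quadric in `ℂ²`, whose image under the
linear functional `ℓ` rotates with the angular velocity `μ`. -/
structure IsLegendreCurve (c : ℝ) (J : Set ℝ) (μ φ : ℝ → ℝ) (ℓ : (Fin 2 → ℂ) →L[ℂ] ℂ)
    (z : ℝ → Fin 2 → ℂ) : Prop where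
  isOpen : IsOpen J
  smooth : ContDiffOn ℝ ∞ z J
  mem : ∀ t ∈ J, herm c (z t) (z t) = c
  legendre : ∀ t ∈ J, herm c (deriv z t) (z t) = 0
  unitSpeed : ∀ t ∈ J, herm c (deriv z t) (deriv z t) = 1
  ode : ∀ t ∈ J, deriv (deriv z) t = (Complex.I * φ t) • deriv z t - (c : ℂ) • z t
  ne_zero : ∀ t ∈ J, ℓ (z t) ≠ 0
  log_deriv : ∀ t ∈ J, ∃ a : ℝ, ℓ (deriv z t) = (a + Complex.I * μ t) * ℓ (z t)

theorem deriv_clm {F : Type} [NormedAddCommGroup F] [NormedSpace ℂ F] (hJ : IsOpen J)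
    (ℓ : F →L[ℂ] ℂ) {z : ℝ → F} (hz : ContDiffOn ℝ ∞ z J) {t : ℝ} (ht : t ∈ J) :
    deriv (fun t => ℓ (z t)) t = ℓ (deriv z t) :=
  ((ℓ.restrictScalars ℝ).hasFDerivAt.comp_hasDerivAt t (hasDerivAt_of_smooth hJ hz ht)).deriv

theorem deriv_deriv_clm {F : Type} [NormedAddCommGroup F] [NormedSpace ℂ F] (hJ : IsOpen J)
    (ℓ : F →L[ℂ] ℂ) {z : ℝ → F} (hz : ContDiffOn ℝ ∞ z J) {t : ℝ} (ht : t ∈ J) :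
    deriv (deriv fun t => ℓ (z t)) t = ℓ (deriv (deriv z) t) := by
  rw [← deriv_clm hJ ℓ (contDiffOn_deriv_of_smooth hJ hz) ht]
  refine Filter.EventuallyEq.deriv_eq ?_
  filter_upwards [hJ.mem_nhds ht] with s hs using deriv_clm hJ ℓ hz hs

/-- A Legendre curve is a profile curve in linear coordinates `ℓ, ℓ'` in which the Hermitian form
of `ℂ²` is the one of the plane spanned by `Y` and `K`. -/
theorem IsLegendreCurve.isProfile {ℓ ℓ' : (Fin 2 → ℂ) →L[ℂ] ℂ} {δ β κ : ℝ}
    (h : IsLegendreCurve c J μ φ ℓ z)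
    (hℓ : ∀ v w, planeForm δ β κ (ℓ v) (ℓ' v) (ℓ w) (ℓ' w) = herm c v w) :
    IsProfile c δ β κ J μ φ (fun t => ℓ (z t)) (fun t => ℓ' (z t)) where
  isOpen := h.isOpen
  smooth_fst := (ℓ.restrictScalars ℝ).contDiff.comp_contDiffOn h.smooth
  smooth_snd := (ℓ'.restrictScalars ℝ).contDiff.comp_contDiffOn h.smooth
  mem t ht := by rw [hℓ, h.mem t ht]
  legendre t ht := by
    rw [deriv_clm h.isOpen ℓ h.smooth ht, deriv_clm h.isOpen ℓ' h.smooth ht, hℓ, h.legendre t ht]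
  unitSpeed t ht := by
    rw [deriv_clm h.isOpen ℓ h.smooth ht, deriv_clm h.isOpen ℓ' h.smooth ht, hℓ, h.unitSpeed t ht]
  ode_fst t ht := by
    rw [deriv_clm h.isOpen ℓ h.smooth ht, deriv_deriv_clm h.isOpen ℓ h.smooth ht, h.ode t ht,
      map_sub, map_smul, map_smul, smul_eq_mul, smul_eq_mul]
  ode_snd t ht := by
    rw [deriv_clm h.isOpen ℓ' h.smooth ht, deriv_deriv_clm h.isOpen ℓ' h.smooth ht, h.ode t ht,
      map_sub, map_smul, map_smul, smul_eq_mul, smul_eq_mul]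
  ne_zero := h.ne_zero
  log_deriv t ht := by
    rw [deriv_clm h.isOpen ℓ h.smooth ht]
    exact h.log_deriv t ht

/-- The coordinate `z_i`. -/
def coord (i : Fin 2) : (Fin 2 → ℂ) →L[ℂ] ℂ := ContinuousLinearMap.proj i

theorem herm_two (c : ℝ) (v w : Fin 2 → ℂ) :
    herm c v w = c * v 0 * conj (w 0) + v 1 * conj (w 1) := by
  simp [herm, Fin.sum_univ_two, sig]

theorem IsLegendreCurve.isProfile_sphere (h : IsLegendreCurve c J μ φ (coord 1) z) :
    IsProfile c 1 0 c J μ φ (fun t => z t 1) (fun t => z t 0) :=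
  h.isProfile (ℓ' := coord 0) fun v w => by
    rw [herm_two, planeForm]; simp [coord]; ring

theorem IsLegendreCurve.isProfile_hyperboloid (h : IsLegendreCurve (-1) J μ φ (coord 0) z) :
    IsProfile (-1) (-1) 0 1 J μ φ (fun t => z t 0) (fun t => z t 1) :=
  h.isProfile (ℓ' := coord 1) fun v w => by
    rw [herm_two, planeForm]; simp [coord]

theorem IsLegendreCurve.isProfile_horosphere
    (h : IsLegendreCurve (-1) J μ φ (coord 0 - coord 1) z) :
    IsProfile (-1) (-1) (-1) 0 J μ φ (fun t => z t 0 - z t 1) (fun t => z t 1) :=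
  h.isProfile (ℓ' := coord 1) fun v w => by
    rw [herm_two, planeForm]; simp [coord]; ring

theorem psiSphere_eq {m : ℕ} (z : ℝ → Fin 2 → ℂ)
    (q : ℝ × Metric.sphere (0 : EuclideanSpace ℝ (Fin (m + 1))) 1) :
    psiSphere z q =
      z q.1 1 • cx (consZero (q.2 : EuclideanSpace ℝ (Fin (m + 1)))) +
        z q.1 0 • cx (Fin.cons 1 fun _ => 0) := by
  funext j
  refine Fin.cases ?_ (fun j => ?_) j <;> simp [psiSphere, cx, consZero]

theorem psiHyperboloid_eq {m : ℕ} (z : ℝ → Fin 2 → ℂ) (q : ℝ × EuclideanSpace ℝ (Fin m)) :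
    psiHyperboloid z q =
      z q.1 0 • cx (hyperboloidMap q.2) + z q.1 1 • cx (hyperboloidAxis m) := by
  funext j
  refine Fin.cases ?_ (fun j => Fin.lastCases ?_ (fun j => ?_) j) j <;>
    simp [psiHyperboloid, cx, hyperboloidMap, hyperboloidAxis]

theorem psiHorosphere_eq {m : ℕ} (z : ℝ → Fin 2 → ℂ) (q : ℝ × EuclideanSpace ℝ (Fin m)) :
    psiHorosphere z q =
      (z q.1 0 - z q.1 1) • cx (horosphereMap q.2) + z q.1 1 • cx (horosphereAxis m) := by
  funext j
  refine Fin.cases ?_ (fun j => Fin.cases ?_ (fun j => ?_) j) j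
  · simp [psiHorosphere, cx, horosphereMap, horosphereAxis]; ring
  · simp [psiHorosphere, cx, horosphereMap, horosphereAxis]; ring
  · simp [psiHorosphere, cx, horosphereMap, horosphereAxis]

variable {m : ℕ} {r : ℝ}

theorem yieldsOnHyperboloid (hm : 1 ≤ m) (hμ : ∀ t ∈ J, μ t ≠ 0) (hJ : J.Nonempty)
    (h : IsLegendreCurve (-1) J μ (fun t => r * μ t) (coord 0) z) :
    YieldsOnHyperboloid m (-1) r J μ z := by
  rw [YieldsOnHyperboloid]
  simp only [psiHyperboloid_eq]
  obtain ⟨t, ht⟩ := hJ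
  exact isHUmbilicalOn_rotation (x := Prod.fst) (Y := fun q => hyperboloidMap q.2) (Or.inr rfl) hm
    (by simp [add_comm]) h.isProfile_hyperboloid hμ (h.isOpen.prod isOpen_univ)
    ⟨(t, 0), ht, trivial⟩
    contDiff_fst.contMDiff.contMDiffOn contDiff_hyperboloidMap.contMDiff.contMDiffOn
    (fun q hq => hq.1) (fun q _ => rform_hyperboloidMap q.2)
    (fun q _ => rform_hyperboloidMap_axis q.2) rform_hyperboloidAxis
    fun p hp => ⟨_, h.isOpen.prod isOpen_univ, hp, subset_rfl, _, _, isAdaptedFrame_hyperboloid _⟩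

theorem yieldsOnHorosphere (hm : 1 ≤ m) (hμ : ∀ t ∈ J, μ t ≠ 0) (hJ : J.Nonempty)
    (h : IsLegendreCurve (-1) J μ (fun t => r * μ t) (coord 0 - coord 1) z) :
    YieldsOnHorosphere m (-1) r J μ z := by
  rw [YieldsOnHorosphere]
  simp only [psiHorosphere_eq]
  obtain ⟨t, ht⟩ := hJ
  exact isHUmbilicalOn_rotation (x := Prod.fst) (Y := fun q => horosphereMap q.2) (Or.inr rfl) hm
    (by simp [add_comm]) h.isProfile_horosphere hμ (h.isOpen.prod isOpen_univ) ⟨(t, 0), ht, trivial⟩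
    contDiff_fst.contMDiff.contMDiffOn contDiff_horosphereMap.contMDiff.contMDiffOn
    (fun q hq => hq.1) (fun q _ => rform_horosphereMap q.2)
    (fun q _ => rform_horosphereMap_axis q.2) rform_horosphereAxis
    fun p hp => ⟨_, h.isOpen.prod isOpen_univ, hp, subset_rfl, _, _, isAdaptedFrame_horosphere _⟩

theorem rform_consZero_axis (y : EuclideanSpace ℝ (Fin (m + 1))) :
    rform c (consZero y) (Fin.cons 1 fun _ => 0) = 0 := by
  rw [consZero, rform_cons]; simp

theorem rform_sphereAxis :
    rform c (Fin.cons 1 fun _ => 0 : Fin (m + 2) → ℝ) (Fin.cons 1 fun _ => 0) = c := by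
  rw [rform_cons]; simp

theorem rform_consZero_self {y : EuclideanSpace ℝ (Fin (m + 1))} (hy : ‖y‖ = 1) :
    rform c (consZero y) (consZero y) = 1 := by
  rw [rform_consZero, real_inner_self_eq_norm_sq, hy, one_pow]

theorem yieldsOnSphere (hc : c = 1 ∨ c = -1) (hm : 1 ≤ m) (hμ : ∀ t ∈ J, μ t ≠ 0)
    (hJ : J.Nonempty) (h : IsLegendreCurve c J μ (fun t => r * μ t) (coord 1) z) :
    YieldsOnSphere m c r J μ z := by
  rw [YieldsOnSphere]
  simp only [psiSphere_eq]
  have hU : IsOpen (J ×ˢ (Set.univ : Set (Metric.sphere (0 : EuclideanSpace ℝ (Fin (m + 1))) 1))) :=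
    h.isOpen.prod isOpen_univ
  have : Nonempty (Metric.sphere (0 : EuclideanSpace ℝ (Fin (m + 1))) 1) :=
    ⟨⟨EuclideanSpace.single 0 1, by simp⟩⟩
  have hne : (J ×ˢ
      (Set.univ : Set (Metric.sphere (0 : EuclideanSpace ℝ (Fin (m + 1))) 1))).Nonempty :=
    hJ.prod Set.univ_nonempty
  have hdim : Module.finrank ℝ (ℝ × EuclideanSpace ℝ (Fin m)) = m + 1 := by simp [add_comm]
  have hY : ContMDiff (𝓘(ℝ, ℝ).prod (𝓡 m)) 𝓘(ℝ, Fin (m + 2) → ℝ) ∞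
      (fun q : ℝ × Metric.sphere (0 : EuclideanSpace ℝ (Fin (m + 1))) 1 =>
        consZero (q.2 : EuclideanSpace ℝ (Fin (m + 1)))) :=
    contDiff_consZero.comp_contMDiff contMDiff_coe_snd
  have hx : ContMDiff (𝓘(ℝ, ℝ).prod (𝓡 m)) 𝓘(ℝ, ℝ) ∞
      (fun q : ℝ × Metric.sphere (0 : EuclideanSpace ℝ (Fin (m + 1))) 1 => q.1) := contMDiff_fst
  refine isHUmbilicalOn_rotation hc hm hdim h.isProfile_sphere hμ hU hne hx.contMDiffOn
    hY.contMDiffOn (fun q hq => hq.1) (fun q _ => rform_consZero_self (norm_eq_of_mem_sphere q.2))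
    (fun q _ => rform_consZero_axis _) rform_sphereAxis fun p hp => ?_
  exact exists_isAdaptedFrame_sphere hU contMDiff_coe_snd.contMDiffOn
      (fun q _ => norm_eq_of_mem_sphere q.2)
      (fun q _ s w hw => exists_hasDirDeriv_prod_sphere q s hw) hp

/-- The part of the elliptic rotation of a curve over a stereographic chart of the sphere, as an
immersion of an open subset of a Euclidean space. -/
theorem exists_isHUmbilicalOfRatioOn (hc : c = 1 ∨ c = -1) (hm : 1 ≤ m) (hμ : ∀ t ∈ J, μ t ≠ 0)
    (hJ : IsConnected J) (h : IsLegendreCurve c J μ (fun t => r * μ t) (coord 1) z) :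
    ∃ (U : Set (EuclideanSpace ℝ (Fin (m + 1)))) (f : EuclideanSpace ℝ (Fin (m + 1)) → Mat (m + 1)),
      IsOpen U ∧ IsConnected U ∧
        IsHUmbilicalOfRatioOn 𝓘(ℝ, EuclideanSpace ℝ (Fin (m + 1))) c f U r := by
  let A : EuclideanSpace ℝ (Fin (m + 1)) ≃L[ℝ] ℝ × EuclideanSpace ℝ (Fin m) :=
    ContinuousLinearEquiv.ofFinrankEq (by simp [add_comm])
  let p₀ : Metric.sphere (0 : EuclideanSpace ℝ (Fin (m + 1))) 1 :=
    ⟨EuclideanSpace.single 0 1, by simp⟩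
  let e := chartAt (EuclideanSpace ℝ (Fin m)) p₀
  have he : e.target = Set.univ := by
    have : Fact (Module.finrank ℝ (EuclideanSpace ℝ (Fin (m + 1))) = m + 1) :=
      ⟨finrank_euclideanSpace_fin⟩
    exact stereographic'_target (n := m) (-p₀)
  let x : EuclideanSpace ℝ (Fin (m + 1)) → ℝ := fun v => (A v).1
  let y : EuclideanSpace ℝ (Fin (m + 1)) → EuclideanSpace ℝ (Fin (m + 1)) :=
    fun v => (e.symm (A v).2 : EuclideanSpace ℝ (Fin (m + 1)))
  have hx : ContDiff ℝ ∞ x := contDiff_fst.comp A.contDiff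
  have hy : ContMDiff 𝓘(ℝ, EuclideanSpace ℝ (Fin (m + 1)))
      𝓘(ℝ, EuclideanSpace ℝ (Fin (m + 1))) ∞ y := by
    have h1 : ContMDiff 𝓘(ℝ, EuclideanSpace ℝ (Fin m)) (𝓡 m) ∞ e.symm := by
      rw [← contMDiffOn_univ, ← he]
      exact contMDiffOn_chart_symm
    have h2 : ContDiff ℝ ∞ fun v => (A v).2 := contDiff_snd.comp A.contDiff
    have : Fact (Module.finrank ℝ (EuclideanSpace ℝ (Fin (m + 1))) = m + 1) :=
      ⟨finrank_euclideanSpace_fin⟩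
    exact (contMDiff_coe_sphere (m := ∞) (n := m)).comp (h1.comp h2.contMDiff)
  have hnorm : ∀ v, ‖y v‖ = 1 := fun v => norm_eq_of_mem_sphere _
  have hsurj : ∀ (q : EuclideanSpace ℝ (Fin (m + 1))) (s : ℝ) (w : EuclideanSpace ℝ (Fin (m + 1))),
      inner ℝ w (y q) = 0 → ∃ X : TangentSpace 𝓘(ℝ, EuclideanSpace ℝ (Fin (m + 1))) q,
      HasDirDeriv 𝓘(ℝ, EuclideanSpace ℝ (Fin (m + 1))) x q X s ∧
      HasDirDeriv 𝓘(ℝ, EuclideanSpace ℝ (Fin (m + 1))) y q X w := by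
    intro q s w hw
    obtain ⟨Z, g', hg', hZ⟩ := exists_hasDirDeriv_coe_sphere (e.symm (A q).2) hw
    have he1 : e.symm.MDifferentiable (𝓡 m) (𝓡 m) := (mdifferentiable_chart p₀).symm
    have he2 : (A q).2 ∈ e.symm.source := by rw [e.symm_source, he]; trivial
    obtain ⟨Z', hZ'⟩ := he1.mfderiv_surjective he2 Z
    let Z'' : EuclideanSpace ℝ (Fin m) := Z'
    have hA1 : HasDirDeriv 𝓘(ℝ, EuclideanSpace ℝ (Fin (m + 1))) x q (A.symm (s, Z'')) s :=
      (hasDirDeriv_of_hasFDerivAt (((ContinuousLinearMap.fst ℝ ℝ _).comp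
        A.toContinuousLinearMap).hasFDerivAt (x := q)) _).congr_val (by simp)
    have hA2 : HasMFDerivAt 𝓘(ℝ, EuclideanSpace ℝ (Fin (m + 1))) 𝓘(ℝ, EuclideanSpace ℝ (Fin m))
        (fun v => (A v).2) q ((ContinuousLinearMap.snd ℝ ℝ _).comp A.toContinuousLinearMap) :=
      (ContinuousLinearMap.hasFDerivAt
        ((ContinuousLinearMap.snd ℝ ℝ _).comp A.toContinuousLinearMap)).hasMFDerivAt
    refine ⟨A.symm (s, Z''), hA1, _, HasMFDerivAt.comp q hg' (HasMFDerivAt.comp q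
      (he1.mdifferentiableAt he2).hasMFDerivAt hA2), ?_⟩
    rw [← hZ, ← hZ']
    have h3 : ((ContinuousLinearMap.snd ℝ ℝ _).comp A.toContinuousLinearMap) (A.symm (s, Z'')) =
      Z'' := by simp
    exact congrArg (fun X => g' (mfderiv (𝓡 m) (𝓡 m) e.symm (A q).2 X)) h3
  have hU : IsOpen (A ⁻¹' (J ×ˢ Set.univ)) := (h.isOpen.prod isOpen_univ).preimage A.continuous
  have hconn : IsConnected (A ⁻¹' (J ×ˢ Set.univ)) :=
    A.toHomeomorph.isConnected_preimage.2 (hJ.prod isConnected_univ)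
  refine ⟨_, _, hU, hconn, fun q => μ (x q), fun q => r * μ (x q), isHUmbilicalOn_rotation hc hm
    finrank_euclideanSpace_fin h.isProfile_sphere hμ hU hconn.nonempty hx.contMDiff.contMDiffOn
    (contDiff_consZero.comp_contMDiff hy).contMDiffOn (fun q hq => hq.1)
    (fun q _ => rform_consZero_self (hnorm q)) (fun q _ => rform_consZero_axis _) rform_sphereAxis
    fun p hp => ?_, fun q hq => ⟨hμ _ hq.1, mul_div_cancel_right₀ _ (hμ _ hq.1)⟩⟩
  exact exists_isAdaptedFrame_sphere hU hy.contMDiffOn (fun q _ => hnorm q)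
    (fun q _ => hsurj q) hp

end Curves

/-! ### The differential equation -/

section Equation

variable {r c : ℝ} {J : Set ℝ} {a μ : ℝ → ℝ}

/-- `a + i μ` is the logarithmic derivative of a coordinate of a Legendre curve of curvature `r μ`:
on the open interval `J` the pair satisfies the real and imaginary parts of the Riccati equation
`b' + b² = i r μ b - c`, and `μ` has no zeros. -/
structure IsRiccati (r c : ℝ) (J : Set ℝ) (a μ : ℝ → ℝ) : Prop where
  isOpen : IsOpen J
  ordConnected : J.OrdConnected
  nonempty : J.Nonempty
  ne_zero : ∀ t ∈ J, μ t ≠ 0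
  deriv_fst : ∀ t ∈ J, HasDerivAt a (-a t ^ 2 - (r - 1) * μ t ^ 2 - c) t
  deriv_snd : ∀ t ∈ J, HasDerivAt μ ((r - 2) * a t * μ t) t

theorem IsSolution.isRiccati (hr : r ≠ 2) (h : IsSolution r c J μ) :
    IsRiccati r c J (fun t => deriv μ t / ((r - 2) * μ t)) μ := by
  have hr' : r - 2 ≠ 0 := sub_ne_zero.2 hr
  have h2 : DifferentiableOn ℝ μ J ∧ ContDiffOn ℝ 1 (deriv μ) J := by
    have h3 := (contDiffOn_succ_iff_deriv_of_isOpen (n := 1) h.isOpen).1 (by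
      simpa only [one_add_one_eq_two] using h.twice)
    exact ⟨h3.1, h3.2.2⟩
  have hd : ∀ t ∈ J, HasDerivAt μ (deriv μ t) t := fun t ht =>
    (h2.1.differentiableAt (h.isOpen.mem_nhds ht)).hasDerivAt
  have hdd : ∀ t ∈ J, HasDerivAt (deriv μ) (deriv (deriv μ) t) t := fun t ht =>
    ((h2.2.differentiableOn one_ne_zero).differentiableAt (h.isOpen.mem_nhds ht)).hasDerivAt
  refine ⟨h.isOpen, h.ordConnected, h.nonempty, h.ne_zero, fun t ht => ?_, fun t ht => ?_⟩
  · have hμ := h.ne_zero t ht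
    have h3 := (hdd t ht).div ((hd t ht).const_mul (r - 2)) (mul_ne_zero hr' hμ)
    refine h3.congr_deriv ?_
    have h4 := h.ode t ht
    field_simp at h4 ⊢
    linear_combination h4
  · refine (hd t ht).congr_deriv ?_
    have hμ := h.ne_zero t ht
    field_simp

theorem smooth_of_hasDerivAt (hJ : IsOpen J) {f f' : ℝ → ℝ} (hf : ∀ t ∈ J, HasDerivAt f (f' t) t)
    {n : ℕ} (hf' : ContDiffOn ℝ n f' J) : ContDiffOn ℝ (n + 1 : ℕ) f J := by
  rw [Nat.cast_add, Nat.cast_one, contDiffOn_succ_iff_deriv_of_isOpen hJ]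
  refine ⟨fun t ht => (hf t ht).differentiableAt.differentiableWithinAt, fun h => ?_,
    hf'.congr fun t ht => (hf t ht).deriv⟩
  exact absurd h (by simp)

/-- The regularity of a solution is bootstrapped from the differential equations. -/
theorem IsRiccati.smooth (h : IsRiccati r c J a μ) :
    ContDiffOn ℝ ∞ a J ∧ ContDiffOn ℝ ∞ μ J := by
  have key : ∀ n : ℕ, ContDiffOn ℝ n a J ∧ ContDiffOn ℝ n μ J := by
    intro n
    induction n with
    | zero =>
      simp only [Nat.cast_zero, contDiffOn_zero]
      exact ⟨fun t ht => (h.deriv_fst t ht).continuousAt.continuousWithinAt,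
        fun t ht => (h.deriv_snd t ht).continuousAt.continuousWithinAt⟩
    | succ n ih =>
      exact ⟨smooth_of_hasDerivAt h.isOpen h.deriv_fst
          (((ih.1.pow 2).neg.sub (contDiffOn_const.mul (ih.2.pow 2))).sub contDiffOn_const),
        smooth_of_hasDerivAt h.isOpen h.deriv_snd ((contDiffOn_const.mul ih.1).mul ih.2)⟩
  exact ⟨contDiffOn_infty.2 fun n => (key n).1, contDiffOn_infty.2 fun n => (key n).2⟩

theorem exists_antideriv (hJ : IsOpen J) (hJ' : J.OrdConnected) (hne : J.Nonempty) {f : ℝ → ℝ}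
    (hf : ContDiffOn ℝ ∞ f J) :
    ∃ F : ℝ → ℝ, ContDiffOn ℝ ∞ F J ∧ ∀ t ∈ J, HasDerivAt F (f t) t := by
  obtain ⟨t₀, ht₀⟩ := hne
  have hd : ∀ t ∈ J, HasDerivAt (fun t => ∫ s in t₀..t, f s) (f t) t := by
    intro t ht
    refine intervalIntegral.integral_hasDerivAt_right ?_ ?_ ?_
    · exact (hf.continuousOn.mono (hJ'.uIcc_subset ht₀ ht)).intervalIntegrable
    · exact hf.continuousOn.stronglyMeasurableAtFilter hJ t ht
    · exact hf.continuousOn.continuousAt (hJ.mem_nhds ht)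
  refine ⟨_, ?_, hd⟩
  rw [contDiffOn_infty_iff_deriv_of_isOpen hJ]
  exact ⟨fun t ht => (hd t ht).differentiableAt.differentiableWithinAt,
    hf.congr fun t ht => (hd t ht).deriv⟩

theorem eq_of_hasDerivAt_zero {F : Type} [NormedAddCommGroup F] [NormedSpace ℝ F] (hJ : IsOpen J)
    (hJ' : J.OrdConnected) {f : ℝ → F} (hf : ∀ t ∈ J, HasDerivAt f 0 t) :
    ∃ k, ∀ t ∈ J, f t = k :=
  hJ.exists_is_const_of_deriv_eq_zero hJ'.isPreconnected
    (fun t ht => (hf t ht).differentiableAt.differentiableWithinAt) fun t ht => (hf t ht).deriv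

/-- The quantity `μ² + a² + c` satisfies a linear differential equation of first order, hence has a
constant sign. -/
theorem IsRiccati.exists_energy (h : IsRiccati r c J a μ) :
    ∃ (A : ℝ → ℝ) (k : ℝ), ContDiffOn ℝ ∞ A J ∧ (∀ t ∈ J, HasDerivAt A (a t) t) ∧
      ∀ t ∈ J, Real.exp (2 * A t) * (μ t ^ 2 + a t ^ 2 + c) = k := by
  obtain ⟨A, hA, hA'⟩ := exists_antideriv h.isOpen h.ordConnected h.nonempty h.smooth.1
  have hd : ∀ t ∈ J, HasDerivAt (fun t => Real.exp (2 * A t) * (μ t ^ 2 + a t ^ 2 + c)) 0 t := by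
    intro t ht
    have h1 := ((hA' t ht).const_mul 2).exp
    have h2 := (((h.deriv_snd t ht).pow 2).add ((h.deriv_fst t ht).pow 2)).add_const c
    refine (h1.mul h2).congr_deriv ?_
    simp
    ring
  obtain ⟨k, hk⟩ := eq_of_hasDerivAt_zero h.isOpen h.ordConnected hd
  exact ⟨A, k, hA, hA', hk⟩

/-- The constant in `exists_energy` can be normalized to `1` or `-1`, unless it is zero. -/
theorem IsRiccati.exists_energy_normalized (h : IsRiccati r c J a μ) {t₀ : ℝ} (ht₀ : t₀ ∈ J)
    (h0 : μ t₀ ^ 2 + a t₀ ^ 2 + c ≠ 0) :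
    ∃ A : ℝ → ℝ, ContDiffOn ℝ ∞ A J ∧ (∀ t ∈ J, HasDerivAt A (a t) t) ∧
      ∀ t ∈ J, Real.exp (2 * A t) * (μ t ^ 2 + a t ^ 2 + c) =
        SignType.sign (μ t₀ ^ 2 + a t₀ ^ 2 + c) := by
  -- adding a constant to `A` scales `exp (2 A)`
  obtain ⟨A, k, hA, hA', hk⟩ := h.exists_energy
  have hk0 : k ≠ 0 := by
    rw [← hk t₀ ht₀]; exact mul_ne_zero (Real.exp_pos _).ne' h0
  have hs : (SignType.sign (μ t₀ ^ 2 + a t₀ ^ 2 + c) : ℝ) * |k| = k := by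
    rw [← hk t₀ ht₀, abs_mul, abs_of_pos (Real.exp_pos _), mul_left_comm, sign_mul_abs]
  refine ⟨fun t => A t - Real.log |k| / 2, hA.sub contDiffOn_const,
    fun t ht => (hA' t ht).sub_const _, fun t ht => ?_⟩
  have h1 : Real.exp (2 * (A t - Real.log |k| / 2)) = Real.exp (2 * A t) / |k| := by
    rw [mul_sub, mul_div_cancel₀ _ two_ne_zero, Real.exp_sub, Real.exp_log (abs_pos.2 hk0)]
  rw [h1, div_mul_eq_mul_div, hk t ht, div_eq_iff (abs_ne_zero.2 hk0), hs]

theorem IsRiccati.isSolution (hr : r ≠ 2) (h : IsRiccati r c J a μ) : IsSolution r c J μ := by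
  refine ⟨h.isOpen, h.ordConnected, h.nonempty, contDiffOn_infty.1 h.smooth.2 2,
    h.ne_zero, fun t ht => ?_⟩
  have hr' : r - 2 ≠ 0 := sub_ne_zero.2 hr
  have h1 : deriv (deriv μ) t = (r - 2) * (-a t ^ 2 - (r - 1) * μ t ^ 2 - c) * μ t +
      (r - 2) * a t * ((r - 2) * a t * μ t) := by
    have h2 : deriv (deriv μ) t = deriv (fun t => (r - 2) * a t * μ t) t := by
      refine Filter.EventuallyEq.deriv_eq ?_
      filter_upwards [h.isOpen.mem_nhds ht] with s hs using (h.deriv_snd s hs).deriv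
    rw [h2]
    exact (((h.deriv_fst t ht).const_mul (r - 2)).mul (h.deriv_snd t ht)).deriv
  rw [h1, (h.deriv_snd t ht).deriv]
  field_simp
  ring

theorem exists_isRiccati (r c a₀ : ℝ) {μ₀ : ℝ} (hμ₀ : μ₀ ≠ 0) :
    ∃ (J : Set ℝ) (a μ : ℝ → ℝ), IsRiccati r c J a μ ∧ 0 ∈ J ∧ a 0 = a₀ ∧ μ 0 = μ₀ := by
  let V : ℝ × ℝ → ℝ × ℝ := fun x => (-x.1 ^ 2 - (r - 1) * x.2 ^ 2 - c, (r - 2) * x.1 * x.2)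
  have hV : ContDiff ℝ 1 V :=
    (((contDiff_fst.pow 2).neg.sub (contDiff_const.mul (contDiff_snd.pow 2))).sub
      contDiff_const).prodMk ((contDiff_const.mul contDiff_fst).mul contDiff_snd)
  obtain ⟨α, hα0, ε, hε, hα⟩ := (hV.contDiffAt
    (x := (a₀, μ₀))).exists_forall_mem_closedBall_exists_eq_forall_mem_Ioo_hasDerivAt₀ 0
  have hd1 : ∀ t ∈ Set.Ioo (0 - ε) (0 + ε), HasDerivAt (fun t => (α t).1) (V (α t)).1 t :=
    fun t ht => (ContinuousLinearMap.fst ℝ ℝ ℝ).hasFDerivAt.comp_hasDerivAt t (hα t ht)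
  have hd2 : ∀ t ∈ Set.Ioo (0 - ε) (0 + ε), HasDerivAt (fun t => (α t).2) (V (α t)).2 t :=
    fun t ht => (ContinuousLinearMap.snd ℝ ℝ ℝ).hasFDerivAt.comp_hasDerivAt t (hα t ht)
  have h0 : (0 : ℝ) ∈ Set.Ioo (0 - ε) (0 + ε) := by constructor <;> linarith
  have hc := (hd2 0 h0).continuousAt.eventually_ne (by rw [hα0]; exact hμ₀)
  obtain ⟨δ, hδ, hball⟩ := Metric.eventually_nhds_iff_ball.1
    (hc.and (isOpen_Ioo.mem_nhds h0))
  rw [Real.ball_eq_Ioo] at hball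
  refine ⟨Set.Ioo (0 - δ) (0 + δ), fun t => (α t).1, fun t => (α t).2,
    ⟨isOpen_Ioo, Set.ordConnected_Ioo, ⟨0, by constructor <;> linarith⟩, fun t ht => (hball t ht).1,
      fun t ht => hd1 t (hball t ht).2, fun t ht => hd2 t (hball t ht).2⟩,
    by constructor <;> linarith, by simp [hα0], by simp [hα0]⟩

end Equation

/-! ### The Legendre curves of a solution -/

section LegendreCurves

variable {r c : ℝ} {J : Set ℝ} {a μ φ : ℝ → ℝ}

theorem isLegendreCurve_of_hasDerivAt {ℓ : (Fin 2 → ℂ) →L[ℂ] ℂ} {z z' z'' : ℝ → Fin 2 → ℂ}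
    (hJ : IsOpen J) (hz : ContDiffOn ℝ ∞ z J) (h1 : ∀ t ∈ J, HasDerivAt z (z' t) t)
    (h2 : ∀ t ∈ J, HasDerivAt z' (z'' t) t) (hmem : ∀ t ∈ J, herm c (z t) (z t) = c)
    (hleg : ∀ t ∈ J, herm c (z' t) (z t) = 0) (hunit : ∀ t ∈ J, herm c (z' t) (z' t) = 1)
    (hode : ∀ t ∈ J, z'' t = (Complex.I * φ t) • z' t - (c : ℂ) • z t)
    (hne : ∀ t ∈ J, ℓ (z t) ≠ 0)
    (hlog : ∀ t ∈ J, ℓ (z' t) = (a t + Complex.I * μ t) * ℓ (z t)) :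
    IsLegendreCurve c J μ φ ℓ z := by
  have hd : ∀ t ∈ J, deriv z t = z' t := fun t ht => (h1 t ht).deriv
  have hdd : ∀ t ∈ J, deriv (deriv z) t = z'' t := fun t ht => by
    rw [← (h2 t ht).deriv]
    refine Filter.EventuallyEq.deriv_eq ?_
    filter_upwards [hJ.mem_nhds ht] with s hs using hd s hs
  exact ⟨hJ, hz, hmem, fun t ht => by rw [hd t ht]; exact hleg t ht,
    fun t ht => by rw [hd t ht]; exact hunit t ht,
    fun t ht => by rw [hdd t ht, hd t ht]; exact hode t ht, hne,
    fun t ht => ⟨a t, by rw [hd t ht]; exact hlog t ht⟩⟩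

/-- `exp (A + i θ)`. -/
def polar (A θ : ℝ → ℝ) (t : ℝ) : ℂ := Complex.exp (A t + θ t * Complex.I)

theorem polar_mul_conj (A θ : ℝ → ℝ) (t : ℝ) :
    polar A θ t * conj (polar A θ t) = (Real.exp (2 * A t) : ℝ) := by
  rw [Complex.mul_conj, Complex.normSq_eq_norm_sq, polar, Complex.norm_exp, ← Real.exp_nat_mul]
  simp

theorem polar_ne_zero (A θ : ℝ → ℝ) (t : ℝ) : polar A θ t ≠ 0 := Complex.exp_ne_zero _

theorem contDiffOn_ofReal {f : ℝ → ℝ} (hf : ContDiffOn ℝ ∞ f J) :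
    ContDiffOn ℝ ∞ (fun t => (f t : ℂ)) J := Complex.ofRealCLM.contDiff.comp_contDiffOn hf

theorem contDiffOn_polar {A θ : ℝ → ℝ} (hA : ContDiffOn ℝ ∞ A J) (hθ : ContDiffOn ℝ ∞ θ J) :
    ContDiffOn ℝ ∞ (polar A θ) J :=
  ((contDiffOn_ofReal hA).add ((contDiffOn_ofReal hθ).mul contDiffOn_const)).cexp

theorem hasDerivAt_polar {A θ : ℝ → ℝ} {A' θ' t : ℝ} (hA : HasDerivAt A A' t)
    (hθ : HasDerivAt θ θ' t) :
    HasDerivAt (polar A θ) ((A' + Complex.I * θ') * polar A θ t) t := by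
  refine ((hA.ofReal_comp.add (hθ.ofReal_comp.mul_const Complex.I)).cexp).congr_deriv ?_
  simp only [polar, Pi.add_apply]; ring

theorem hasDerivAt_vec {f g : ℝ → ℂ} {f' g' : ℂ} {t : ℝ} (hf : HasDerivAt f f' t)
    (hg : HasDerivAt g g' t) : HasDerivAt (fun t => ![f t, g t]) ![f', g'] t := by
  rw [hasDerivAt_pi]
  intro i
  fin_cases i
  · exact hf
  · exact hg

theorem contDiffOn_vec {f g : ℝ → ℂ} (hf : ContDiffOn ℝ ∞ f J) (hg : ContDiffOn ℝ ∞ g J) :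
    ContDiffOn ℝ ∞ (fun t => ![f t, g t]) J := by
  rw [contDiffOn_pi]
  intro i
  fin_cases i
  · exact hf
  · exact hg

theorem IsRiccati.hasDerivAt_b (h : IsRiccati r c J a μ) {t : ℝ} (ht : t ∈ J) :
    HasDerivAt (fun t => (a t + Complex.I * μ t : ℂ))
      (Complex.I * (r * μ t : ℝ) * (a t + Complex.I * μ t) - c -
        (a t + Complex.I * μ t) ^ 2) t := by
  refine ((h.deriv_fst t ht).ofReal_comp.add
    ((h.deriv_snd t ht).ofReal_comp.const_mul Complex.I)).congr_deriv ?_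
  push_cast
  linear_combination (r * μ t ^ 2 - μ t ^ 2 : ℂ) * (-Complex.I_sq)

/-- The coordinate with the logarithmic derivative `b = a + i μ`. -/
theorem IsRiccati.hasDerivAt_p (h : IsRiccati r c J a μ) {A θ : ℝ → ℝ} {t : ℝ} (ht : t ∈ J)
    (hA : HasDerivAt A (a t) t) (hθ : HasDerivAt θ (μ t) t) :
    HasDerivAt (fun t => (a t + Complex.I * μ t : ℂ) * polar A θ t)
      (Complex.I * (r * μ t : ℝ) * ((a t + Complex.I * μ t) * polar A θ t) -
        c * polar A θ t) t := by
  refine ((h.hasDerivAt_b ht).mul (hasDerivAt_polar hA hθ)).congr_deriv ?_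
  ring

/-- The companion of the coordinate with the logarithmic derivative `b`: together they form a
Legendre curve of curvature `r μ`. -/
theorem IsRiccati.hasDerivAt_q (h : IsRiccati r c J a μ) {A θ : ℝ → ℝ} {t : ℝ} (ht : t ∈ J)
    (hA : HasDerivAt A (a t) t) (hθ : HasDerivAt θ (μ t) t) :
    HasDerivAt (fun t => (a t - Complex.I * μ t : ℂ) * polar A (fun t => (r - 1) * θ t) t)
      (-c * polar A (fun t => (r - 1) * θ t) t) t := by
  have h1 : HasDerivAt (fun t => (a t - Complex.I * μ t : ℂ))
      ((-a t ^ 2 - (r - 1) * μ t ^ 2 - c : ℝ) - Complex.I * ((r - 2) * a t * μ t : ℝ)) t :=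
    (h.deriv_fst t ht).ofReal_comp.sub ((h.deriv_snd t ht).ofReal_comp.const_mul Complex.I)
  refine (h1.mul (hasDerivAt_polar hA (hθ.const_mul (r - 1)))).congr_deriv ?_
  push_cast
  linear_combination (-(r - 1) * μ t ^ 2 * polar A (fun t => (r - 1) * θ t) t : ℂ) * Complex.I_sq

theorem IsRiccati.exists_angle (h : IsRiccati r c J a μ) :
    ∃ θ : ℝ → ℝ, ContDiffOn ℝ ∞ θ J ∧ ∀ t ∈ J, HasDerivAt θ (μ t) t :=
  exists_antideriv h.isOpen h.ordConnected h.nonempty h.smooth.2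

/-- The curve `((a - i μ) exp (A + i (r - 1) θ), exp (A + i θ))` with `A' = a` and `θ' = μ`. -/
theorem IsRiccati.exists_isLegendreCurve_sphere (h : IsRiccati r c J a μ) (hc : c = 1 ∨ c = -1)
    {A : ℝ → ℝ} (hAs : ContDiffOn ℝ ∞ A J) (hA : ∀ t ∈ J, HasDerivAt A (a t) t)
    (hE : ∀ t ∈ J, Real.exp (2 * A t) * (μ t ^ 2 + a t ^ 2 + c) = 1) :
    ∃ z, IsLegendreCurve c J μ (fun t => r * μ t) (coord 1) z := by
  obtain ⟨θ, hθs, hθ⟩ := h.exists_angle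
  have hcc := mul_self_of_sign hc
  have has := contDiffOn_ofReal h.smooth.1
  have hμs := contDiffOn_ofReal h.smooth.2
  have hr : ∀ t ∈ J, HasDerivAt (fun t => (r - 1) * θ t) ((r - 1) * μ t) t :=
    fun t ht => (hθ t ht).const_mul _
  have hEt : ∀ t ∈ J, ((Real.exp (2 * A t) : ℝ) : ℂ) * ((μ t : ℂ) ^ 2 + (a t : ℂ) ^ 2 + c) = 1 :=
    fun t ht => by exact_mod_cast hE t ht
  refine ⟨_, isLegendreCurve_of_hasDerivAt (a := a) h.isOpen (contDiffOn_vec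
      ((has.sub (contDiffOn_const.mul hμs)).mul
        (contDiffOn_polar hAs (contDiffOn_const.mul hθs)))
      (contDiffOn_polar hAs hθs))
    (fun t ht => hasDerivAt_vec (h.hasDerivAt_q ht (hA t ht) (hθ t ht))
      (hasDerivAt_polar (hA t ht) (hθ t ht)))
    (fun t ht => hasDerivAt_vec ((hasDerivAt_polar (hA t ht) (hr t ht)).const_mul (-c : ℂ))
      (h.hasDerivAt_p ht (hA t ht) (hθ t ht)))
    (fun t ht => ?_) (fun t ht => ?_) (fun t ht => ?_) (fun t ht => ?_)
    (fun t ht => polar_ne_zero _ _ _) (fun t ht => rfl)⟩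
  all_goals
    have hP := polar_mul_conj A θ t
    have hQ := polar_mul_conj A (fun t => (r - 1) * θ t) t
    have hEt := hEt t ht
    have hI := Complex.I_sq
    set P := polar A θ t
    set Q := polar A (fun t => (r - 1) * θ t) t
    set R : ℂ := ((Real.exp (2 * A t) : ℝ) : ℂ)
  · simp only [herm_two, Matrix.cons_val_zero, Matrix.cons_val_one, map_mul, map_sub,
      Complex.conj_ofReal, Complex.conj_I]
    linear_combination c * (a t - Complex.I * μ t) * (a t + Complex.I * μ t) * hQ + hP -
      c * R * μ t ^ 2 * hI + c * hEt - R * hcc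
  · simp only [herm_two, Matrix.cons_val_zero, Matrix.cons_val_one, map_mul, map_sub,
      Complex.conj_ofReal, Complex.conj_I]
    linear_combination -c * c * (a t + Complex.I * μ t) * hQ + (a t + Complex.I * μ t) * hP -
      (a t + Complex.I * μ t) * R * hcc
  · simp only [herm_two, Matrix.cons_val_zero, Matrix.cons_val_one, map_mul, map_add, map_neg,
      Complex.conj_ofReal, Complex.conj_I]
    linear_combination c * c * c * hQ +
      (a t + Complex.I * μ t) * (a t - Complex.I * μ t) * hP + hEt - R * μ t ^ 2 * hI +
      c * R * hcc
  · funext i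
    fin_cases i
    · simp
      ring
    · simp

/-- The curve `(exp (A + i θ), (a - i μ) exp (A + i (r - 1) θ))` with `A' = a` and `θ' = μ`. -/
theorem IsRiccati.exists_isLegendreCurve_hyperboloid (h : IsRiccati r (-1) J a μ)
    {A : ℝ → ℝ} (hAs : ContDiffOn ℝ ∞ A J) (hA : ∀ t ∈ J, HasDerivAt A (a t) t)
    (hE : ∀ t ∈ J, Real.exp (2 * A t) * (μ t ^ 2 + a t ^ 2 + -1) = -1) :
    ∃ z, IsLegendreCurve (-1) J μ (fun t => r * μ t) (coord 0) z := by
  obtain ⟨θ, hθs, hθ⟩ := h.exists_angle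
  have has := contDiffOn_ofReal h.smooth.1
  have hμs := contDiffOn_ofReal h.smooth.2
  have hr : ∀ t ∈ J, HasDerivAt (fun t => (r - 1) * θ t) ((r - 1) * μ t) t :=
    fun t ht => (hθ t ht).const_mul _
  have hEt : ∀ t ∈ J, ((Real.exp (2 * A t) : ℝ) : ℂ) * ((μ t : ℂ) ^ 2 + (a t : ℂ) ^ 2 + -1) = -1 :=
    fun t ht => by exact_mod_cast hE t ht
  refine ⟨_, isLegendreCurve_of_hasDerivAt (a := a) h.isOpen (contDiffOn_vec
      (contDiffOn_polar hAs hθs)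
      ((has.sub (contDiffOn_const.mul hμs)).mul
        (contDiffOn_polar hAs (contDiffOn_const.mul hθs))))
    (fun t ht => hasDerivAt_vec (hasDerivAt_polar (hA t ht) (hθ t ht))
      (h.hasDerivAt_q ht (hA t ht) (hθ t ht)))
    (fun t ht => hasDerivAt_vec (h.hasDerivAt_p ht (hA t ht) (hθ t ht))
      ((hasDerivAt_polar (hA t ht) (hr t ht)).const_mul (-(-1 : ℝ) : ℂ)))
    (fun t ht => ?_) (fun t ht => ?_) (fun t ht => ?_) (fun t ht => ?_)
    (fun t ht => polar_ne_zero _ _ _) (fun t ht => rfl)⟩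
  all_goals
    have hP := polar_mul_conj A θ t
    have hQ := polar_mul_conj A (fun t => (r - 1) * θ t) t
    have hEt := hEt t ht
    have hI := Complex.I_sq
    set P := polar A θ t
    set Q := polar A (fun t => (r - 1) * θ t) t
    set R : ℂ := ((Real.exp (2 * A t) : ℝ) : ℂ)
  · simp only [herm_two, Matrix.cons_val_zero, Matrix.cons_val_one, map_mul, map_sub,
      Complex.conj_ofReal, Complex.conj_I, Complex.ofReal_neg, Complex.ofReal_one]
    linear_combination (a t - Complex.I * μ t) * (a t + Complex.I * μ t) * hQ - hP -
      R * μ t ^ 2 * hI + hEt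
  · simp only [herm_two, Matrix.cons_val_zero, Matrix.cons_val_one, map_mul, map_sub,
      Complex.conj_ofReal, Complex.conj_I, Complex.ofReal_neg, Complex.ofReal_one]
    linear_combination (a t + Complex.I * μ t) * hQ - (a t + Complex.I * μ t) * hP
  · simp only [herm_two, Matrix.cons_val_zero, Matrix.cons_val_one, map_mul, map_add, map_neg,
      map_one, Complex.conj_ofReal, Complex.conj_I, Complex.ofReal_neg, Complex.ofReal_one]
    linear_combination hQ - (a t + Complex.I * μ t) * (a t - Complex.I * μ t) * hP - hEt +
      R * μ t ^ 2 * hI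
  · funext i
    fin_cases i
    · simp
    · simp
      ring

/-- When `a² + μ² = 1` the rotating coordinate is the null coordinate `ζ = z₁ - z₂`; the
complementary one `z₁ + z₂` is `ζ (|ζ|⁻² + i σ)` with a second quadrature `σ`. -/
theorem IsRiccati.exists_isLegendreCurve_horosphere (h : IsRiccati r (-1) J a μ)
    {A : ℝ → ℝ} (hAs : ContDiffOn ℝ ∞ A J) (hA : ∀ t ∈ J, HasDerivAt A (a t) t)
    (hE : ∀ t ∈ J, μ t ^ 2 + a t ^ 2 + -1 = 0) :
    ∃ z, IsLegendreCurve (-1) J μ (fun t => r * μ t) (coord 0 - coord 1) z := by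
  obtain ⟨θ, hθs, hθ⟩ := h.exists_angle
  have hSs : ContDiffOn ℝ ∞ (fun t => Real.exp (-2 * A t)) J :=
    (contDiffOn_const.mul hAs).exp
  obtain ⟨σ, hσs, hσ⟩ := exists_antideriv h.isOpen h.ordConnected h.nonempty
    (f := fun t => -2 * μ t * Real.exp (-2 * A t)) ((contDiffOn_const.mul h.smooth.2).mul hSs)
  have has := contDiffOn_ofReal h.smooth.1
  have hμs := contDiffOn_ofReal h.smooth.2
  let b : ℝ → ℂ := fun t => a t + Complex.I * μ t
  let S : ℝ → ℂ := fun t => (Real.exp (-2 * A t) : ℝ)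
  let s : ℝ → ℂ := fun t => S t + Complex.I * σ t
  have hS : ∀ t ∈ J, HasDerivAt S (-2 * a t * S t) t := fun t ht => by
    refine (((hA t ht).const_mul (-2)).exp.ofReal_comp).congr_deriv ?_
    simp only [S]; push_cast; ring
  have hs : ∀ t ∈ J, HasDerivAt s (-2 * b t * S t) t := fun t ht => by
    refine ((hS t ht).add ((hσ t ht).ofReal_comp.const_mul Complex.I)).congr_deriv ?_
    simp only [b, S]; push_cast; ring
  have hss : ContDiffOn ℝ ∞ s J :=
    (contDiffOn_ofReal hSs).add (contDiffOn_const.mul (contDiffOn_ofReal hσs))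
  have hP1 : ∀ t ∈ J, HasDerivAt (polar A θ) (b t * polar A θ t) t :=
    fun t ht => hasDerivAt_polar (hA t ht) (hθ t ht)
  have hP2 : ∀ t ∈ J, HasDerivAt (fun t => b t * polar A θ t)
      (Complex.I * (r * μ t : ℝ) * (b t * polar A θ t) + polar A θ t) t := fun t ht => by
    refine (h.hasDerivAt_p ht (hA t ht) (hθ t ht)).congr_deriv ?_
    simp only [b]; push_cast; ring
  have hbb : ∀ t ∈ J, b t * b t - 2 * a t * b t = -1 := fun t ht => by
    have h1 : (μ t : ℂ) ^ 2 + (a t : ℂ) ^ 2 + -1 = 0 := by exact_mod_cast hE t ht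
    simp only [b]
    linear_combination (μ t : ℂ) ^ 2 * Complex.I_sq - h1
  have hη1 : ∀ t ∈ J, HasDerivAt (fun t => polar A θ t * s t)
      (b t * polar A θ t * (s t - 2 * S t)) t := fun t ht => by
    refine ((hP1 t ht).mul (hs t ht)).congr_deriv ?_
    ring
  have hη2 : ∀ t ∈ J, HasDerivAt (fun t => b t * polar A θ t * (s t - 2 * S t))
      (Complex.I * (r * μ t : ℝ) * (b t * polar A θ t * (s t - 2 * S t)) +
        polar A θ t * s t) t := fun t ht => by
    have hu : HasDerivAt (fun t => s t - 2 * S t) (-2 * b t * S t - 2 * (-2 * a t * S t)) t :=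
      (hs t ht).sub ((hS t ht).const_mul 2)
    refine ((hP2 t ht).mul hu).congr_deriv ?_
    linear_combination (-2 * polar A θ t * S t) * hbb t ht
  have hRS : ∀ t, polar A θ t * conj (polar A θ t) * S t = 1 := fun t => by
    rw [polar_mul_conj]
    simp only [S]
    rw [← Complex.ofReal_mul, ← Real.exp_add]
    simp
  have hsS : ∀ t, s t + conj (s t) = 2 * S t := fun t => by
    simp only [s, S, map_add, map_mul, Complex.conj_ofReal, Complex.conj_I]; ring
  have hSS : ∀ t, conj (S t) = S t := fun t => Complex.conj_ofReal _
  have hbc : ∀ t ∈ J, b t * conj (b t) = 1 := fun t ht => by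
    have h1 : (μ t : ℂ) ^ 2 + (a t : ℂ) ^ 2 + -1 = 0 := by exact_mod_cast hE t ht
    simp only [b, map_add, map_mul, Complex.conj_ofReal, Complex.conj_I]
    linear_combination h1 - (μ t : ℂ) ^ 2 * Complex.I_sq
  have hherm : ∀ v v' w w' : ℂ, herm (-1) ![(v + v') / 2, (v' - v) / 2]
      ![(w + w') / 2, (w' - w) / 2] = -(v * conj w' + v' * conj w) / 2 := by
    intro v v' w w'
    simp only [herm_two, Matrix.cons_val_zero, Matrix.cons_val_one, map_div₀, map_add, map_sub,
      Complex.ofReal_neg, Complex.ofReal_one, map_ofNat]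
    ring
  have hPs := contDiffOn_polar hAs hθs
  refine ⟨_, isLegendreCurve_of_hasDerivAt (a := a) h.isOpen (contDiffOn_vec
      ((hPs.add (hPs.mul hss)).div_const 2) (((hPs.mul hss).sub hPs).div_const 2))
    (fun t ht => hasDerivAt_vec (((hP1 t ht).add (hη1 t ht)).div_const 2)
      (((hη1 t ht).sub (hP1 t ht)).div_const 2))
    (fun t ht => hasDerivAt_vec (((hP2 t ht).add (hη2 t ht)).div_const 2)
      (((hη2 t ht).sub (hP2 t ht)).div_const 2))
    (fun t ht => ?_) (fun t ht => ?_) (fun t ht => ?_) (fun t ht => ?_)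
    (fun t ht => ?_) (fun t ht => ?_)⟩
  · refine (hherm _ _ _ _).trans ?_
    simp only [map_mul, Complex.ofReal_neg, Complex.ofReal_one]
    linear_combination (-1 : ℂ) * hRS t -
      polar A θ t * conj (polar A θ t) / 2 * hsS t
  · refine (hherm _ _ _ _).trans ?_
    simp only [map_mul]
    linear_combination (-polar A θ t * conj (polar A θ t) * b t / 2) * hsS t
  · refine (hherm _ _ _ _).trans ?_
    simp only [map_mul, map_sub, hSS, map_ofNat]
    linear_combination (-polar A θ t * conj (polar A θ t) * b t * conj (b t) / 2) * hsS t +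
      b t * conj (b t) * hRS t + hbc t ht
  · funext i
    fin_cases i
    · simp
      ring
    · simp
      ring
  · simp only [coord, sub_apply, ContinuousLinearMap.proj_apply,
      Matrix.cons_val_zero, Matrix.cons_val_one]
    exact fun h0 => polar_ne_zero A θ t (by linear_combination h0)
  · simp only [coord, sub_apply, ContinuousLinearMap.proj_apply,
      Matrix.cons_val_zero, Matrix.cons_val_one, b]
    ring

end LegendreCurves

/-! ### Curves in the surface and their horizontal lifts -/

section Lifts

variable {c : ℝ} {J : Set ℝ} {μ φ : ℝ → ℝ} {z w : ℝ → Fin 2 → ℂ} {ℓ : (Fin 2 → ℂ) →L[ℂ] ℂ}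

/-- The polarization of the quadratic map `hopf3 c`, multiplied by two. -/
def hopf3Bil (c : ℝ) (v w : Fin 2 → ℂ) : Fin 3 → ℝ :=
  ![(v 0 * conj (w 1) + w 0 * conj (v 1)).re, (v 0 * conj (w 1) + w 0 * conj (v 1)).im,
    (v 0 * conj (w 0) - c * (v 1 * conj (w 1))).re]

theorem hopf3_eq (c : ℝ) (v : Fin 2 → ℂ) : hopf3 c v = (2 : ℝ)⁻¹ • hopf3Bil c v v := by
  funext i
  fin_cases i
  · simp [hopf3, hopf3Bil]; ring
  · simp [hopf3, hopf3Bil]; ring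
  · simp [hopf3, hopf3Bil, ← Complex.normSq_eq_norm_sq, Complex.normSq_apply]; ring

theorem hopf3Bil_comm (c : ℝ) (v w : Fin 2 → ℂ) : hopf3Bil c v w = hopf3Bil c w v := by
  funext i
  fin_cases i
  · simp [hopf3Bil]; ring
  · simp [hopf3Bil]; ring
  · simp [hopf3Bil]; ring

/-- A vector which is `herm`-orthogonal to a point of the quadric in `ℂ²` is a multiple of
`(-c z̄₂, z̄₁)`. -/
theorem exists_eq_smul_normal (hc : c = 1 ∨ c = -1) {z v : Fin 2 → ℂ} (hz : herm c z z = c)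
    (hv : herm c v z = 0) :
    ∃ u : ℂ, v = ![-c * u * conj (z 1), u * conj (z 0)] ∧ herm c v v = u * conj u := by
  have hcc := mul_self_of_sign hc
  rw [herm_two] at hz hv
  have h0 : v 0 = -c * (z 0 * v 1 - z 1 * v 0) * conj (z 1) := by
    linear_combination c * z 0 * hv - c * v 0 * hz - (v 0) * hcc
  have h1 : v 1 = (z 0 * v 1 - z 1 * v 0) * conj (z 0) := by
    linear_combination c * z 1 * hv - c * v 1 * hz -
      (z 1 * v 0 * conj (z 0) - v 1 * z 0 * conj (z 0) + v 1) * hcc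
  generalize z 0 * v 1 - z 1 * v 0 = u at h0 h1
  refine ⟨u, ?_, ?_⟩
  · funext i
    fin_cases i
    · exact h0
    · exact h1
  · rw [herm_two, h0, h1]
    simp only [map_mul, map_neg, Complex.conj_ofReal, Complex.conj_conj]
    linear_combination u * conj u * (c * z 1 * conj (z 1) - z 0 * conj (z 0) + 1) * hcc +
      c * u * conj u * hz

theorem norm_sq_add (hc : c = 1 ∨ c = -1) {z : Fin 2 → ℂ} (hz : herm c z z = c) :
    (z 0).re ^ 2 + (z 0).im ^ 2 + c * ((z 1).re ^ 2 + (z 1).im ^ 2) = 1 := by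
  have h := congrArg Complex.re hz
  rw [herm_two] at h
  simp at h
  rcases hc with rfl | rfl <;> linarith

/-- The image under the differential of `hopf3 c` of the horizontal vector `u (-c z̄₂, z̄₁)`. -/
def horizontalImage (c : ℝ) (z : Fin 2 → ℂ) (u : ℂ) : Fin 3 → ℝ :=
  hopf3Bil c z ![-c * u * conj (z 1), u * conj (z 0)]

theorem ip3_horizontalImage (hc : c = 1 ∨ c = -1) {z : Fin 2 → ℂ} (hz : herm c z z = c)
    (u v : ℂ) :
    ip3 c (horizontalImage c z u) (horizontalImage c z v) = u.re * v.re + u.im * v.im := by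
  have h : ip3 c (horizontalImage c z u) (horizontalImage c z v) = (u.re * v.re + u.im * v.im) *
      ((z 0).re ^ 2 + (z 0).im ^ 2 + c * ((z 1).re ^ 2 + (z 1).im ^ 2)) ^ 2 := by
    rcases hc with rfl | rfl <;> simp [ip3, horizontalImage, hopf3Bil] <;> ring
  rw [h, norm_sq_add hc hz]; ring

theorem ip3_horizontalImage_hopf3 (hc : c = 1 ∨ c = -1) (z : Fin 2 → ℂ) (u : ℂ) :
    ip3 c (horizontalImage c z u) (hopf3 c z) = 0 := by
  rw [hopf3_eq]
  rcases hc with rfl | rfl <;> simp [ip3, horizontalImage, hopf3Bil] <;> ring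

/-- With the orientation given by the sign of this determinant, the unit normal of the image of a
horizontal vector is the image of its product with `i`. -/
theorem det_horizontalImage (hc : c = 1 ∨ c = -1) {z : Fin 2 → ℂ} (hz : herm c z z = c) (u : ℂ) :
    Matrix.det (Matrix.of ![hopf3 c z, horizontalImage c z u,
      horizontalImage c z (Complex.I * u)]) = -(u.re ^ 2 + u.im ^ 2) / 2 := by
  have h : Matrix.det (Matrix.of ![hopf3 c z, horizontalImage c z u,
      horizontalImage c z (Complex.I * u)]) = -(u.re ^ 2 + u.im ^ 2) / 2 *
      ((z 0).re ^ 2 + (z 0).im ^ 2 + c * ((z 1).re ^ 2 + (z 1).im ^ 2)) ^ 3 := by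
    rw [hopf3_eq, Matrix.det_fin_three]
    rcases hc with rfl | rfl <;> simp [horizontalImage, hopf3Bil] <;> ring
  rw [h, norm_sq_add hc hz]; ring

theorem hopf3_mem_surface (hc : c = 1 ∨ c = -1) {z : Fin 2 → ℂ} (hz : herm c z z = c) :
    hopf3 c z ∈ Surface c := by
  have h1 := norm_sq_add hc hz
  have h : ip3 c (hopf3 c z) (hopf3 c z) = c / 4 *
      ((z 0).re ^ 2 + (z 0).im ^ 2 + c * ((z 1).re ^ 2 + (z 1).im ^ 2)) ^ 2 := by
    rw [hopf3_eq]
    rcases hc with rfl | rfl <;> simp [ip3, hopf3Bil] <;> ring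
  refine ⟨by rw [h, h1]; ring, ?_⟩
  rintro rfl
  rw [hopf3_eq]
  simp [hopf3Bil]
  nlinarith [sq_nonneg (z 1).re, sq_nonneg (z 1).im]

/-- On unit vectors `herm`-orthogonal to `z`, such as the velocity of a Legendre curve, `hopf3 c`
is `-c` times its value at `z`: on the sphere their image is the antipode. -/
theorem hopf3_normal (hc : c = 1 ∨ c = -1) (z : Fin 2 → ℂ) {u : ℂ} (hu : u * conj u = 1) :
    hopf3 c ![-c * u * conj (z 1), u * conj (z 0)] = (-c) • hopf3 c z := by
  have h1 : u.re * u.re + u.im * u.im = 1 := by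
    have := congrArg Complex.re hu
    simpa using this
  have h : hopf3 c ![-c * u * conj (z 1), u * conj (z 0)] =
      ((u.re * u.re + u.im * u.im) * -c) • hopf3 c z := by
    rw [hopf3_eq, hopf3_eq]
    funext i
    rcases hc with rfl | rfl <;> fin_cases i <;> simp [hopf3Bil] <;> ring
  rw [h, h1, one_mul]

theorem hasDerivAt_hopf3Bil {v w : ℝ → Fin 2 → ℂ} {v' w' : Fin 2 → ℂ} {t : ℝ}
    (hv : HasDerivAt v v' t) (hw : HasDerivAt w w' t) :
    HasDerivAt (fun t => hopf3Bil c (v t) (w t)) (hopf3Bil c v' (w t) + hopf3Bil c (v t) w') t := by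
  have hv := hasDerivAt_pi.1 hv
  have hw := hasDerivAt_pi.1 hw
  have h1 := ((hv 0).mul (hw 1).star).add ((hw 0).mul (hv 1).star)
  have h2 := ((hv 0).mul (hw 0).star).sub (((hv 1).mul (hw 1).star).const_mul (c : ℂ))
  rw [hasDerivAt_pi]
  intro i
  fin_cases i
  · refine (Complex.reCLM.hasFDerivAt.comp_hasDerivAt t h1).congr_deriv ?_
    simp [hopf3Bil]
    ring
  · refine (Complex.imCLM.hasFDerivAt.comp_hasDerivAt t h1).congr_deriv ?_
    simp [hopf3Bil]
    ring
  · refine (Complex.reCLM.hasFDerivAt.comp_hasDerivAt t h2).congr_deriv ?_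
    simp [hopf3Bil]
    ring

theorem contDiff_hopf3 : ContDiff ℝ ∞ (hopf3 c) := by
  have h (i : Fin 2) : ContDiff ℝ ∞ fun z : Fin 2 → ℂ => z i := contDiff_apply ℝ ℂ i
  have h' (i : Fin 2) : ContDiff ℝ ∞ fun z : Fin 2 → ℂ => conj (z i) :=
    Complex.conjCLE.contDiff.comp (h i)
  rw [show hopf3 c = fun z => (2 : ℝ)⁻¹ • hopf3Bil c z z from funext (hopf3_eq c)]
  refine ContDiff.const_smul _ (contDiff_pi.2 fun i => ?_)
  have h0 := ((h 0).mul (h' 1)).add ((h 0).mul (h' 1))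
  fin_cases i
  · exact Complex.reCLM.contDiff.comp h0
  · exact Complex.imCLM.contDiff.comp h0
  · exact Complex.reCLM.contDiff.comp
      (((h 0).mul (h' 0)).sub (contDiff_const.mul ((h 1).mul (h' 1))))

/-- The image under the differential of `hopf3 c` at `v` of the second derivative prescribed by the
equation of a Legendre curve. -/
theorem hopf3Bil_ode (c φ : ℝ) (v w : Fin 2 → ℂ) :
    hopf3Bil c v ((Complex.I * φ) • w - (c : ℂ) • v) =
      φ • hopf3Bil c v (Complex.I • w) - (2 * c) • hopf3 c v := by
  rw [hopf3_eq]
  funext i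
  fin_cases i <;> simp [hopf3Bil] <;> ring

/-- The projection of a Legendre curve of curvature `φ` is a unit speed curve of curvature `φ`; its
unit normal is the image of `i z'`. -/
theorem IsLegendreCurve.isUnitSpeedCurve (h : IsLegendreCurve c J μ φ ℓ z)
    (hc : c = 1 ∨ c = -1) : IsUnitSpeedCurve c J (fun t => hopf3 c (z t)) φ := by
  have hz : ∀ t ∈ J, HasDerivAt z (deriv z t) t := fun t ht =>
    hasDerivAt_of_smooth h.isOpen h.smooth ht
  have hz' : ∀ t ∈ J, HasDerivAt (deriv z) (deriv (deriv z) t) t := fun t ht =>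
    hasDerivAt_of_smooth h.isOpen (contDiffOn_deriv_of_smooth h.isOpen h.smooth) ht
  have h1 : ∀ t ∈ J, deriv (fun t => hopf3 c (z t)) t = hopf3Bil c (z t) (deriv z t) := by
    intro t ht
    simp only [hopf3_eq]
    refine (((hasDerivAt_hopf3Bil (c := c) (hz t ht) (hz t ht)).fun_const_smul
      (2 : ℝ)⁻¹).congr_deriv ?_).deriv
    rw [hopf3Bil_comm c (deriv z t), ← two_smul ℝ, smul_smul]
    simp
  have h2 : ∀ t ∈ J, deriv (deriv fun t => hopf3 c (z t)) t =
      hopf3Bil c (deriv z t) (deriv z t) + hopf3Bil c (z t) (deriv (deriv z) t) := by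
    intro t ht
    rw [← (hasDerivAt_hopf3Bil (c := c) (hz t ht) (hz' t ht)).deriv]
    refine Filter.EventuallyEq.deriv_eq ?_
    filter_upwards [h.isOpen.mem_nhds ht] with s hs using h1 s hs
  refine ⟨contDiff_hopf3.comp_contDiffOn h.smooth, fun t ht => hopf3_mem_surface hc (h.mem t ht),
    fun t ht => ?_, fun t ht => ?_⟩
  all_goals
    obtain ⟨u, hu, huu⟩ := exists_eq_smul_normal hc (h.mem t ht) (h.legendre t ht)
    rw [h.unitSpeed t ht] at huu
    have hu1 : u.re * u.re + u.im * u.im = 1 := by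
      have := congrArg Complex.re huu
      simpa using this.symm
    have h3 : hopf3Bil c (z t) (deriv z t) = horizontalImage c (z t) u := by
      rw [horizontalImage, ← hu]
  · rw [h1 t ht, h3, ip3_horizontalImage hc (h.mem t ht), hu1]
  · refine ⟨horizontalImage c (z t) (Complex.I * u), ?_, ?_, ?_, ?_, -4 * c, ?_⟩
    · rw [ip3_horizontalImage hc (h.mem t ht)]
      simp
      linarith
    · exact ip3_horizontalImage_hopf3 hc _ _
    · rw [h1 t ht, h3, ip3_horizontalImage hc (h.mem t ht)]
      simp
      ring
    · rw [h1 t ht, h3, det_horizontalImage hc (h.mem t ht)]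
      nlinarith
    · have h4 : hopf3Bil c (deriv z t) (deriv z t) = (-2 * c) • hopf3 c (z t) := by
        have h5 := hopf3_normal hc (z t) huu.symm
        rw [← hu, hopf3_eq, inv_smul_eq_iff₀ two_ne_zero] at h5
        rw [h5, smul_smul]
        congr 1
        ring
      have h6 : hopf3Bil c (z t) (Complex.I • deriv z t) =
          horizontalImage c (z t) (Complex.I * u) := by
        rw [horizontalImage, hu]
        congr 1
        funext i
        fin_cases i <;> simp <;> ring
      rw [h2 t ht, h4, h.ode t ht, hopf3Bil_ode, h6]
      module

/-- A Legendre curve is a horizontal lift of its image. -/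
theorem IsLegendreCurve.isHorizontalLift (h : IsLegendreCurve c J μ φ ℓ z) :
    IsHorizontalLift c J (fun t => hopf3 c (z t)) z where
  smooth := h.smooth
  mem t ht := by simp [Quadric, ip, h.mem t ht]
  lift _ _ := rfl
  horizontal t ht := by rw [ip, herm_smul_right, h.legendre t ht, mul_zero, Complex.zero_re]

theorem hasDerivAt_herm {v w : ℝ → Fin 2 → ℂ} {v' w' : Fin 2 → ℂ} {t : ℝ}
    (hv : HasDerivAt v v' t) (hw : HasDerivAt w w' t) :
    HasDerivAt (fun t => herm c (v t) (w t)) (herm c v' (w t) + herm c (v t) w') t := by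
  have hv := hasDerivAt_pi.1 hv
  have hw := hasDerivAt_pi.1 hw
  simp only [herm_two]
  refine ((((hv 0).const_mul (c : ℂ)).mul (hw 0).star).add
    ((hv 1).mul (hw 1).star)).congr_deriv ?_
  simp
  ring

/-- The derivative of a horizontal lift is orthogonal to it for the Hermitian form. -/
theorem IsHorizontalLift.herm_deriv {γ : ℝ → Fin 3 → ℝ} (hJ : IsOpen J)
    (h : IsHorizontalLift c J γ w) {t : ℝ} (ht : t ∈ J) : herm c (deriv w t) (w t) = 0 := by
  have hw := hasDerivAt_of_smooth hJ h.smooth ht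
  have h1 : herm c (deriv w t) (w t) + herm c (w t) (deriv w t) = 0 := by
    rw [← (hasDerivAt_herm hw hw).deriv, ← deriv_const t (c : ℂ)]
    refine Filter.EventuallyEq.deriv_eq ?_
    filter_upwards [hJ.mem_nhds ht] with s hs using herm_self (h.mem s hs)
  rw [← herm_conj (deriv w t)] at h1
  have h2 := h.horizontal t ht
  rw [ip, herm_smul_right] at h2
  have h3 := congrArg Complex.re h1
  simp at h2 h3
  refine Complex.ext ?_ ?_
  · simp; linarith
  · simp; linarith

/-- Two points of the quadric with the same image in the surface differ by a phase. -/
theorem eq_smul_of_hopf3_eq (hc : c = 1 ∨ c = -1) {v w : Fin 2 → ℂ} (hv : herm c v v = c)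
    (hw : herm c w w = c) (h : hopf3 c w = hopf3 c v) : w = (c * herm c w v) • v := by
  have hcc := mul_self_of_sign hc
  have h0 : w 0 * conj (w 1) = v 0 * conj (v 1) :=
    Complex.ext (congrFun h 0) (congrFun h 1)
  have h2 : w 0 * conj (w 0) - c * (w 1 * conj (w 1)) =
      v 0 * conj (v 0) - c * (v 1 * conj (v 1)) := by
    have := congrFun h 2
    simp only [hopf3, Matrix.cons_val] at this
    simp only [Complex.mul_conj, Complex.normSq_eq_norm_sq]
    exact_mod_cast by linarith
  rw [herm_two] at hv hw ⊢
  have h3 : w 1 * conj (w 0) = v 1 * conj (v 0) := by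
    have := congrArg conj h0
    simp only [map_mul, Complex.conj_conj] at this
    linear_combination this
  have h4 : w 0 * conj (w 0) = v 0 * conj (v 0) := by
    linear_combination h2 / 2 + c / 2 * (hw - hv) - (w 0 * conj (w 0) - v 0 * conj (v 0)) / 2 * hcc
  have h5 : w 1 * conj (w 1) = v 1 * conj (v 1) := by
    linear_combination hw - hv - c * h4
  funext i
  fin_cases i
  · change w 0 = c * (c * w 0 * conj (v 0) + w 1 * conj (v 1)) * v 0
    linear_combination c * w 1 * h0 + c * c * w 0 * h4 - c * w 0 * hw - w 0 * hcc
  · change w 1 = c * (c * w 0 * conj (v 0) + w 1 * conj (v 1)) * v 1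
    linear_combination c * c * w 0 * h3 + c * w 1 * h5 - c * w 1 * hw - w 1 * hcc

/-- The horizontal lifts of the image of a Legendre curve differ from it by a constant phase. -/
theorem IsHorizontalLift.exists_phase (h : IsLegendreCurve c J μ φ ℓ z) (hc : c = 1 ∨ c = -1)
    (hJ' : J.OrdConnected) (hne : J.Nonempty)
    (hw : IsHorizontalLift c J (fun t => hopf3 c (z t)) w) :
    ∃ u : ℂ, u * conj u = 1 ∧ ∀ t ∈ J, w t = u • z t := by
  have hcc := mul_self_of_sign hc
  have h1 : ∀ t ∈ J, w t = (c * herm c (w t) (z t)) • z t := fun t ht =>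
    eq_smul_of_hopf3_eq hc (h.mem t ht) (herm_self (hw.mem t ht)) (hw.lift t ht)
  have h2 : ∀ t ∈ J, (c * herm c (w t) (z t)) * conj (c * herm c (w t) (z t)) = 1 := by
    intro t ht
    have h3 := herm_self (hw.mem t ht)
    rw [h1 t ht, herm_smul_left, herm_smul_right, h.mem t ht] at h3
    linear_combination c * h3 - (c * herm c (w t) (z t) * conj (c * herm c (w t) (z t)) - 1) * hcc
  have h3 : ∀ t ∈ J, HasDerivAt (fun t => (c : ℂ) * herm c (w t) (z t)) 0 t := by
    intro t ht
    refine ((hasDerivAt_herm (hasDerivAt_of_smooth h.isOpen hw.smooth ht)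
      (hasDerivAt_of_smooth h.isOpen h.smooth ht)).const_mul (c : ℂ)).congr_deriv ?_
    have h4 : herm c (w t) (deriv z t) = 0 := by
      rw [h1 t ht, herm_smul_left, herm_eq_zero_symm (h.legendre t ht), mul_zero]
    have h5 : conj (c * herm c (w t) (z t)) * herm c (deriv w t) (z t) = 0 := by
      rw [← herm_smul_right, ← h1 t ht, hw.herm_deriv h.isOpen ht]
    have h6 : herm c (deriv w t) (z t) = 0 :=
      (mul_eq_zero.1 h5).resolve_left (right_ne_zero_of_mul_eq_one (h2 t ht))
    rw [h4, h6, add_zero, mul_zero]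
  obtain ⟨u, hu⟩ := eq_of_hasDerivAt_zero h.isOpen hJ' h3
  obtain ⟨t₀, ht₀⟩ := hne
  exact ⟨u, by rw [← hu t₀ ht₀]; exact h2 t₀ ht₀, fun t ht => by rw [← hu t ht]; exact h1 t ht⟩

theorem deriv_eq_of_eqOn (hJ : IsOpen J) {f g : ℝ → Fin 2 → ℂ} (h : ∀ t ∈ J, f t = g t) {t : ℝ}
    (ht : t ∈ J) : deriv f t = deriv g t :=
  Filter.EventuallyEq.deriv_eq (Filter.eventually_of_mem (hJ.mem_nhds ht) h)

/-- The defining properties of a Legendre curve are invariant under multiplication with a phase. -/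
theorem IsLegendreCurve.phase (h : IsLegendreCurve c J μ φ ℓ z) {u : ℂ} (hu : u * conj u = 1)
    (hw : ∀ t ∈ J, w t = u • z t) : IsLegendreCurve c J μ φ ℓ w := by
  have h1 : ∀ t ∈ J, deriv w t = u • deriv z t := fun t ht => by
    rw [deriv_eq_of_eqOn h.isOpen hw ht]
    exact ((hasDerivAt_of_smooth h.isOpen h.smooth ht).fun_const_smul u).deriv
  have h2 : ∀ t ∈ J, deriv (deriv w) t = u • deriv (deriv z) t := fun t ht => by
    rw [deriv_eq_of_eqOn h.isOpen h1 ht]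
    exact ((hasDerivAt_of_smooth h.isOpen
      (contDiffOn_deriv_of_smooth h.isOpen h.smooth) ht).fun_const_smul u).deriv
  refine ⟨h.isOpen, (h.smooth.const_smul u).congr hw, fun t ht => ?_, fun t ht => ?_,
    fun t ht => ?_, fun t ht => ?_, fun t ht => ?_, fun t ht => ?_⟩
  · rw [hw t ht, herm_smul_left, herm_smul_right, h.mem t ht, ← mul_assoc, hu, one_mul]
  · rw [hw t ht, h1 t ht, herm_smul_left, herm_smul_right, h.legendre t ht, mul_zero, mul_zero]
  · rw [h1 t ht, herm_smul_left, herm_smul_right, h.unitSpeed t ht, ← mul_assoc, hu, one_mul]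
  · rw [h1 t ht, h2 t ht, hw t ht, h.ode t ht]
    module
  · rw [hw t ht, map_smul, smul_eq_mul]
    exact mul_ne_zero (left_ne_zero_of_mul_eq_one hu) (h.ne_zero t ht)
  · obtain ⟨a, ha⟩ := h.log_deriv t ht
    refine ⟨a, ?_⟩
    rw [hw t ht, h1 t ht, map_smul, map_smul, smul_eq_mul, smul_eq_mul, ha]
    ring

/-- Each horizontal lift of the image of a Legendre curve is a Legendre curve with the same data. -/
theorem IsLegendreCurve.of_isHorizontalLift (h : IsLegendreCurve c J μ φ ℓ z)
    (hc : c = 1 ∨ c = -1) (hJ' : J.OrdConnected) (hne : J.Nonempty)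
    (hw : IsHorizontalLift c J (fun t => hopf3 c (z t)) w) : IsLegendreCurve c J μ φ ℓ w :=
  let ⟨_, hu, hwu⟩ := hw.exists_phase h hc hJ' hne
  h.phase hu hwu

theorem IsLegendreCurve.isUnitSpeedLegendre (h : IsLegendreCurve c J μ φ ℓ z) :
    IsUnitSpeedLegendre c J z where
  smooth := h.smooth
  mem := h.isHorizontalLift.mem
  unitSpeed t ht := by rw [ip, h.unitSpeed t ht, Complex.one_re]
  legendre := h.isHorizontalLift.horizontal

end Lifts

/-! ### The classification of the curves by the energy -/

section Conclusion

variable {r c : ℝ} {J : Set ℝ} {a μ : ℝ → ℝ}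

/-- Positivity of the energy at one point is enough for the rotation of elliptic type. -/
theorem IsRiccati.exists_isLegendreCurve_of_pos (h : IsRiccati r c J a μ) (hc : c = 1 ∨ c = -1)
    {t₀ : ℝ} (ht₀ : t₀ ∈ J) (h0 : 0 < μ t₀ ^ 2 + a t₀ ^ 2 + c) :
    (∀ t ∈ J, 0 < μ t ^ 2 + a t ^ 2 + c) ∧
      ∃ z, IsLegendreCurve c J μ (fun t => r * μ t) (coord 1) z := by
  obtain ⟨A, hAs, hA, hE⟩ := h.exists_energy_normalized ht₀ h0.ne'
  rw [sign_pos h0] at hE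
  refine ⟨fun t ht => ?_, h.exists_isLegendreCurve_sphere hc hAs hA fun t ht => by simp [hE t ht]⟩
  refine pos_of_mul_pos_right ?_ (Real.exp_pos (2 * A t)).le
  simp [hE t ht]

/-- The three cases of hyperbolic Riccati solutions, with the matching Legendre curves. -/
theorem IsRiccati.trichotomy (h : IsRiccati r (-1) J a μ) :
    ((∀ t ∈ J, 0 < μ t ^ 2 + a t ^ 2 + -1) ∧
      ∃ z, IsLegendreCurve (-1) J μ (fun t => r * μ t) (coord 1) z) ∨
    ((∀ t ∈ J, μ t ^ 2 + a t ^ 2 + -1 < 0) ∧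
      ∃ z, IsLegendreCurve (-1) J μ (fun t => r * μ t) (coord 0) z) ∨
    ((∀ t ∈ J, μ t ^ 2 + a t ^ 2 + -1 = 0) ∧
      ∃ z, IsLegendreCurve (-1) J μ (fun t => r * μ t) (coord 0 - coord 1) z) := by
  obtain ⟨t₀, ht₀⟩ := h.nonempty
  rcases lt_trichotomy (μ t₀ ^ 2 + a t₀ ^ 2 + -1) 0 with h0 | h0 | h0
  · obtain ⟨A, hAs, hA, hE⟩ := h.exists_energy_normalized ht₀ h0.ne
    rw [sign_neg h0] at hE
    refine .inr (.inl ⟨fun t ht => ?_,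
      h.exists_isLegendreCurve_hyperboloid hAs hA fun t ht => by simp [hE t ht]⟩)
    refine neg_of_mul_neg_right ?_ (Real.exp_pos (2 * A t)).le
    simp [hE t ht]
  · obtain ⟨A, k, hAs, hA, hE⟩ := h.exists_energy
    have h1 : ∀ t ∈ J, μ t ^ 2 + a t ^ 2 + -1 = 0 := by
      intro t ht
      have h2 := hE t ht
      rw [← hE t₀ ht₀, h0, mul_zero] at h2
      exact (mul_eq_zero.1 h2).resolve_left (Real.exp_ne_zero _)
    exact .inr (.inr ⟨h1, h.exists_isLegendreCurve_horosphere hAs hA h1⟩)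
  · exact .inl (h.exists_isLegendreCurve_of_pos (.inr rfl) ht₀ h0)

/-- A Legendre curve projects to a curve in the surface all of whose horizontal lifts are Legendre
curves with the same data. -/
theorem IsLegendreCurve.exists_curve {φ : ℝ → ℝ} {ℓ : (Fin 2 → ℂ) →L[ℂ] ℂ} {z : ℝ → Fin 2 → ℂ}
    (h : IsLegendreCurve c J μ φ ℓ z) (hc : c = 1 ∨ c = -1) (hJ' : J.OrdConnected)
    (hne : J.Nonempty) :
    ∃ γ : ℝ → Fin 3 → ℝ, IsUnitSpeedCurve c J γ φ ∧ (∃ z, IsHorizontalLift c J γ z) ∧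
      ∀ z, IsHorizontalLift c J γ z → IsLegendreCurve c J μ φ ℓ z :=
  ⟨_, h.isUnitSpeedCurve hc, ⟨_, h.isHorizontalLift⟩,
    fun _ hw => h.of_isHorizontalLift hc hJ' hne hw⟩

end Conclusion

end SpaceForms

end

theorem mainTheorem5 (m : ℕ) (hm : 1 ≤ m) (r : ℝ) :
    -- existence, in complex dimension `n = m + 1`
    (∀ c : ℝ, c = 1 ∨ c = -1 →
      ∃ (U : Set (EuclideanSpace ℝ (Fin (m + 1))))
        (f : EuclideanSpace ℝ (Fin (m + 1)) → SpaceForms.Mat (m + 1)),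
        IsOpen U ∧ IsConnected U ∧
        SpaceForms.IsHUmbilicalOfRatioOn (modelWithCornersSelf ℝ (EuclideanSpace ℝ (Fin (m + 1))))
          c f U r) ∧
    -- the construction for `r ≠ 2`
    (r ≠ 2 →
      -- the differential equation has nowhere vanishing solutions
      (∀ c : ℝ, c = 1 ∨ c = -1 → ∃ (I : Set ℝ) (μ : ℝ → ℝ), SpaceForms.IsSolution r c I μ) ∧
      -- in `CP^n(4)`
      (∀ (I : Set ℝ) (μ : ℝ → ℝ), SpaceForms.IsSolution r 1 I μ →
        ∃ γ : ℝ → Fin 3 → ℝ,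
          SpaceForms.IsUnitSpeedCurve 1 I γ (fun t => r * μ t) ∧
          (∃ z : ℝ → Fin 2 → ℂ, SpaceForms.IsHorizontalLift 1 I γ z) ∧
          ∀ z : ℝ → Fin 2 → ℂ, SpaceForms.IsHorizontalLift 1 I γ z →
            SpaceForms.IsUnitSpeedLegendre 1 I z ∧
            (∀ t ∈ I, deriv (deriv z) t =
              (Complex.I * ((r * μ t : ℝ) : ℂ)) • deriv z t - z t) ∧
            SpaceForms.YieldsOnSphere m 1 r I μ z) ∧
      -- in `CH^n(-4)`
      (∀ (I : Set ℝ) (μ : ℝ → ℝ), SpaceForms.IsSolution r (-1) I μ →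
        ∃ γ : ℝ → Fin 3 → ℝ,
          SpaceForms.IsUnitSpeedCurve (-1) I γ (fun t => r * μ t) ∧
          (∃ z : ℝ → Fin 2 → ℂ, SpaceForms.IsHorizontalLift (-1) I γ z) ∧
          ∀ z : ℝ → Fin 2 → ℂ, SpaceForms.IsHorizontalLift (-1) I γ z →
            SpaceForms.IsUnitSpeedLegendre (-1) I z ∧
            (∀ t ∈ I, deriv (deriv z) t =
              (Complex.I * ((r * μ t : ℝ) : ℂ)) • deriv z t + z t) ∧
            (((∀ t ∈ I, 0 < SpaceForms.energy r μ t) ∧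
                SpaceForms.YieldsOnSphere m (-1) r I μ z) ∨
              ((∀ t ∈ I, SpaceForms.energy r μ t < 0) ∧
                SpaceForms.YieldsOnHyperboloid m (-1) r I μ z) ∨
              ((∀ t ∈ I, SpaceForms.energy r μ t = 0) ∧
                SpaceForms.YieldsOnHorosphere m (-1) r I μ z)))) := by
  refine ⟨fun c hc => ?_, fun hr => ⟨fun c _ => ?_, fun I μ hμ => ?_, fun I μ hμ => ?_⟩⟩
  -- the initial values `a = 0`, `μ = 2` have positive energy for both signs of `c`
  · obtain ⟨J, a, μ, h, h0, ha, hμ⟩ :=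
      SpaceForms.exists_isRiccati r c 0 (two_ne_zero (α := ℝ))
    obtain ⟨-, z, hz⟩ := h.exists_isLegendreCurve_of_pos hc h0 (by
      rw [ha, hμ]; rcases hc with rfl | rfl <;> norm_num)
    exact SpaceForms.exists_isHUmbilicalOfRatioOn hc hm h.ne_zero
      ⟨h.nonempty, h.ordConnected.isPreconnected⟩ hz
  · obtain ⟨J, a, μ, h, -⟩ := SpaceForms.exists_isRiccati r c 0 (two_ne_zero (α := ℝ))
    exact ⟨J, μ, h.isSolution hr⟩
  · have h := hμ.isRiccati hr
    obtain ⟨t₀, ht₀⟩ := hμ.nonempty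
    obtain ⟨-, z, hz⟩ := h.exists_isLegendreCurve_of_pos (.inl rfl) ht₀ (by positivity)
    obtain ⟨γ, hγ, hl, H⟩ := hz.exists_curve (.inl rfl) hμ.ordConnected hμ.nonempty
    refine ⟨γ, hγ, hl, fun w hw => ⟨(H w hw).isUnitSpeedLegendre, fun t ht => ?_,
      SpaceForms.yieldsOnSphere (.inl rfl) hm hμ.ne_zero hμ.nonempty (H w hw)⟩⟩
    rw [(H w hw).ode t ht, Complex.ofReal_one, one_smul]
  · have h := hμ.isRiccati hr
    have hE : ∀ t, SpaceForms.energy r μ t =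
        μ t ^ 2 + (deriv μ t / ((r - 2) * μ t)) ^ 2 + -1 := fun t => sub_eq_add_neg _ _
    simp only [hE]
    have hode : ∀ ℓ z, SpaceForms.IsLegendreCurve (-1) I μ (fun t => r * μ t) ℓ z →
        ∀ t ∈ I, deriv (deriv z) t =
          (Complex.I * ((r * μ t : ℝ) : ℂ)) • deriv z t + z t := fun ℓ z hz t ht => by
      rw [hz.ode t ht, Complex.ofReal_neg, Complex.ofReal_one, neg_smul, one_smul, sub_neg_eq_add]
    rcases h.trichotomy with ⟨hs, z, hz⟩ | ⟨hs, z, hz⟩ | ⟨hs, z, hz⟩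
    · obtain ⟨γ, hγ, hl, H⟩ := hz.exists_curve (.inr rfl) hμ.ordConnected hμ.nonempty
      exact ⟨γ, hγ, hl, fun w hw => ⟨(H w hw).isUnitSpeedLegendre, hode _ _ (H w hw),
        .inl ⟨hs, SpaceForms.yieldsOnSphere (.inr rfl) hm hμ.ne_zero hμ.nonempty (H w hw)⟩⟩⟩
    · obtain ⟨γ, hγ, hl, H⟩ := hz.exists_curve (.inr rfl) hμ.ordConnected hμ.nonempty
      exact ⟨γ, hγ, hl, fun w hw => ⟨(H w hw).isUnitSpeedLegendre, hode _ _ (H w hw),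
        .inr (.inl ⟨hs,
          SpaceForms.yieldsOnHyperboloid hm hμ.ne_zero hμ.nonempty (H w hw)⟩)⟩⟩
    · obtain ⟨γ, hγ, hl, H⟩ := hz.exists_curve (.inr rfl) hμ.ordConnected hμ.nonempty
      exact ⟨γ, hγ, hl, fun w hw => ⟨(H w hw).isUnitSpeedLegendre, hode _ _ (H w hw),
        .inr (.inr ⟨hs,
          SpaceForms.yieldsOnHorosphere hm hμ.ne_zero hμ.nonempty (H w hw)⟩)⟩⟩
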